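/- There is an absolute constant $c$ such that, for every odd prime power $q$, every set $S$ of $q+2$ points in the Desarguesian projective plane $\mathrm{PG}(2,q)$ over the finite field $\mathbb{F}_q$ has at least $2q-c$ odd secants, where an odd secant of $S$ is a line of $\mathrm{PG}(2,q)$ incident with an odd number of points of $S$. -/

import Mathlib

open scoped LinearAlgebra.Projectivization

/-- The projective plane `PG(2, K)`: the one-dimensional subspaces of `K³`. -/
abbrev ProjPlane (K : Type*) [Field K] : Type _ := ℙ K (Fin 3 → K)

/-- The number of points of `S` incident with `ℓ`, where `ℓ` is a subspace of `K³` (the lines of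
the plane are the two-dimensional subspaces) and a point is incident with `ℓ` when it is
contained in `ℓ` as a subspace. -/
noncomputable def incidentCount {K : Type*} [Field K] (S : Finset (ProjPlane K))
    (ℓ : Submodule K (Fin 3 → K)) : ℕ :=
  {P : ProjPlane K | P ∈ S ∧ P.submodule ≤ ℓ}.ncard

/-- The set of odd secants of `S`: the lines of the plane incident with an odd number of points
of `S`. -/
def oddSecants {K : Type*} [Field K] (S : Finset (ProjPlane K)) :
    Set (Submodule K (Fin 3 → K)) :=
  {ℓ | Module.finrank K ℓ = 2 ∧ Odd (incidentCount S ℓ)}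

/-! Fix a point `x` of `S`. The other `q + 1` points of `S` lie on the `q + 1` lines through `x`, so
over these lines the excesses `|ℓ ∩ S| - 2` add up to zero. If `x` is on no tangent, then all its
lines are bisecants; Segre's product argument allows at most two such points. If `x` is on exactly
one tangent `t`, then it is on exactly one 3-secant `u` and its other lines are bisecants; call it
special. Every other point is on at least two tangents. Hence there are about `2q - |A|` tangents,
where `A` is the set of special points, and it remains to find about `|A|` further odd secants. This
is immediate when few special points share their 3-secants. The other case that works is that the
3-secants of almost all special points pass through one point `P` of `S`: then `P` is on about `|A|
/ 2` of them, and on at least as many tangents.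

That nothing else happens, up to a bounded number of exceptions, is `exists_special_dichotomy`.
Segre's lemma of tangents, applied to triples containing a fixed special point, gives after
rescaling `tᵢ(eⱼ) uⱼ(eᵢ) + uᵢ(eⱼ) tⱼ(eᵢ) = 0` for special points `eᵢ`, `eⱼ` (`SegreFamily`). Any
four points of such a family then define a sextic through all the others. If the four consist of two
pairs, each sharing its 3-secant, the sextic splits off the lines of the two pairs and leaves a
quartic, so many points lie on an irreducible curve `f` of degree at most 4. A weak Bézout theorem
makes `f` a component of many sextics. Their double points force the tangent of `f` at a smooth
point `eᵢ` to be `tᵢ` or `uᵢ`, say `tᵢ`. If `f` is a conic, the `tᵢ` are polars and the `uᵢ` concur.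
If `f` has degree 3 or 4, an auxiliary curve containing `f` gives a contradiction unless many `tᵢ`
concur (`Generic.exists_concurrent_of_gradAt`).

Concurrence at five points spreads to almost the whole family, because a conic is determined by five
points (`Generic.secant_eq_of_concurrent`). If the `tᵢ` concur, the `uᵢ` are polars of distinct
points, hence distinct. If the `uᵢ` concur at `P` and two points share a 3-secant, Segre's lemma for
that pair shows that `P` is the third point of `S` on it. -/

section PlaneCurves

/-! ### Plane curves: homogeneous factors and a weak Bézout theorem. -/

open MvPolynomial

variable {K : Type*} [Field K]

/-- The substitution `Xᵢ ↦ T Xᵢ`, which separates the homogeneous components. -/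
noncomputable def scaleVars (σ : Type*) (K : Type*) [Field K] :
    MvPolynomial σ K →ₐ[K] Polynomial (MvPolynomial σ K) :=
  aeval fun i => Polynomial.X * Polynomial.C (X i)

lemma scaleVars_monomial {σ : Type*} (d : σ →₀ ℕ) (r : K) :
    scaleVars σ K (monomial d r) = Polynomial.monomial d.degree (monomial d r) := by
  rw [scaleVars, aeval_monomial, ← Polynomial.C_mul_X_pow_eq_monomial, monomial_eq,
    Finsupp.degree_apply, Polynomial.C_mul, Finsupp.prod, Finsupp.prod]
  simp only [mul_pow, Finset.prod_mul_distrib, Finset.prod_pow_eq_pow_sum, map_prod, map_pow]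
  have : algebraMap K (Polynomial (MvPolynomial σ K)) r = Polynomial.C (C r) := rfl
  rw [this]
  ring

lemma coeff_scaleVars {σ : Type*} (f : MvPolynomial σ K) (n : ℕ) :
    (scaleVars σ K f).coeff n = homogeneousComponent n f := by
  induction f using MvPolynomial.induction_on' with
  | monomial d r =>
    rw [scaleVars_monomial, Polynomial.coeff_monomial]
    split_ifs with h
    · exact (homogeneousComponent_eq_self (isHomogeneous_monomial r h)).symm
    · rw [homogeneousComponent_of_mem (m := n) (isHomogeneous_monomial r rfl), if_neg (Ne.symm h)]
  | add p q hp hq => rw [map_add, Polynomial.coeff_add, hp, hq, map_add]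

lemma MvPolynomial.IsHomogeneous.of_scaleVars {σ : Type*} {f : MvPolynomial σ K} {n : ℕ}
    (h : ∀ m, m ≠ n → (scaleVars σ K f).coeff m = 0) : f.IsHomogeneous n := by
  rw [← sum_homogeneousComponent f]
  refine IsHomogeneous.sum _ _ _ fun i _ => ?_
  by_cases hi : i = n
  · exact hi ▸ homogeneousComponent_isHomogeneous i f
  · rw [← coeff_scaleVars, h i hi]
    exact isHomogeneous_zero _ _ _

/-- A factor of a nonzero homogeneous polynomial is homogeneous. -/
lemma MvPolynomial.IsHomogeneous.exists_of_mul {σ : Type*} {f g : MvPolynomial σ K} {n : ℕ}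
    (h : (f * g).IsHomogeneous n) (h0 : f * g ≠ 0) :
    ∃ a b, f.IsHomogeneous a ∧ g.IsHomogeneous b ∧ a + b = n := by
  have hf0 : f ≠ 0 := left_ne_zero_of_mul h0
  have hg0 : g ≠ 0 := right_ne_zero_of_mul h0
  have key : scaleVars σ K f * scaleVars σ K g = Polynomial.monomial n (f * g) := by
    ext1 m
    rw [← map_mul, coeff_scaleVars, Polynomial.coeff_monomial]
    split_ifs with hm
    · exact hm ▸ homogeneousComponent_eq_self h
    · rw [homogeneousComponent_of_mem h, if_neg (Ne.symm hm)]
  have hne : scaleVars σ K f * scaleVars σ K g ≠ 0 := by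
    rw [key]; simpa using h0
  have hF : scaleVars σ K f ≠ 0 := left_ne_zero_of_mul hne
  have hG : scaleVars σ K g ≠ 0 := right_ne_zero_of_mul hne
  -- Degree and trailing degree in `T` both add over products and agree on the monomial `key`, so
  -- they agree on each factor: each factor is a single monomial in `T`.
  have hd := Polynomial.natDegree_mul hF hG
  have ht := Polynomial.natTrailingDegree_mul hF hG
  rw [key, Polynomial.natDegree_monomial_eq _ h0] at hd
  rw [key, Polynomial.natTrailingDegree_monomial h0] at ht
  have h1 := Polynomial.natTrailingDegree_le_natDegree (scaleVars σ K f)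
  have h2 := Polynomial.natTrailingDegree_le_natDegree (scaleVars σ K g)
  refine ⟨_, _, .of_scaleVars (n := (scaleVars σ K f).natDegree) fun m hm => ?_,
    .of_scaleVars (n := (scaleVars σ K g).natDegree) fun m hm => ?_, hd.symm⟩
  · rcases lt_or_gt_of_ne hm with hm | hm
    · exact Polynomial.coeff_eq_zero_of_lt_natTrailingDegree (by omega)
    · exact Polynomial.coeff_eq_zero_of_natDegree_lt hm
  · rcases lt_or_gt_of_ne hm with hm | hm
    · exact Polynomial.coeff_eq_zero_of_lt_natTrailingDegree (by omega)
    · exact Polynomial.coeff_eq_zero_of_natDegree_lt hm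

lemma finrank_homogeneousSubmodule (n : ℕ) :
    Module.finrank K (homogeneousSubmodule (Fin 3) K n) = (n + 2).choose 2 := by
  have e : homogeneousSubmodule (Fin 3) K n =
      AddMonoidAlgebra.supported K K {d : Fin 3 →₀ ℕ | d.degree = n} :=
    homogeneousSubmodule_eq_finsupp_supported _ _ n
  have hs : {d : Fin 3 →₀ ℕ | d.degree = n} =
      ((Finset.univ : Finset (Fin 3)).finsuppAntidiag n : Set (Fin 3 →₀ ℕ)) := by
    ext d
    simp [Finset.mem_finsuppAntidiag, Finsupp.degree_eq_sum]
  rw [e, hs]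
  have b := basisRestrictSupport K
    ((Finset.univ : Finset (Fin 3)).finsuppAntidiag n : Set (Fin 3 →₀ ℕ))
  have hb := Module.finrank_eq_card_basis b
  rw [restrictSupport] at hb
  rw [hb]
  simp only [Finset.coe_sort_coe, Fintype.card_coe, Finset.card_finsuppAntidiag_nat_eq_choose,
    Finset.card_univ, Fintype.card_fin]
  rw [show 3 + n - 1 = n + 2 by omega, ← Nat.choose_symm_add]

instance (n : ℕ) : FiniteDimensional K (homogeneousSubmodule (Fin 3) K n) :=
  Module.Finite.iff_fg.mpr (homogeneousSubmodule_fg (Fin 3) K n)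

/-- The linear form with coefficient vector `a`. -/
noncomputable def linForm (a : Fin 3 → K) : MvPolynomial (Fin 3) K := ∑ i, C (a i) * X i

lemma eval_linForm (a x : Fin 3 → K) : eval x (linForm a) = a ⬝ᵥ x := by
  simp [linForm, dotProduct]

lemma isHomogeneous_linForm (a : Fin 3 → K) : (linForm a).IsHomogeneous 1 :=
  IsHomogeneous.sum _ _ _ fun _ _ => isHomogeneous_C_mul_X _ _

lemma exists_dotProduct_eq_zero_of_crossProduct_ne_zero {x y : Fin 3 → K}
    (h : crossProduct x y ≠ 0) : ∃ a, a ⬝ᵥ y = 0 ∧ a ⬝ᵥ x ≠ 0 := by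
  by_contra! H
  refine h (dotProduct_eq_zero _ fun v => ?_)
  rw [dotProduct_comm, triple_product_permutation, dotProduct_comm]
  exact H _ (by rw [dotProduct_comm, dot_self_cross])

/-- Finitely many distinct points of the plane impose independent conditions on the forms of
large degree. -/
lemma exists_form_separating {ι : Type*} (s : Finset ι) (e : ι → Fin 3 → K)
    (he : ∀ i ∈ s, ∀ j ∈ s, i ≠ j → crossProduct (e i) (e j) ≠ 0) (he0 : ∀ i ∈ s, e i ≠ 0)
    {n : ℕ} (hn : s.card ≤ n) {i : ι} (hi : i ∈ s) :
    ∃ p : MvPolynomial (Fin 3) K, p.IsHomogeneous n ∧ eval (e i) p ≠ 0 ∧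
      ∀ j ∈ s, j ≠ i → eval (e j) p = 0 := by
  classical
  have h1 : ∀ j, ∃ a : Fin 3 → K, j ∈ s.erase i → a ⬝ᵥ e j = 0 ∧ a ⬝ᵥ e i ≠ 0 := fun j => by
    by_cases hj : j ∈ s.erase i
    · obtain ⟨a, ha⟩ := exists_dotProduct_eq_zero_of_crossProduct_ne_zero
        (he i hi j (Finset.mem_of_mem_erase hj) (Finset.ne_of_mem_erase hj).symm)
      exact ⟨a, fun _ => ha⟩
    · exact ⟨0, fun h => absurd h hj⟩
  choose a ha using h1
  obtain ⟨b, hb⟩ : ∃ b : Fin 3 → K, b ⬝ᵥ e i ≠ 0 := by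
    by_contra! H
    exact he0 i hi (dotProduct_eq_zero _ fun v => by rw [dotProduct_comm, H])
  -- Take one line through each other point that misses `e i`, and pad to degree `n` with a line
  -- missing `e i`.
  refine ⟨(∏ j ∈ s.erase i, linForm (a j)) * linForm b ^ (n - (s.erase i).card), ?_, ?_, ?_⟩
  · have h2 := (IsHomogeneous.prod (s.erase i) (fun j => linForm (a j)) (fun _ => 1)
      fun j _ => isHomogeneous_linForm (a j)).mul
        ((isHomogeneous_linForm b).pow (n - (s.erase i).card))
    convert h2 using 1
    have := Finset.card_erase_le (a := i) (s := s)
    simp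
    omega
  · simp only [map_mul, map_prod, map_pow, eval_linForm]
    exact mul_ne_zero (Finset.prod_ne_zero_iff.mpr fun j hj => (ha j hj).2) (pow_ne_zero _ hb)
  · intro j hj hji
    have hj' : j ∈ s.erase i := Finset.mem_erase.mpr ⟨hji, hj⟩
    rw [map_mul, map_prod, Finset.prod_eq_zero hj' (by rw [eval_linForm, (ha j hj').1]), zero_mul]

/-- Weak form of Bézout's theorem: an irreducible plane curve of degree `d` and a plane curve of
degree `k` that does not contain it have at most `dk` common points. -/
theorem card_le_of_irreducible {f g : MvPolynomial (Fin 3) K} {d k : ℕ} (hf : f.IsHomogeneous d)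
    (hirr : Irreducible f) (hg : g.IsHomogeneous k) (hfg : ¬ f ∣ g) {ι : Type*} (s : Finset ι)
    (e : ι → Fin 3 → K) (he : ∀ i ∈ s, ∀ j ∈ s, i ≠ j → crossProduct (e i) (e j) ≠ 0)
    (he0 : ∀ i ∈ s, e i ≠ 0) (hef : ∀ i ∈ s, eval (e i) f = 0)
    (heg : ∀ i ∈ s, eval (e i) g = 0) : s.card ≤ d * k := by
  classical
  set V : ℕ → Submodule K (MvPolynomial (Fin 3) K) := homogeneousSubmodule (Fin 3) K with hV
  set c := s.card
  have hp : Prime f := hirr.prime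
  -- The Koszul complex of `f`, `g` in degree `c + d + k`. As `f` is prime and does not divide `g`,
  -- every syzygy is a multiple of `(-g, f)`. The degree is at least the number `c` of points, so
  -- evaluation at them is onto, and it kills the image of `Φ`.
  let Φ : (V (c + k) × V (c + d)) →ₗ[K] V (c + d + k) :=
    LinearMap.codRestrict _
      (((LinearMap.mulRight K f).comp (V (c + k)).subtype).coprod
        ((LinearMap.mulRight K g).comp (V (c + d)).subtype)) (by
      rintro ⟨⟨x, hx⟩, ⟨y, hy⟩⟩
      have h1 := IsHomogeneous.mul hx hf
      have h2 := IsHomogeneous.mul hy hg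
      rw [add_right_comm] at h1
      exact h1.add h2)
  have hΦ : ∀ z, (Φ z : MvPolynomial (Fin 3) K) = z.1.1 * f + z.2.1 * g := fun z => rfl
  let Ψ : V c →ₗ[K] (V (c + k) × V (c + d)) :=
    LinearMap.prod
      (LinearMap.codRestrict _ ((LinearMap.mulRight K (-g)).comp (V c).subtype)
        fun x => IsHomogeneous.mul x.2 hg.neg)
      (LinearMap.codRestrict _ ((LinearMap.mulRight K f).comp (V c).subtype)
        fun x => IsHomogeneous.mul x.2 hf)
  have hΨ1 : ∀ z, ((Ψ z).1 : MvPolynomial (Fin 3) K) = z.1 * -g := fun z => rfl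
  have hΨ2 : ∀ z, ((Ψ z).2 : MvPolynomial (Fin 3) K) = z.1 * f := fun z => rfl
  let ev : V (c + d + k) →ₗ[K] (s → K) :=
    LinearMap.pi fun i => (aeval (e i)).toLinearMap.comp (V (c + d + k)).subtype
  have hev : ∀ z i, ev z i = eval (e i) z.1 := fun z i => by
    simp [ev, aeval_eq_eval]
  have hker : LinearMap.ker Φ ≤ LinearMap.range Ψ := by
    rintro ⟨⟨x, hx⟩, ⟨y, hy⟩⟩ hz
    have h0 : x * f + y * g = 0 := by
      have := congrArg Subtype.val (LinearMap.mem_ker.mp hz)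
      rwa [hΦ] at this
    have hdvd : f ∣ y * g := ⟨-x, by linear_combination h0⟩
    obtain ⟨w, hw⟩ := (hp.dvd_or_dvd hdvd).resolve_right hfg
    have hx' : x = w * -g := mul_right_cancel₀ hirr.ne_zero (by rw [hw] at h0; linear_combination h0)
    have hwc : w.IsHomogeneous c := by
      by_cases hw0 : w = 0
      · exact hw0 ▸ isHomogeneous_zero _ _ _
      · have hne : f * w ≠ 0 := mul_ne_zero hirr.ne_zero hw0
        obtain ⟨a, b, ha, hb, hab⟩ := IsHomogeneous.exists_of_mul (n := c + d) (hw ▸ hy) hne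
        have := ha.inj_right hf hirr.ne_zero
        have hbc : b = c := by omega
        exact hbc ▸ hb
    refine ⟨⟨w, hwc⟩, Prod.ext (Subtype.ext ?_) (Subtype.ext ?_)⟩
    · exact (hΨ1 _).trans hx'.symm
    · exact (hΨ2 _).trans ((mul_comm _ _).trans hw.symm)
  have hsurj : Function.Surjective ev := by
    rw [← LinearMap.range_eq_top, eq_top_iff, ← (Pi.basisFun K s).span_eq, Submodule.span_le]
    rintro _ ⟨i, rfl⟩
    obtain ⟨p, hp1, hp2, hp3⟩ := exists_form_separating s e he he0
      (n := c + d + k) (by omega) i.2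
    refine ⟨(eval (e i) p)⁻¹ • ⟨p, hp1⟩, ?_⟩
    ext j
    rw [map_smul, Pi.smul_apply, hev, Pi.basisFun_apply]
    by_cases hij : j = i
    · subst hij; simp [hp2]
    · rw [hp3 j j.2 fun h => hij (Subtype.ext h)]
      simp [hij]
  have hle : LinearMap.range Φ ≤ LinearMap.ker ev := by
    rintro _ ⟨z, rfl⟩
    ext i
    rw [hev, hΦ]
    simp [hef i i.2, heg i i.2]
  have r1 := LinearMap.finrank_range_add_finrank_ker Φ
  have r2 := LinearMap.finrank_range_add_finrank_ker ev
  have r3 := Submodule.finrank_mono hker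
  have r4 := LinearMap.finrank_range_le Ψ
  have r5 := Submodule.finrank_mono hle
  rw [LinearMap.range_eq_top.mpr hsurj, finrank_top, Module.finrank_fintype_fun_eq_card,
    Fintype.card_coe] at r2
  rw [Module.finrank_prod] at r1
  have hfr : ∀ n, Module.finrank K (V n) = (n + 2).choose 2 := finrank_homogeneousSubmodule
  rw [hfr, hfr] at r1
  rw [hfr] at r2 r4
  -- With `h n = (n + 2).choose 2`, the dimensions leave room for at most `h (c + d + k) - h (c + d)
  -- - h (c + k) + h c = d * k` points.
  have hch : ∀ n : ℕ, ((n + 2).choose 2 : ℤ) * 2 = (n + 2) * (n + 1) := fun n => by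
    rw [Nat.choose_two_right]
    have := Nat.even_mul_pred_self (n + 2)
    have h2 := Nat.div_mul_cancel this.two_dvd
    zify at h2
    push_cast at h2 ⊢
    linarith
  have c1 := hch (c + k)
  have c2 := hch (c + d)
  have c3 := hch (c + d + k)
  have c4 := hch c
  push_cast at c1 c2 c3 c4
  zify at r1 r2 r3 r4 r5 ⊢
  nlinarith

end PlaneCurves

/-! ### Components with many points, restriction to lines, gradients and polars. -/

section PlaneCurves

open MvPolynomial

variable {K : Type*} [Field K]

/-- The points where a nonzero form of degree `n` vanishes include a proportion `1 / n` lying on a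
single irreducible component. -/
lemma exists_irreducible_of_isHomogeneous {ι : Type*} (e : ι → Fin 3 → K) (n : ℕ) :
    ∀ {F : MvPolynomial (Fin 3) K}, F ≠ 0 → F.IsHomogeneous n → ∀ {s : Finset ι}, s.Nonempty →
      (∀ i ∈ s, eval (e i) F = 0) →
      ∃ f d, Irreducible f ∧ f.IsHomogeneous d ∧ d ≤ n ∧
        ∃ s' ⊆ s, s.card ≤ n * s'.card ∧ ∀ i ∈ s', eval (e i) f = 0 := by
  classical
  have hunit : ∀ (a : MvPolynomial (Fin 3) K), a ≠ 0 → ¬ IsUnit a → ¬ a.IsHomogeneous 0 := by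
    intro a ha0 ha h
    rw [← totalDegree_zero_iff_isHomogeneous, totalDegree_eq_zero_iff_eq_C] at h
    refine ha ?_
    rw [h]
    refine (IsUnit.mk0 _ fun h0 => ha0 ?_).map C
    rw [h, h0, C_0]
  induction n using Nat.strong_induction_on with
  | _ n ih =>
  intro F hF0 hF s hs hv
  by_cases hirr : Irreducible F
  · refine ⟨F, n, hirr, hF, le_rfl, s, Finset.Subset.refl _, ?_, hv⟩
    have : n ≠ 0 := by
      rintro rfl
      exact hunit F hF0 hirr.not_isUnit hF
    exact Nat.le_mul_of_pos_left _ (Nat.pos_of_ne_zero this)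
  · have hnu : ¬ IsUnit F := by
      intro hu
      obtain ⟨i, hi⟩ := hs
      have := hu.map (eval (e i))
      rw [hv i hi] at this
      exact not_isUnit_zero this
    rw [irreducible_iff] at hirr
    push Not at hirr
    obtain ⟨a, b, hab, ha, hb⟩ := hirr hnu
    have ha0 : a ≠ 0 := left_ne_zero_of_mul (hab ▸ hF0)
    have hb0 : b ≠ 0 := right_ne_zero_of_mul (hab ▸ hF0)
    obtain ⟨k, l, hk, hl, hkl⟩ := IsHomogeneous.exists_of_mul (hab ▸ hF) (hab ▸ hF0)
    have hk0 : k ≠ 0 := by rintro rfl; exact hunit a ha0 ha hk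
    have hl0 : l ≠ 0 := by rintro rfl; exact hunit b hb0 hb hl
    have hcard : s.card ≤ (s.filter fun i => eval (e i) a = 0).card +
        (s.filter fun i => eval (e i) b = 0).card := by
      refine le_trans (Finset.card_le_card fun i hi => ?_) (Finset.card_union_le _ _)
      have h := hv i hi
      rw [hab, map_mul, mul_eq_zero] at h
      simpa [hi] using h
    have hs0 : 0 < s.card := hs.card_pos
    have step : ∀ (c : MvPolynomial (Fin 3) K) (m : ℕ), c ≠ 0 → c.IsHomogeneous m → 0 < m → m < n →
        m * s.card ≤ n * (s.filter fun i => eval (e i) c = 0).card →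
        ∃ f d, Irreducible f ∧ f.IsHomogeneous d ∧ d ≤ n ∧
          ∃ s' ⊆ s, s.card ≤ n * s'.card ∧ ∀ i ∈ s', eval (e i) f = 0 := by
      intro c m hc0 hc hm hmn hle
      have hne : (s.filter fun i => eval (e i) c = 0).Nonempty := by
        rw [← Finset.card_pos]
        by_contra h0
        have : 0 < m * s.card := Nat.mul_pos hm hs0
        simp only [not_lt, Nat.le_zero] at h0
        rw [h0] at hle
        omega
      obtain ⟨f, d, h1, h2, h3, s', h4, h5, h6⟩ := ih m hmn hc0 hc hne
        fun i hi => (Finset.mem_filter.mp hi).2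
      refine ⟨f, d, h1, h2, h3.trans hmn.le, s', h4.trans (Finset.filter_subset _ _), ?_, h6⟩
      refine le_of_mul_le_mul_left (a := m) ?_ hm
      calc m * s.card ≤ n * _ := hle
        _ ≤ n * (m * s'.card) := Nat.mul_le_mul_left _ h5
        _ = m * (n * s'.card) := by ring
    -- Pigeonhole weighted by degree: since `k + l = n`, either `a` vanishes on a proportion `k / n`
    -- of the points or `b` on a proportion `l / n`. Induction on that factor then gives `1 / n`.
    by_cases hc : k * s.card ≤ n * (s.filter fun i => eval (e i) a = 0).card
    · exact step a k ha0 hk (Nat.pos_of_ne_zero hk0) (by omega) hc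
    · refine step b l hb0 hl (Nat.pos_of_ne_zero hl0) (by omega) ?_
      subst hkl
      nlinarith

/-- The restriction of a polynomial to the line `x + s v`, as a polynomial in `s`. -/
noncomputable def alongLine (x v : Fin 3 → K) : MvPolynomial (Fin 3) K →ₐ[K] Polynomial K :=
  aeval fun i => Polynomial.C (x i) + Polynomial.C (v i) * Polynomial.X

lemma eval_alongLine (x v : Fin 3 → K) (f : MvPolynomial (Fin 3) K) (s : K) :
    (alongLine x v f).eval s = eval (x + s • v) f := by
  have h : (Polynomial.aeval s).comp (alongLine x v) = aeval (x + s • v) := by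
    ext i
    simp only [alongLine, AlgHom.comp_apply, aeval_X, map_add, map_mul, Polynomial.aeval_C,
      Polynomial.aeval_X, Pi.add_apply, Pi.smul_apply, smul_eq_mul, mul_comm s]
    rfl
  rw [← Polynomial.coe_aeval_eq_eval, ← AlgHom.comp_apply, h, aeval_eq_eval]

lemma coeff_zero_alongLine (x v : Fin 3 → K) (f : MvPolynomial (Fin 3) K) :
    (alongLine x v f).coeff 0 = eval x f := by
  rw [Polynomial.coeff_zero_eq_eval_zero, eval_alongLine, zero_smul, add_zero]

lemma alongLine_linForm (x v a : Fin 3 → K) :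
    alongLine x v (linForm a) =
      Polynomial.C (a ⬝ᵥ x) + Polynomial.C (a ⬝ᵥ v) * Polynomial.X := by
  have hC : ∀ c : K, algebraMap K (Polynomial K) c = Polynomial.C c := fun _ => rfl
  simp only [linForm, alongLine, map_mul, aeval_X, ← algebraMap_eq, AlgHom.commutes, hC,
    dotProduct, Fin.sum_univ_three, map_add]
  ring

/-- The gradient of a polynomial at a point. -/
noncomputable def gradAt (f : MvPolynomial (Fin 3) K) (x : Fin 3 → K) : Fin 3 → K :=
  fun i => eval x (pderiv i f)

lemma derivative_alongLine (x v : Fin 3 → K) (f : MvPolynomial (Fin 3) K) :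
    (alongLine x v f).derivative = ∑ i, Polynomial.C (v i) * alongLine x v (pderiv i f) := by
  induction f using MvPolynomial.induction_on with
  | C a =>
    have : alongLine x v (C a) = Polynomial.C a := (alongLine x v).commutes a
    simp [this]
  | add p q hp hq => simp [hp, hq, mul_add, Finset.sum_add_distrib]
  | mul_X p j hp =>
    have hX : alongLine x v (X j) = Polynomial.C (x j) + Polynomial.C (v j) * Polynomial.X := by
      simp [alongLine]
    have hX' : ∀ i, Polynomial.C (v i) * alongLine x v (pderiv i (X j : MvPolynomial (Fin 3) K)) =
        if i = j then Polynomial.C (v j) else 0 := by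
      intro i
      split_ifs with h
      · subst h; simp
      · rw [pderiv_X_of_ne (Ne.symm h)]; simp
    simp only [map_mul, Polynomial.derivative_mul, hp, hX, pderiv_mul, map_add, mul_add,
      Finset.sum_add_distrib]
    have h1 : ∑ i, Polynomial.C (v i) * (alongLine x v p * alongLine x v (pderiv i (X j))) =
        alongLine x v p * Polynomial.C (v j) := by
      have : ∀ i, Polynomial.C (v i) * (alongLine x v p * alongLine x v (pderiv i (X j))) =
          alongLine x v p * if i = j then Polynomial.C (v j) else 0 := by
        intro i; rw [← hX']; ring
      rw [Finset.sum_congr rfl fun i _ => this i]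
      simp
    rw [h1, Finset.sum_mul, Finset.sum_mul, add_comm]
    simp only [Fin.sum_univ_three, Polynomial.derivative_C, Polynomial.derivative_X]
    ring

lemma coeff_one_alongLine (x v : Fin 3 → K) (f : MvPolynomial (Fin 3) K) :
    (alongLine x v f).coeff 1 = gradAt f x ⬝ᵥ v := by
  have h := congrArg (fun p => Polynomial.coeff p 0) (derivative_alongLine x v f)
  simp only [Polynomial.coeff_derivative, Polynomial.finsetSum_coeff, Polynomial.coeff_C_mul,
    coeff_zero_alongLine] at h
  simp only [dotProduct, gradAt]
  simpa [mul_comm] using h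

/-- The first polar of the point `x` with respect to `f`. -/
noncomputable def polar (x : Fin 3 → K) (f : MvPolynomial (Fin 3) K) : MvPolynomial (Fin 3) K :=
  ∑ i, C (x i) * pderiv i f

lemma eval_polar (x y : Fin 3 → K) (f : MvPolynomial (Fin 3) K) :
    eval y (polar x f) = gradAt f y ⬝ᵥ x := by
  simp [polar, gradAt, dotProduct, mul_comm]

lemma isHomogeneous_polar (x : Fin 3 → K) {f : MvPolynomial (Fin 3) K} {d : ℕ}
    (hf : f.IsHomogeneous d) : (polar x f).IsHomogeneous (d - 1) :=
  IsHomogeneous.sum _ _ _ fun _ _ => hf.pderiv.C_mul _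

/-- Along `x + s v`, Euler's identity splits `d f` into the polar of `x` and `s` times the
derivative in `s`. -/
lemma alongLine_polar (x v : Fin 3 → K) {f : MvPolynomial (Fin 3) K} {d : ℕ}
    (hf : f.IsHomogeneous d) :
    alongLine x v (polar x f) =
      d • alongLine x v f - Polynomial.X * (alongLine x v f).derivative := by
  have hX : ∀ j, alongLine x v (X j) = Polynomial.C (x j) + Polynomial.C (v j) * Polynomial.X := by
    simp [alongLine]
  have hC : ∀ c : K, alongLine x v (C c) = Polynomial.C c := fun c => (alongLine x v).commutes c
  have h := congrArg (alongLine x v) hf.sum_X_mul_pderiv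
  rw [map_nsmul] at h
  rw [← h, derivative_alongLine]
  simp only [polar, map_sum, map_mul, hX, hC, Finset.mul_sum, ← Finset.sum_sub_distrib]
  exact Finset.sum_congr rfl fun i _ => by ring

lemma gradAt_dotProduct_self {f : MvPolynomial (Fin 3) K} {d : ℕ} (hf : f.IsHomogeneous d)
    (x : Fin 3 → K) : gradAt f x ⬝ᵥ x = d * eval x f := by
  have h := congrArg (eval x) hf.sum_X_mul_pderiv
  simp only [map_sum, map_mul, eval_X, nsmul_eq_mul, map_natCast] at h
  rw [← h]
  simp [gradAt, dotProduct, mul_comm]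

/-- The point `v` of the line `x + s v` sits at `s = ∞`, so the value there is read off the
coefficient of degree `d`. -/
lemma alongLine_top {f : MvPolynomial (Fin 3) K} {d : ℕ} (hf : f.IsHomogeneous d)
    (x v : Fin 3 → K) :
    (alongLine x v f).natDegree ≤ d ∧ (alongLine x v f).coeff d = eval v f := by
  have hl : ∀ i, (Polynomial.C (x i) + Polynomial.C (v i) * Polynomial.X).natDegree ≤ 1 :=
    fun i => by
      rw [add_comm]; exact Polynomial.natDegree_linear_le
  have hmon : ∀ (m : Fin 3 →₀ ℕ) (c : K), m.degree = d →
      (alongLine x v (monomial m c)).natDegree ≤ d ∧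
        (alongLine x v (monomial m c)).coeff d = eval v (monomial m c) := by
    intro m c hm
    have e1 : alongLine x v (monomial m c) = Polynomial.C c *
        ∏ i, (Polynomial.C (x i) + Polynomial.C (v i) * Polynomial.X) ^ m i := by
      rw [alongLine, aeval_monomial, Finsupp.prod_fintype _ _ (by simp)]
      rfl
    have hp : ∀ i ∈ (Finset.univ : Finset (Fin 3)),
        ((Polynomial.C (x i) + Polynomial.C (v i) * Polynomial.X) ^ m i).natDegree ≤ m i := by
      intro i _
      simpa using Polynomial.natDegree_pow_le_of_le (m i) (hl i)
    have hd : ∑ i, m i = d := by rw [← hm, Finsupp.degree_eq_sum]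
    constructor
    · rw [e1]
      refine (Polynomial.natDegree_C_mul_le _ _).trans ?_
      rw [← hd]
      exact (Polynomial.natDegree_prod_le _ _).trans (Finset.sum_le_sum hp)
    · have hc : ∀ i, ((Polynomial.C (x i) + Polynomial.C (v i) * Polynomial.X) ^ m i).coeff (m i) =
          v i ^ m i := fun i => by
        have := Polynomial.coeff_pow_of_natDegree_le (m := m i) (hl i)
        rw [mul_one] at this
        rw [this]
        simp
      rw [e1, Polynomial.coeff_C_mul, ← hd, eval_monomial, Finsupp.prod_fintype _ _ (by simp)]
      have h01 := Polynomial.natDegree_mul_le_of_le (hp 0 (Finset.mem_univ _))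
        (hp 1 (Finset.mem_univ _))
      rw [Fin.prod_univ_three, Fin.sum_univ_three, Fin.prod_univ_three,
        Polynomial.coeff_mul_add_eq_of_natDegree_le h01 (hp 2 (Finset.mem_univ _)),
        Polynomial.coeff_mul_add_eq_of_natDegree_le (hp 0 (Finset.mem_univ _))
        (hp 1 (Finset.mem_univ _)), hc, hc, hc]
  rw [f.as_sum]
  simp only [map_sum, Polynomial.finsetSum_coeff]
  have hdeg : ∀ m ∈ f.support, m.degree = d := fun m hm => (hf.degree_eq_sum_deg_support hm).symm
  constructor
  · exact Polynomial.natDegree_sum_le_of_forall_le _ _ fun m hm => (hmon m _ (hdeg m hm)).1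
  · exact Finset.sum_congr rfl fun m hm => (hmon m _ (hdeg m hm)).2

end PlaneCurves

/-! ### Determinants, joins and intersections in coordinates. -/

section VectorAlgebra

variable {K : Type*} [Field K]

/-- The determinant of three vectors of `K³`. -/
def det3 (u v w : Fin 3 → K) : K := u ⬝ᵥ crossProduct v w

lemma dotProduct_three (a b : Fin 3 → K) : a ⬝ᵥ b = a 0 * b 0 + a 1 * b 1 + a 2 * b 2 := by
  simp [dotProduct, Fin.sum_univ_three]

lemma det3_expand (u v w : Fin 3 → K) :
    det3 u v w = u 0 * (v 1 * w 2 - v 2 * w 1) + u 1 * (v 2 * w 0 - v 0 * w 2) +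
      u 2 * (v 0 * w 1 - v 1 * w 0) := by
  rw [det3, dotProduct_three, cross_apply]
  rfl

lemma crossProduct_dotProduct (u v w : Fin 3 → K) : crossProduct u v ⬝ᵥ w = det3 w u v :=
  dotProduct_comm _ _

lemma cramer_three (a b c y : Fin 3 → K) :
    det3 a b c • y = det3 y b c • a + det3 a y c • b + det3 a b y • c := by
  ext i
  fin_cases i <;> simp [det3_expand] <;> ring

lemma exists_smul_of_crossProduct_eq_zero {x y : Fin 3 → K} (h : crossProduct x y = 0)
    (hy : y ≠ 0) : ∃ k : K, x = k • y := by
  obtain ⟨i, hi⟩ := Function.ne_iff.mp hy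
  simp only [Pi.zero_apply] at hi
  rw [cross_apply] at h
  have h0 := congrFun h 0
  have h1 := congrFun h 1
  have h2 := congrFun h 2
  simp at h0 h1 h2
  refine ⟨x i / y i, ?_⟩
  ext j
  simp only [Pi.smul_apply, smul_eq_mul]
  field_simp
  fin_cases i <;> fin_cases j <;> simp <;>
    first
    | ring1
    | linear_combination h0
    | linear_combination -h0
    | linear_combination h1
    | linear_combination -h1
    | linear_combination h2
    | linear_combination -h2

lemma crossProduct_ne_zero_of_dotProduct {a x y : Fin 3 → K} (hx : a ⬝ᵥ x = 0) (hy : a ⬝ᵥ y ≠ 0)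
    (hx0 : x ≠ 0) : crossProduct x y ≠ 0 := by
  intro h
  rw [← cross_anticomm, neg_eq_zero] at h
  obtain ⟨k, rfl⟩ := exists_smul_of_crossProduct_eq_zero h hx0
  exact hy (by rw [dotProduct_smul, hx, smul_zero])

lemma exists_dotProduct_ne_zero {a : Fin 3 → K} (ha : a ≠ 0) : ∃ w, a ⬝ᵥ w ≠ 0 := by
  by_contra! H
  exact ha (dotProduct_eq_zero _ H)

lemma exists_smul_crossProduct {e t u : Fin 3 → K} (ht : t ⬝ᵥ e = 0) (hu : u ⬝ᵥ e = 0)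
    (he : e ≠ 0) (htu : crossProduct t u ≠ 0) : ∃ k : K, k ≠ 0 ∧ e = k • crossProduct t u := by
  obtain ⟨k, hk⟩ := exists_smul_of_crossProduct_eq_zero (x := e) (y := crossProduct t u)
    (by rw [cross_cross_eq_smul_sub_smul', ht, dotProduct_comm, hu, zero_smul, zero_smul, sub_zero]) htu
  refine ⟨k, ?_, hk⟩
  rintro rfl
  exact he (by rw [hk, zero_smul])

lemma exists_dotProduct_eq {t u : Fin 3 → K} (htu : crossProduct t u ≠ 0) (a b : K) :
    ∃ v, t ⬝ᵥ v = a ∧ u ⬝ᵥ v = b := by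
  obtain ⟨w, hw⟩ := exists_dotProduct_ne_zero htu
  rw [crossProduct_dotProduct, det3_expand] at hw
  refine ⟨(crossProduct t u ⬝ᵥ w)⁻¹ • (a • crossProduct u w + b • crossProduct w t), ?_, ?_⟩
  all_goals
    rw [crossProduct_dotProduct, det3_expand, dotProduct_smul, smul_eq_mul, inv_mul_eq_iff_eq_mul₀ hw]
    simp only [dotProduct_three, cross_apply, Pi.add_apply, Pi.smul_apply, smul_eq_mul]
    simp
    ring

lemma exists_eq_smul_add_smul {e t u g : Fin 3 → K} (ht : t ⬝ᵥ e = 0) (hu : u ⬝ᵥ e = 0)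
    (hg : g ⬝ᵥ e = 0) (he : e ≠ 0) (htu : crossProduct t u ≠ 0) :
    ∃ a b : K, g = a • t + b • u := by
  obtain ⟨w, hw⟩ := exists_dotProduct_ne_zero htu
  obtain ⟨k, hk, rfl⟩ := exists_smul_crossProduct ht hu he htu
  have hg' : det3 t u g = 0 := by
    rw [dotProduct_smul, smul_eq_zero_iff_right hk] at hg
    rw [← hg]; simp only [det3_expand, dotProduct_three, cross_apply]; simp; ring
  have h := cramer_three t u w g
  rw [hg', zero_smul, add_zero] at h
  have hw' : det3 t u w ≠ 0 := by
    convert hw using 1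
    simp only [crossProduct_dotProduct, det3_expand]; ring
  refine ⟨(det3 t u w)⁻¹ * det3 g u w, (det3 t u w)⁻¹ * det3 t g w, ?_⟩
  rw [mul_smul, mul_smul, ← smul_add, ← h, smul_smul, inv_mul_cancel₀ hw', one_smul]

end VectorAlgebra

/-! ### Segre families and the sextics through them. -/

section SegreFamilies

variable {K : Type*} [Field K] {ι : Type*}

/-- A family of points `e i` of the plane, each with two lines `t i` and `u i` through it, which
satisfies the relation that Segre's lemma of tangents gives for points of a set of size `q + 2`
lying on exactly one tangent `t i` and one 3-secant `u i`. -/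
structure SegreFamily (ι K : Type*) [Field K] where
  /-- the points -/
  e : ι → Fin 3 → K
  /-- the tangents -/
  t : ι → Fin 3 → K
  /-- the 3-secants -/
  u : ι → Fin 3 → K
  e_ne_zero : ∀ i, e i ≠ 0
  t_self : ∀ i, t i ⬝ᵥ e i = 0
  u_self : ∀ i, u i ⬝ᵥ e i = 0
  cross_ne_zero : ∀ i, crossProduct (t i) (u i) ≠ 0
  rel : ∀ i j, (t i ⬝ᵥ e j) * (u j ⬝ᵥ e i) + (u i ⬝ᵥ e j) * (t j ⬝ᵥ e i) = 0

namespace SegreFamily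

/-- Exchange the roles of the tangents and the 3-secants. -/
def swap (F : SegreFamily ι K) : SegreFamily ι K where
  e := F.e
  t := F.u
  u := F.t
  e_ne_zero := F.e_ne_zero
  t_self := F.u_self
  u_self := F.t_self
  cross_ne_zero i h := F.cross_ne_zero i (by rw [← cross_anticomm, h, neg_zero])
  rel i j := by rw [add_comm]; exact F.rel i j

/-- Scale the two linear forms at each point by a common factor. -/
def rescale (F : SegreFamily ι K) (c : ι → K) (hc : ∀ i, c i ≠ 0) : SegreFamily ι K where
  e := F.e
  t i := c i • F.t i
  u i := c i • F.u i
  e_ne_zero := F.e_ne_zero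
  t_self i := by rw [smul_dotProduct, F.t_self, smul_zero]
  u_self i := by rw [smul_dotProduct, F.u_self, smul_zero]
  cross_ne_zero i h := F.cross_ne_zero i <| by
    rw [map_smul, map_smul, LinearMap.smul_apply, smul_smul] at h
    exact (smul_eq_zero.mp h).resolve_left (mul_ne_zero (hc i) (hc i))
  rel i j := by
    simp only [smul_dotProduct, smul_eq_mul]
    linear_combination c i * c j * F.rel i j

/-- A set of points of the family in general position: none is on a line attached to another one
and no three are collinear. -/
structure Generic (F : SegreFamily ι K) (s : Finset ι) : Prop where
  t_ne : ∀ i ∈ s, ∀ j ∈ s, i ≠ j → F.t i ⬝ᵥ F.e j ≠ 0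
  u_ne : ∀ i ∈ s, ∀ j ∈ s, i ≠ j → F.u i ⬝ᵥ F.e j ≠ 0
  det_ne : ∀ i ∈ s, ∀ j ∈ s, ∀ k ∈ s, i ≠ j → i ≠ k → j ≠ k → det3 (F.e i) (F.e j) (F.e k) ≠ 0

variable {F : SegreFamily ι K} {s : Finset ι}

lemma Generic.swap (h : F.Generic s) : F.swap.Generic s := ⟨h.u_ne, h.t_ne, h.det_ne⟩

lemma Generic.mono (h : F.Generic s) {s' : Finset ι} (hs : s' ⊆ s) : F.Generic s' :=
  ⟨fun i hi j hj => h.t_ne i (hs hi) j (hs hj), fun i hi j hj => h.u_ne i (hs hi) j (hs hj),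
    fun i hi j hj k hk => h.det_ne i (hs hi) j (hs hj) k (hs hk)⟩

lemma Generic.rescale (h : F.Generic s) (c : ι → K) (hc : ∀ i, c i ≠ 0) :
    (F.rescale c hc).Generic s where
  t_ne i hi j hj hij := by
    change c i • F.t i ⬝ᵥ F.e j ≠ 0
    rw [smul_dotProduct]
    exact smul_ne_zero (hc i) (h.t_ne i hi j hj hij)
  u_ne i hi j hj hij := by
    change c i • F.u i ⬝ᵥ F.e j ≠ 0
    rw [smul_dotProduct]
    exact smul_ne_zero (hc i) (h.u_ne i hi j hj hij)
  det_ne := h.det_ne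

lemma Generic.crossProduct_ne_zero (h : F.Generic s) :
    ∀ i ∈ s, ∀ j ∈ s, i ≠ j → crossProduct (F.e i) (F.e j) ≠ 0 := fun i hi j hj hij =>
  crossProduct_ne_zero_of_dotProduct (F.t_self i) (h.t_ne i hi j hj hij) (F.e_ne_zero i)

/-- As `e i` is a multiple of `t i × u i`, the forms `t i` and `u i` are coordinates on the pencil
at `e i`; this is the Binet–Cauchy identity. -/
lemma exists_det3_eq (F : SegreFamily ι K) (i : ι) : ∃ k : K, k ≠ 0 ∧ ∀ y z,
    det3 (F.e i) y z =
      k * ((F.t i ⬝ᵥ y) * (F.u i ⬝ᵥ z) - (F.t i ⬝ᵥ z) * (F.u i ⬝ᵥ y)) := by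
  obtain ⟨k, hk, h⟩ := exists_smul_crossProduct (F.t_self i) (F.u_self i) (F.e_ne_zero i)
    (F.cross_ne_zero i)
  refine ⟨k, hk, fun y z => ?_⟩
  rw [h, det3, smul_dotProduct, cross_dot_cross, smul_eq_mul]

open MvPolynomial

/-- The conic `uᵢ tⱼ = uⱼ tᵢ`. -/
noncomputable def conic (F : SegreFamily ι K) (i j : ι) : MvPolynomial (Fin 3) K :=
  linForm (F.u i) * linForm (F.t j) - linForm (F.u j) * linForm (F.t i)

/-- The line through the points `e i` and `e j`. -/
noncomputable def join (F : SegreFamily ι K) (i j : ι) : MvPolynomial (Fin 3) K :=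
  linForm (crossProduct (F.e i) (F.e j))

lemma eval_join (F : SegreFamily ι K) (i j : ι) (y : Fin 3 → K) :
    eval y (F.join i j) = det3 y (F.e i) (F.e j) := by
  rw [join, eval_linForm, crossProduct_dotProduct]

lemma eval_conic (F : SegreFamily ι K) (i j : ι) (y : Fin 3 → K) :
    eval y (F.conic i j) = (F.u i ⬝ᵥ y) * (F.t j ⬝ᵥ y) - (F.u j ⬝ᵥ y) * (F.t i ⬝ᵥ y) := by
  simp only [conic, map_sub, map_mul, eval_linForm]

lemma isHomogeneous_conic (F : SegreFamily ι K) (i j : ι) : (F.conic i j).IsHomogeneous 2 :=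
  ((isHomogeneous_linForm _).mul (isHomogeneous_linForm _)).sub
    ((isHomogeneous_linForm _).mul (isHomogeneous_linForm _))

/-- The sextic associated with four points of the family. -/
noncomputable def sextic (F : SegreFamily ι K) (a b c d : ι) : MvPolynomial (Fin 3) K :=
  F.join a b * F.join c d * F.conic a d * F.conic b c -
    F.join a d * F.join b c * F.conic a b * F.conic c d

lemma isHomogeneous_sextic (F : SegreFamily ι K) (a b c d : ι) :
    (F.sextic a b c d).IsHomogeneous 6 :=
  ((((isHomogeneous_linForm _).mul (isHomogeneous_linForm _)).mul
    (F.isHomogeneous_conic _ _)).mul (F.isHomogeneous_conic _ _)).sub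
  ((((isHomogeneous_linForm _).mul (isHomogeneous_linForm _)).mul
    (F.isHomogeneous_conic _ _)).mul (F.isHomogeneous_conic _ _))

/-- At `e i` the ratio of `join a b` to `conic a b` is `k φ(a) φ(b)`, with `φ(a) = tᵢ(eₐ) / tₐ(eᵢ)`.
Such a product does not change when `a, b, c, d` are paired differently, and the sextic says exactly
that. -/
lemma exists_join_mul (F : SegreFamily ι K) (i : ι) : ∃ k : K, ∀ a b,
    eval (F.e i) (F.join a b) * ((F.t a ⬝ᵥ F.e i) * (F.t b ⬝ᵥ F.e i)) =
      k * ((F.t i ⬝ᵥ F.e a) * (F.t i ⬝ᵥ F.e b)) * eval (F.e i) (F.conic a b) := by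
  obtain ⟨k, -, hk⟩ := F.exists_det3_eq i
  refine ⟨k, fun a b => ?_⟩
  rw [eval_join, eval_conic, hk]
  linear_combination k * (F.t i ⬝ᵥ F.e a) * (F.t a ⬝ᵥ F.e i) * F.rel i b -
    k * (F.t i ⬝ᵥ F.e b) * (F.t b ⬝ᵥ F.e i) * F.rel i a

lemma eval_sextic (F : SegreFamily ι K) {i a b c d : ι} (ha : F.t a ⬝ᵥ F.e i ≠ 0)
    (hb : F.t b ⬝ᵥ F.e i ≠ 0) (hc : F.t c ⬝ᵥ F.e i ≠ 0) (hd : F.t d ⬝ᵥ F.e i ≠ 0) :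
    eval (F.e i) (F.sextic a b c d) = 0 := by
  obtain ⟨k, hk⟩ := F.exists_join_mul i
  refine (mul_eq_zero_iff_left (mul_ne_zero (mul_ne_zero ha hb) (mul_ne_zero hc hd))).mp ?_
  have h1 := hk a b
  have h2 := hk c d
  have h3 := hk a d
  have h4 := hk b c
  simp only [sextic, map_sub, map_mul]
  linear_combination (eval (F.e i) (F.conic a d) * eval (F.e i) (F.conic b c)) *
    ((eval (F.e i) (F.join c d) * ((F.t c ⬝ᵥ F.e i) * (F.t d ⬝ᵥ F.e i))) * h1 +
      (k * ((F.t i ⬝ᵥ F.e a) * (F.t i ⬝ᵥ F.e b)) * eval (F.e i) (F.conic a b)) * h2) -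
    (eval (F.e i) (F.conic a b) * eval (F.e i) (F.conic c d)) *
    ((eval (F.e i) (F.join b c) * ((F.t b ⬝ᵥ F.e i) * (F.t c ⬝ᵥ F.e i))) * h3 +
      (k * ((F.t i ⬝ᵥ F.e a) * (F.t i ⬝ᵥ F.e d)) * eval (F.e i) (F.conic a d)) * h4)

lemma join_self_left (F : SegreFamily ι K) (i j : ι) : eval (F.e i) (F.join i j) = 0 := by
  rw [eval_join, det3_expand]; ring

lemma join_self_right (F : SegreFamily ι K) (i j : ι) : eval (F.e j) (F.join i j) = 0 := by
  rw [eval_join, det3_expand]; ring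

lemma Generic.eval_sextic_eq_zero (h : F.Generic s) {i a b c d : ι} (hi : i ∈ s) (ha : a ∈ s)
    (hb : b ∈ s) (hc : c ∈ s) (hd : d ∈ s) : eval (F.e i) (F.sextic a b c d) = 0 := by
  by_cases hia : i = a
  · subst hia; simp [sextic, join_self_left]
  by_cases hib : i = b
  · subst hib; simp [sextic, join_self_left, join_self_right]
  by_cases hic : i = c
  · subst hic; simp [sextic, join_self_left, join_self_right]
  by_cases hid : i = d
  · subst hid; simp [sextic, join_self_right]
  exact F.eval_sextic (h.t_ne a ha i hi (Ne.symm hia)) (h.t_ne b hb i hi (Ne.symm hib))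
    (h.t_ne c hc i hi (Ne.symm hic)) (h.t_ne d hd i hi (Ne.symm hid))

/-- The sextic has an ordinary double point at `e d`, with tangents `t d` and `u d`. -/
lemma Generic.alongLine_sextic (h : F.Generic s) (h2 : (2 : K) ≠ 0) {a b c d : ι} (ha : a ∈ s)
    (hb : b ∈ s) (hc : c ∈ s) (hd : d ∈ s) (hab : a ≠ b) (hac : a ≠ c) (had : a ≠ d)
    (hbc : b ≠ c) (hbd : b ≠ d) (hcd : c ≠ d) (v : Fin 3 → K) :
    ∃ R : Polynomial K, alongLine (F.e d) v (F.sextic a b c d) = Polynomial.X ^ 2 * R ∧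
      (R.coeff 0 = 0 → (F.t d ⬝ᵥ v) * (F.u d ⬝ᵥ v) = 0) := by
  obtain ⟨k, hk, hdet⟩ := F.exists_det3_eq d
  have dz1 : crossProduct (F.e c) (F.e d) ⬝ᵥ F.e d = 0 := by
    rw [crossProduct_dotProduct, det3_expand]; ring
  have dz2 : crossProduct (F.e a) (F.e d) ⬝ᵥ F.e d = 0 := by
    rw [crossProduct_dotProduct, det3_expand]; ring
  have hD : ∀ x y z : Fin 3 → K, crossProduct x y ⬝ᵥ z = det3 z x y := crossProduct_dotProduct
  have hcyc : ∀ x y z : Fin 3 → K, det3 z x y = det3 y z x := fun x y z => by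
    simp only [det3_expand]; ring
  -- In each of the two products one join and one conic involve `d`; both vanish at `e d`, which
  -- accounts for `X ^ 2`.
  refine ⟨alongLine (F.e d) v (F.join a b) * Polynomial.C (crossProduct (F.e c) (F.e d) ⬝ᵥ v) *
      (alongLine (F.e d) v (linForm (F.u a)) * Polynomial.C (F.t d ⬝ᵥ v) -
        Polynomial.C (F.u d ⬝ᵥ v) * alongLine (F.e d) v (linForm (F.t a))) *
      alongLine (F.e d) v (F.conic b c) -
    Polynomial.C (crossProduct (F.e a) (F.e d) ⬝ᵥ v) * alongLine (F.e d) v (F.join b c) *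
      alongLine (F.e d) v (F.conic a b) *
      (alongLine (F.e d) v (linForm (F.u c)) * Polynomial.C (F.t d ⬝ᵥ v) -
        Polynomial.C (F.u d ⬝ᵥ v) * alongLine (F.e d) v (linForm (F.t c))), ?_, fun h0 => ?_⟩
  · simp only [sextic, map_sub, map_mul]
    rw [conic, conic, conic, conic, join, join, join, join]
    simp only [map_sub, map_mul, alongLine_linForm, F.t_self, F.u_self, dz1, dz2, map_zero,
      zero_add]
    ring
  · simp only [Polynomial.coeff_sub, Polynomial.mul_coeff_zero, coeff_zero_alongLine,
      Polynomial.coeff_C_zero, eval_join, eval_conic, eval_linForm, hD] at h0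
    rw [hcyc (F.e c) (F.e d) v, hcyc (F.e a) (F.e d) v, hdet, hdet, hdet, hdet] at h0
    have ra := F.rel d a
    have rb := F.rel d b
    have rc := F.rel d c
    have hta := h.t_ne a ha d hd had
    have htb := h.t_ne b hb d hd hbd
    have htc := h.t_ne c hc d hd hcd
    have hTa := h.t_ne d hd a ha had.symm
    have hTb := h.t_ne d hd b hb hbd.symm
    have hTc := h.t_ne d hd c hc hcd.symm
    have d1 := h.det_ne d hd a ha b hb had.symm hbd.symm hab
    have d2 := h.det_ne d hd b hb c hc hbd.symm hcd.symm hbc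
    have d3 := h.det_ne d hd a ha c hc had.symm hcd.symm hac
    rw [hdet] at d1 d2 d3
    have d1' := right_ne_zero_of_mul d1
    have d2' := right_ne_zero_of_mul d2
    have d3' := right_ne_zero_of_mul d3
    generalize F.t d ⬝ᵥ F.e a = Ta at *
    generalize F.t d ⬝ᵥ F.e b = Tb at *
    generalize F.t d ⬝ᵥ F.e c = Tc at *
    generalize F.u d ⬝ᵥ F.e a = Na at *
    generalize F.u d ⬝ᵥ F.e b = Nb at *
    generalize F.u d ⬝ᵥ F.e c = Nc at *
    generalize F.t a ⬝ᵥ F.e d = ta at *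
    generalize F.t b ⬝ᵥ F.e d = tb at *
    generalize F.t c ⬝ᵥ F.e d = tc at *
    generalize F.t d ⬝ᵥ v = T at *
    generalize F.u d ⬝ᵥ v = X at *
    -- The Segre relation with `d` eliminates the values of `u` at `e d`. What remains is `t d · v`
    -- times `u d · v`, up to a factor made of 2, tangent values and the determinants of `e d` with
    -- pairs of the other points.
    have ea : F.u a ⬝ᵥ F.e d = -Na * ta / Ta := by field_simp; linear_combination ra
    have eb : F.u b ⬝ᵥ F.e d = -Nb * tb / Tb := by field_simp; linear_combination rb
    have ec : F.u c ⬝ᵥ F.e d = -Nc * tc / Tc := by field_simp; linear_combination rc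
    rw [ea, eb, ec] at h0
    have hne : 2 * k ^ 2 * (ta * tb * tc) * (Ta * Nb - Tb * Na) * (Tb * Nc - Tc * Nb) *
        (Ta * Nc - Tc * Na) ≠ 0 := by
      simp only [ne_eq, mul_eq_zero, not_or]
      exact ⟨⟨⟨⟨⟨h2, pow_ne_zero _ hk⟩, ⟨hta, htb⟩, htc⟩, d1'⟩, d2'⟩, d3'⟩
    refine (mul_eq_zero.mp ?_).resolve_left hne
    field_simp at h0
    linear_combination -h0

end SegreFamily

end SegreFamilies

/-! ### Singular points of irreducible curves of low degree. -/

section PlaneCurves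

open MvPolynomial

variable {K : Type*} [Field K]

lemma MvPolynomial.IsHomogeneous.not_dvd {f g : MvPolynomial (Fin 3) K} {d k : ℕ}
    (hf : f.IsHomogeneous d) (hf0 : f ≠ 0) (hg : g.IsHomogeneous k) (hg0 : g ≠ 0) (hkd : k < d) :
    ¬ f ∣ g := by
  rintro ⟨w, rfl⟩
  obtain ⟨a, b, ha, -, hab⟩ := hg.exists_of_mul hg0
  have := ha.inj_right hf hf0
  omega

lemma linForm_ne_zero {a : Fin 3 → K} (ha : a ≠ 0) : linForm a ≠ 0 := by
  obtain ⟨w, hw⟩ := exists_dotProduct_ne_zero ha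
  intro h
  exact hw (by rw [← eval_linForm, h, map_zero])

lemma eval_smul_of_isHomogeneous {f : MvPolynomial (Fin 3) K} {d : ℕ} (hf : f.IsHomogeneous d)
    (c : K) (x : Fin 3 → K) : eval (c • x) f = c ^ d * eval x f := by
  conv_lhs => rw [f.as_sum]
  conv_rhs => rw [f.as_sum]
  rw [map_sum, map_sum, Finset.mul_sum]
  refine Finset.sum_congr rfl fun m hm => ?_
  rw [eval_monomial, eval_monomial, hf.degree_eq_sum_deg_support hm, Finsupp.prod, Finsupp.prod]
  simp only [Pi.smul_apply, smul_eq_mul, mul_pow, Finset.prod_mul_distrib,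
    Finset.prod_pow_eq_pow_sum]
  ring

/-- An irreducible curve with more than `d` points on a line is that line. -/
lemma dvd_linForm_of_alongLine_eq_zero [Finite K] {f : MvPolynomial (Fin 3) K} {d : ℕ}
    (hf : f.IsHomogeneous d) (hirr : Irreducible f) (hK : d < Nat.card K) {x v : Fin 3 → K}
    (hxv : crossProduct x v ≠ 0) (h : alongLine x v f = 0) : f ∣ linForm (crossProduct x v) := by
  have := Fintype.ofFinite K
  rw [Nat.card_eq_fintype_card] at hK
  by_contra hndvd
  have hcross : ∀ s r : K, crossProduct (x + s • v) (x + r • v) = (r - s) • crossProduct x v := by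
    intro s r
    rw [cross_apply, cross_apply]
    ext i
    fin_cases i <;> simp <;> ring
  have hB := card_le_of_irreducible hf hirr (isHomogeneous_linForm (crossProduct x v)) hndvd
    (Finset.univ : Finset K) (fun s => x + s • v)
    (fun s _ r _ hsr => by
      rw [hcross]
      exact smul_ne_zero (sub_ne_zero.mpr (Ne.symm hsr)) hxv)
    (fun s _ h0 => by
      refine hxv ?_
      have : x = -(s • v) := eq_neg_of_add_eq_zero_left h0
      rw [this, map_neg, map_smul]
      simp)
    (fun s _ => by rw [← eval_alongLine, h, Polynomial.eval_zero])
    (fun s _ => by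
      rw [eval_linForm, crossProduct_dotProduct, det3_expand]
      simp only [Pi.add_apply, Pi.smul_apply, smul_eq_mul]
      ring)
  rw [Finset.card_univ, mul_one] at hB
  omega

lemma alongLine_ne_zero [Finite K] {f : MvPolynomial (Fin 3) K} {d : ℕ}
    (hf : f.IsHomogeneous d) (hirr : Irreducible f) (hd : 1 < d) (hK : d < Nat.card K)
    {x v : Fin 3 → K} (hxv : crossProduct x v ≠ 0) : alongLine x v f ≠ 0 := fun h =>
  hf.not_dvd hirr.ne_zero (isHomogeneous_linForm _) (linForm_ne_zero hxv) hd
    (dvd_linForm_of_alongLine_eq_zero hf hirr hK hxv h)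

/-- An irreducible curve of degree at most 4 in odd characteristic has at most 12 singular
points. -/
lemma card_singular_le [Finite K] (h2 : (2 : K) ≠ 0) (hK : 4 < Nat.card K)
    {f : MvPolynomial (Fin 3) K} {d : ℕ} (hf : f.IsHomogeneous d) (hirr : Irreducible f)
    (hd : d ≤ 4) {ι : Type*} (s : Finset ι) (e : ι → Fin 3 → K)
    (he : ∀ i ∈ s, ∀ j ∈ s, i ≠ j → crossProduct (e i) (e j) ≠ 0) (he0 : ∀ i ∈ s, e i ≠ 0)
    (hef : ∀ i ∈ s, eval (e i) f = 0) (hs : ∀ i ∈ s, gradAt f (e i) = 0) : s.card ≤ 12 := by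
  have hd0 : d ≠ 0 := by
    rintro rfl
    rw [← totalDegree_zero_iff_isHomogeneous, totalDegree_eq_zero_iff_eq_C] at hf
    refine hirr.not_isUnit ?_
    rw [hf]
    refine (IsUnit.mk0 _ fun h0 => hirr.ne_zero ?_).map C
    rw [hf, h0, C_0]
  -- Euler's identity yields a nonzero partial derivative unless the characteristic divides `d`; for
  -- `d ≤ 4` and `2 ≠ 0` the only exception is a cubic in characteristic 3.
  by_cases hdK : (d : K) = 0
  · have hd3 : d = 3 := by
      interval_cases d
      · exact absurd rfl hd0
      · simp at hdK
      · exact absurd (by exact_mod_cast hdK) h2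
      · rfl
      · refine absurd ?_ (mul_ne_zero h2 h2)
        push_cast at hdK
        linear_combination hdK
    subst hd3
    refine le_trans (Finset.card_le_one.mpr fun i hi j hj => ?_) (by norm_num)
    by_contra hij
    refine alongLine_ne_zero hf hirr (by norm_num) (by omega) (he i hi j hj hij) ?_
    -- A cubic singular at two points vanishes on their join: `e i` kills the coefficients 0 and 1,
    -- `e j` kills the coefficient 3, and the polar of `e i` evaluated at `e j` kills the
    -- coefficient 2, because `3 - 2 = 1`.
    have htop := alongLine_top hf (e i) (e j)
    have hpol := (alongLine_top (isHomogeneous_polar (e i) hf) (e i) (e j)).2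
    rw [alongLine_polar _ _ hf, eval_polar, hs j hj, zero_dotProduct] at hpol
    ext n
    rw [Polynomial.coeff_zero]
    by_cases hn : 3 < n
    · exact Polynomial.coeff_eq_zero_of_natDegree_lt (lt_of_le_of_lt htop.1 hn)
    · interval_cases n
      · rw [coeff_zero_alongLine, hef i hi]
      · rw [coeff_one_alongLine, hs i hi, zero_dotProduct]
      · simp only [Nat.add_one_sub_one, Polynomial.coeff_sub, Polynomial.coeff_smul,
          Polynomial.coeff_X_mul, Polynomial.coeff_derivative] at hpol
        simp at hpol
        linear_combination hpol
      · rw [htop.2, hef j hj]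
  · obtain ⟨j, hj⟩ : ∃ j, pderiv j f ≠ 0 := by
      by_contra! H
      have h := hf.sum_X_mul_pderiv
      simp only [H, mul_zero, Finset.sum_const_zero, nsmul_eq_mul] at h
      have hdC : ((d : ℕ) : MvPolynomial (Fin 3) K) = C (d : K) := by simp
      rw [hdC] at h
      exact mul_ne_zero ((map_ne_zero_iff _ (C_injective _ _)).mpr hdK) hirr.ne_zero h.symm
    -- Singular points also lie on this derivative, of degree `d - 1`, and `d * (d - 1) ≤ 12`.
    have hB := card_le_of_irreducible hf hirr (hf.pderiv (i := j))
      (hf.not_dvd hirr.ne_zero hf.pderiv hj (by omega)) s e he he0 hef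
      fun i hi => congrFun (hs i hi) j
    refine hB.trans ?_
    interval_cases d <;> norm_num

/-- Both sides are `f(x + y) - f(x) - f(y)`, the polarisation of the quadratic form. -/
lemma gradAt_dotProduct_comm {f : MvPolynomial (Fin 3) K} (hf : f.IsHomogeneous 2)
    (x y : Fin 3 → K) : gradAt f x ⬝ᵥ y = gradAt f y ⬝ᵥ x := by
  have key : ∀ x y : Fin 3 → K,
      eval (x + y) f = eval x f + gradAt f x ⬝ᵥ y + eval y f := by
    intro x y
    have h := eval_alongLine x y f 1
    have ht := alongLine_top hf x y
    rw [Polynomial.eval_eq_sum_range' (Nat.lt_succ_of_le ht.1)] at h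
    simp only [Finset.sum_range_succ, Finset.sum_range_zero, zero_add, one_pow, mul_one, one_smul,
      coeff_zero_alongLine, coeff_one_alongLine, ht.2] at h
    exact h.symm
  have h1 := key x y
  have h2 := key y x
  rw [add_comm y x] at h2
  linear_combination h2 - h1

end PlaneCurves

/-! ### Tangents of a curve through a Segre family. -/

section SegreFamilies

open MvPolynomial

variable {K : Type*} [Field K] {ι : Type*}

namespace SegreFamily

variable {F : SegreFamily ι K} {s : Finset ι}

/-- At a smooth point of an irreducible curve through many points of a generic family, the tangent
of the curve is one of the two lines attached to the point. -/
lemma Generic.gradAt_eq (h : F.Generic s) (h2 : (2 : K) ≠ 0) {f : MvPolynomial (Fin 3) K} {d : ℕ}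
    (hf : f.IsHomogeneous d) (hirr : Irreducible f) (hd : d ≤ 4) (hs : 25 ≤ s.card)
    (hfs : ∀ i ∈ s, eval (F.e i) f = 0) {i : ι} (hi : i ∈ s) (hg : gradAt f (F.e i) ≠ 0) :
    ∃ c : K, c ≠ 0 ∧ (gradAt f (F.e i) = c • F.t i ∨ gradAt f (F.e i) = c • F.u i) := by
  classical
  obtain ⟨a, ha, ha'⟩ : ∃ a ∈ s, a ∉ ({i} : Finset ι) :=
    Finset.exists_mem_notMem_of_card_lt_card (by rw [Finset.card_singleton]; omega)
  obtain ⟨b, hb, hb'⟩ : ∃ b ∈ s, b ∉ ({i, a} : Finset ι) :=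
    Finset.exists_mem_notMem_of_card_lt_card (Finset.card_le_two.trans_lt (by omega))
  obtain ⟨c, hc, hc'⟩ : ∃ c ∈ s, c ∉ ({i, a, b} : Finset ι) :=
    Finset.exists_mem_notMem_of_card_lt_card (Finset.card_le_three.trans_lt (by omega))
  simp only [Finset.mem_insert, Finset.mem_singleton, not_or] at ha' hb' hc'
  -- Bézout: at least 25 common points, against `4 * 6 = 24`.
  have hdvd : f ∣ F.sextic a b c i := by
    by_contra hnd
    have := card_le_of_irreducible hf hirr (F.isHomogeneous_sextic a b c i) hnd s F.e
      h.crossProduct_ne_zero (fun j _ => F.e_ne_zero j) hfs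
      fun j hj => h.eval_sextic_eq_zero hj ha hb hc hi
    omega
  obtain ⟨r, hr⟩ := hdvd
  have hline : ∀ v, ∃ R : Polynomial K,
      alongLine (F.e i) v f * alongLine (F.e i) v r = Polynomial.X ^ 2 * R ∧
        (R.coeff 0 = 0 → (F.t i ⬝ᵥ v) * (F.u i ⬝ᵥ v) = 0) := fun v => by
    rw [← map_mul, ← hr]
    exact h.alongLine_sextic h2 ha hb hc hi (Ne.symm hb'.2) (Ne.symm hc'.2.1) ha'
      (Ne.symm hc'.2.2) hb'.1 hc'.1 v
  have hf1 : ∀ v, ∃ P : Polynomial K, alongLine (F.e i) v f = Polynomial.X * P ∧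
      P.coeff 0 = gradAt f (F.e i) ⬝ᵥ v := fun v => by
    obtain ⟨P, hP⟩ := Polynomial.X_dvd_iff.mpr
      ((coeff_zero_alongLine (F.e i) v f).trans (hfs i hi))
    refine ⟨P, hP, ?_⟩
    rw [← coeff_one_alongLine, hP, Polynomial.coeff_X_mul]
  have hX0 : (Polynomial.X : Polynomial K) ≠ 0 := Polynomial.X_ne_zero
  -- The sextic vanishes doubly at `e i` and `f` only simply, so the cofactor vanishes there.
  have hr0 : eval (F.e i) r = 0 := by
    obtain ⟨v, hv⟩ := exists_dotProduct_ne_zero hg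
    obtain ⟨R, hR, -⟩ := hline v
    obtain ⟨P, hP, hP0⟩ := hf1 v
    rw [hP] at hR
    have h1 : P * alongLine (F.e i) v r = Polynomial.X * R :=
      mul_left_cancel₀ hX0 (by linear_combination hR)
    have h3 := congrArg (fun p => Polynomial.coeff p 0) h1
    simp only [Polynomial.mul_coeff_zero, coeff_zero_alongLine, Polynomial.coeff_X_zero,
      zero_mul, hP0] at h3
    exact (mul_eq_zero.mp h3).resolve_left hv
  obtain ⟨α, β, hαβ⟩ := exists_eq_smul_add_smul (F.t_self i) (F.u_self i)
    (by rw [gradAt_dotProduct_self hf, hfs i hi, mul_zero]) (F.e_ne_zero i) (F.cross_ne_zero i)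
  -- This direction is tangent to `f` at `e i`. Along it `f` vanishes to order 2 and the cofactor to
  -- order 1, so the sextic vanishes to order 3 and `v` must lie on `t i` or `u i`; this gives `α β
  -- = 0`.
  obtain ⟨v, hv1, hv2⟩ := exists_dotProduct_eq (F.cross_ne_zero i) β (-α)
  obtain ⟨R, hR, hR0⟩ := hline v
  obtain ⟨P, hP, hP0⟩ := hf1 v
  have hgv : P.coeff 0 = 0 := by
    rw [hP0, hαβ, add_dotProduct, smul_dotProduct, smul_dotProduct, hv1, hv2, smul_eq_mul,
      smul_eq_mul]
    ring
  obtain ⟨P', hP'⟩ := Polynomial.X_dvd_iff.mpr hgv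
  have hRv : R.coeff 0 = 0 := by
    have h1 : P' * alongLine (F.e i) v r = R :=
      mul_left_cancel₀ (pow_ne_zero 2 hX0) (by rw [← hR, hP, hP']; ring)
    rw [← h1, Polynomial.mul_coeff_zero, coeff_zero_alongLine, hr0, mul_zero]
  have h5 := hR0 hRv
  rw [hv1, hv2] at h5
  by_cases hβ : β = 0
  · subst hβ
    rw [zero_smul, add_zero] at hαβ
    refine ⟨α, ?_, Or.inl hαβ⟩
    rintro rfl
    exact hg (by rw [hαβ, zero_smul])
  · have hα : α = 0 := neg_eq_zero.mp ((mul_eq_zero.mp h5).resolve_left hβ)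
    subst hα
    rw [zero_smul, zero_add] at hαβ
    exact ⟨β, hβ, Or.inr hαβ⟩

end SegreFamily

end SegreFamilies

/-! ### Univariate identities for restrictions to a line. -/

section LowDegree

open Polynomial

variable {K : Type*} [Field K]

lemma isCoprime_linear {p : K[X]} {α β : K} (h0 : α ≠ 0 ∨ β ≠ 0)
    (h : ∀ x, p.eval x = 0 → α + β * x ≠ 0) : IsCoprime p (C α + C β * X) := by
  by_cases hβ : β = 0
  · subst hβ
    have hα : IsUnit (C α + C 0 * X : K[X]) := by simpa using h0
    obtain ⟨r, hr⟩ := hα.exists_left_inv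
    exact ⟨0, r, by rw [hr]; ring⟩
  · have hdeg : (C α + C β * X).degree = 1 := by
      rw [add_comm]; exact degree_linear hβ
    refine ((irreducible_of_degree_eq_one hdeg).isCoprime_or_dvd p).elim IsCoprime.symm ?_
    rintro ⟨r, rfl⟩
    refine absurd ?_ (h (-α / β) ?_)
    · field_simp; ring
    · rw [eval_mul]
      simp only [eval_add, eval_C, eval_mul, eval_X]
      field_simp
      ring

lemma exists_eq_C_mul_of_dvd {k M : K[X]} (h : k ∣ M) (hdeg : M.natDegree ≤ k.natDegree) :
    ∃ c, M = C c * k := by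
  obtain ⟨r, rfl⟩ := h
  by_cases h0 : k * r = 0
  · exact ⟨0, by rw [h0, C_0, zero_mul]⟩
  · rw [natDegree_mul (left_ne_zero_of_mul h0) (right_ne_zero_of_mul h0)] at hdeg
    refine ⟨r.coeff 0, ?_⟩
    rw [← eq_C_of_natDegree_eq_zero (by omega), mul_comm]

/-- A form of degree 3 or 4 with a double root at `0` which is related to its polar form in
this way has no other root. -/
lemma eq_zero_of_polar_mul_eq {d : ℕ} (hd : d = 3 ∨ d = 4) {p H : K[X]}
    (hdeg : p.natDegree ≤ d) (h0 : p.coeff 0 = 0) (h1 : p.coeff 1 = 0) (htop : p.coeff d ≠ 0)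
    {w α β γ δ : K} (hαβ : α ≠ 0 ∨ β ≠ 0) (hγδ : γ ≠ 0 ∨ δ ≠ 0)
    (hl : ∀ x, p.eval x = 0 → α + β * x ≠ 0) (hm : ∀ x, p.eval x = 0 → γ + δ * x ≠ 0)
    (h : (d • p - X * derivative p) * (C w * X) * (C α + C β * X) * (C γ + C δ * X) = p * H) :
    H = 0 := by
  have hX2 : (X : K[X]) ^ 2 ≠ 0 := pow_ne_zero _ X_ne_zero
  -- Here `k` and `N` are `p` and its polar divided by `X ^ 2`. The two linear factors are coprime
  -- to `k`, so `k` divides `N * (C w * X)`. The polar loses the top coefficient of `p`, which makes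
  -- up for the factor `X`: degrees force `N * (C w * X) = C κ * k`, and comparing coefficients
  -- makes this zero.
  have main : ∀ k N : K[X], p = X ^ 2 * k → d • p - X * derivative p = X ^ 2 * N →
      (N * (C w * X)).natDegree ≤ k.natDegree →
      (∀ κ : K, N * (C w * X) = C κ * k → N * (C w * X) = 0) → H = 0 := by
    intro k N hk hN hkdeg hκ
    have hk0 : k ≠ 0 := by
      rintro rfl
      rw [mul_zero] at hk
      exact htop (by rw [hk, coeff_zero])
    have e1 : N * (C w * X) * (C α + C β * X) * (C γ + C δ * X) = k * H := by
      refine mul_left_cancel₀ hX2 ?_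
      rw [← mul_assoc (X ^ 2) k H, ← hk, ← h, hN]
      ring
    have hroot : ∀ x, k.eval x = 0 → p.eval x = 0 := fun x hx => by rw [hk, eval_mul, hx, mul_zero]
    have c1 := isCoprime_linear (p := k) hαβ fun x hx => hl x (hroot x hx)
    have c2 := isCoprime_linear (p := k) hγδ fun x hx => hm x (hroot x hx)
    obtain ⟨κ, hκ'⟩ := exists_eq_C_mul_of_dvd
      (c1.dvd_of_dvd_mul_right (c2.dvd_of_dvd_mul_right ⟨H, e1⟩)) hkdeg
    rw [hκ κ hκ', zero_mul, zero_mul] at e1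
    exact (mul_eq_zero.mp e1.symm).resolve_left hk0
  rcases hd with rfl | rfl
  · have hp : p = X ^ 2 * (C (p.coeff 2) + C (p.coeff 3) * X) := by
      conv_lhs => rw [p.as_sum_range_C_mul_X_pow' (Nat.lt_succ_of_le hdeg)]
      simp only [Finset.sum_range_succ, Finset.sum_range_zero, h0, h1, C_0]
      ring
    generalize p.coeff 2 = a at hp
    generalize hb : p.coeff 3 = b at hp htop
    refine main _ (C a) hp ?_ ?_ ?_
    · rw [hp]
      simp only [derivative_mul, derivative_X_pow, derivative_add, derivative_C, derivative_X]
      simp only [nsmul_eq_mul, Nat.cast_ofNat, C_ofNat]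
      ring
    · rw [add_comm, natDegree_linear htop, ← mul_assoc, ← C_mul]
      exact (natDegree_C_mul_le _ _).trans natDegree_X_le
    · intro κ hκ
      have k0 := congrArg (fun q => coeff q 0) hκ
      have k1 := congrArg (fun q => coeff q 1) hκ
      rw [← mul_assoc, ← C_mul] at k0 k1 ⊢
      simp [coeff_X] at k0 k1
      have : a * w = 0 := by
        rcases k0 with rfl | rfl
        · rw [k1, zero_mul]
        · rw [zero_mul]
      rw [this, C_0, zero_mul]
  · have hp : p = X ^ 2 * (C (p.coeff 2) + C (p.coeff 3) * X + C (p.coeff 4) * X ^ 2) := by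
      conv_lhs => rw [p.as_sum_range_C_mul_X_pow' (Nat.lt_succ_of_le hdeg)]
      simp only [Finset.sum_range_succ, Finset.sum_range_zero, h0, h1, C_0]
      ring
    generalize p.coeff 2 = a at hp
    generalize p.coeff 3 = b at hp
    generalize hc : p.coeff 4 = c at hp htop
    refine main _ (C (2 * a) + C b * X) hp ?_ ?_ ?_
    · rw [hp]
      simp only [derivative_mul, derivative_X_pow, derivative_add, derivative_C, derivative_X,
        C_mul, nsmul_eq_mul, Nat.cast_ofNat, C_ofNat]
      ring
    · have : (C a + C b * X + C c * X ^ 2).natDegree = 2 := by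
        rw [show C a + C b * X + C c * X ^ 2 = C c * X ^ 2 + C b * X + C a by ring]
        exact natDegree_quadratic htop
      rw [this]
      refine natDegree_mul_le_of_le (m := 1) (n := 1) ?_ ((natDegree_C_mul_le _ _).trans natDegree_X_le)
      rw [add_comm]; exact natDegree_linear_le
    · intro κ hκ
      have k0 := congrArg (fun q => coeff q 0) hκ
      have k1 := congrArg (fun q => coeff q 1) hκ
      have k2 := congrArg (fun q => coeff q 2) hκ
      have e : (C (2 * a) + C b * X) * (C w * X) = C (2 * a * w) * X + C (b * w) * X ^ 2 := by
        simp only [C_mul]; ring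
      rw [e] at k0 k1 k2 ⊢
      simp only [coeff_add, coeff_C_mul, coeff_X, coeff_X_pow, coeff_C] at k0 k1 k2
      norm_num at k0 k1 k2
      have hκa : 2 * a * w = 0 ∧ b * w = 0 := by
        rcases k0 with rfl | rfl
        · exact ⟨by rw [k1, zero_mul], by rw [k2, zero_mul]⟩
        · rw [mul_zero, zero_mul] at k1
          rcases mul_eq_zero.mp k1.symm with rfl | rfl
          · exact ⟨by ring, by rw [k2, zero_mul]⟩
          · exact ⟨by ring, by ring⟩
      rw [hκa.1, hκa.2, C_0, zero_mul, zero_mul, add_zero]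

/-- Serves to compare the terms of order 2 in `adjoint = f * g` along a line through `e a`, where
`f` restricts to `X * P`. As `P` does not vanish at 0, the linear term of `g` can be isolated. -/
lemma coeff_one_of_polar_expansion {d D δ w tb tb' tc tc' lb lc ub ub' uc uc' τ : K}
    {P G A B : K[X]}
    (h : (C D + C δ * X) * (C d * (X * P) - X * (1 * P + X * derivative P)) * (C w * X) *
        (C tb + C tb' * X) * (C tc + C tc' * X) +
      (C lb * X) * A * (C ub + C ub' * X) * (C tc + C tc' * X) * (C τ * X) +
      (C lc * X) * B * (C uc + C uc' * X) * (C τ * X) * (C tb + C tb' * X) = X * P * G)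
    (hP : P.coeff 0 ≠ 0) : P.coeff 0 * G.coeff 1 = D * (d - 1) * P.coeff 0 * w * tb * tc +
      lb * A.coeff 0 * ub * tc * τ + lc * B.coeff 0 * uc * τ * tb := by
  obtain ⟨W, hW⟩ : ∃ W, W = (C D + C δ * X) * (C (d - 1) * P - X * derivative P) * C w *
        (C tb + C tb' * X) * (C tc + C tc' * X) +
      C lb * A * (C ub + C ub' * X) * (C tc + C tc' * X) * C τ +
      C lc * B * (C uc + C uc' * X) * C τ * (C tb + C tb' * X) := ⟨_, rfl⟩
  have h1 : X * W = P * G := by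
    refine mul_left_cancel₀ (X_ne_zero (R := K)) ?_
    rw [hW, C_sub, C_1]
    linear_combination h
  have hG : G.coeff 0 = 0 := by
    have := congrArg (fun p => coeff p 0) h1
    simp only [mul_coeff_zero, coeff_X_zero, zero_mul] at this
    exact (mul_eq_zero.mp this.symm).resolve_left hP
  obtain ⟨G', rfl⟩ := X_dvd_iff.mpr hG
  have h3 : W = P * G' := mul_left_cancel₀ (X_ne_zero (R := K)) (by rw [h1]; ring)
  rw [coeff_X_mul, ← mul_coeff_zero, ← h3, hW]
  simp only [coeff_add, coeff_sub, mul_coeff_zero, coeff_C_zero, coeff_X_zero]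
  ring

end LowDegree

/-! ### Symmetric families, and the adjoint curve of a curve tangent to all `t i`. -/

section SegreFamilies

open MvPolynomial

variable {K : Type*} [Field K] {ι : Type*}

namespace SegreFamily

variable {F : SegreFamily ι K} {s : Finset ι}

/-- If the tangent forms are symmetric, then the 3-secants are concurrent. -/
lemma Generic.concurrent_of_symmetric (h : F.Generic s) (hs : 3 ≤ s.card)
    (hsym : ∀ i ∈ s, ∀ j ∈ s, F.t i ⬝ᵥ F.e j = F.t j ⬝ᵥ F.e i) :
    ∃ P : Fin 3 → K, P ≠ 0 ∧ ∀ i ∈ s, F.u i ⬝ᵥ P = 0 := by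
  classical
  obtain ⟨a, ha, b, hb, c, hc, hab, hac, hbc⟩ := Finset.two_lt_card.mp hs
  -- For symmetric `t` the Segre relation makes `u` antisymmetric.
  have hanti : ∀ i ∈ s, ∀ j ∈ s, F.u i ⬝ᵥ F.e j = -(F.u j ⬝ᵥ F.e i) := by
    intro i hi j hj
    by_cases hij : i = j
    · subst hij; rw [F.u_self, neg_zero]
    · have hr := F.rel i j
      rw [hsym j hj i hi] at hr
      have : (F.t i ⬝ᵥ F.e j) * (F.u i ⬝ᵥ F.e j + F.u j ⬝ᵥ F.e i) = 0 := by
        linear_combination hr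
      exact eq_neg_of_add_eq_zero_left
        ((mul_eq_zero.mp this).resolve_left (h.t_ne i hi j hj hij))
  have hD := h.det_ne a ha b hb c hc hab hac hbc
  -- The kernel of the alternating form whose entries on the basis `e a, e b, e c` are the values of
  -- `u`.
  refine ⟨(F.u b ⬝ᵥ F.e c) • F.e a + (F.u c ⬝ᵥ F.e a) • F.e b + (F.u a ⬝ᵥ F.e b) • F.e c,
    fun h0 => ?_, fun i hi => ?_⟩
  · have h1 : det3 ((F.u b ⬝ᵥ F.e c) • F.e a + (F.u c ⬝ᵥ F.e a) • F.e b +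
        (F.u a ⬝ᵥ F.e b) • F.e c) (F.e b) (F.e c) =
        (F.u b ⬝ᵥ F.e c) * det3 (F.e a) (F.e b) (F.e c) := by
      simp only [det3_expand, Pi.add_apply, Pi.smul_apply, smul_eq_mul]; ring
    rw [h0, det3, zero_dotProduct] at h1
    exact mul_ne_zero (h.u_ne b hb c hc hbc) hD h1.symm
  · refine (mul_eq_zero.mp ?_).resolve_left hD
    have hcr := cramer_three (F.e a) (F.e b) (F.e c) (F.e i)
    have ca := congrArg (F.u a ⬝ᵥ ·) hcr
    have cb := congrArg (F.u b ⬝ᵥ ·) hcr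
    have cc := congrArg (F.u c ⬝ᵥ ·) hcr
    simp only [dotProduct_add, dotProduct_smul, smul_eq_mul, F.u_self] at ca cb cc ⊢
    rw [hanti i hi a ha, hanti i hi b hb, hanti i hi c hc]
    have e1 := hanti a ha b hb
    have e2 := hanti a ha c hc
    have e3 := hanti b hb c hc
    rw [e1, e2] at ca
    rw [e3] at cb
    rw [e1, e3]
    linear_combination (F.u c ⬝ᵥ F.e b) * ca - (F.u c ⬝ᵥ F.e a) * cb + (F.u b ⬝ᵥ F.e a) * cc

/-- The curve of degree `d + 3` through the points of a family whose tangents are the tangents of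
the curve `f` of degree `d`. -/
noncomputable def adjoint (F : SegreFamily ι K) (f : MvPolynomial (Fin 3) K) (a b c : ι) :
    MvPolynomial (Fin 3) K :=
  F.join b c * polar (F.e a) f * linForm (F.u a) * linForm (F.t b) * linForm (F.t c) +
  F.join c a * polar (F.e b) f * linForm (F.u b) * linForm (F.t c) * linForm (F.t a) +
  F.join a b * polar (F.e c) f * linForm (F.u c) * linForm (F.t a) * linForm (F.t b)

lemma isHomogeneous_adjoint (F : SegreFamily ι K) {f : MvPolynomial (Fin 3) K} {d : ℕ}
    (hf : f.IsHomogeneous d) (hd : 1 ≤ d) (a b c : ι) :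
    (F.adjoint f a b c).IsHomogeneous (d + 3) := by
  have key : ∀ x y p q r : ι, (F.join x y * polar (F.e p) f * linForm (F.u p) * linForm (F.t q) *
      linForm (F.t r)).IsHomogeneous (d + 3) := fun x y p q r => by
    have := ((((isHomogeneous_linForm (crossProduct (F.e x) (F.e y))).mul
      (isHomogeneous_polar (F.e p) hf)).mul (isHomogeneous_linForm (F.u p))).mul
      (isHomogeneous_linForm (F.t q))).mul (isHomogeneous_linForm (F.t r))
    rw [show d + 3 = 1 + (d - 1) + 1 + 1 + 1 by omega]
    exact this
  exact ((key _ _ _ _ _).add (key _ _ _ _ _)).add (key _ _ _ _ _)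

/-- The polars take the values `tᵢ(eₐ)`, and `tᵢ(eₐ) uₐ(eᵢ) = -uᵢ(eₐ) tₐ(eᵢ)`. The sum thus becomes
a multiple of `uᵢ` applied to Cramer's expansion of `eᵢ`, and `uᵢ(eᵢ) = 0`. -/
lemma eval_adjoint (F : SegreFamily ι K) {f : MvPolynomial (Fin 3) K} {i : ι}
    (hg : gradAt f (F.e i) = F.t i) (a b c : ι) : eval (F.e i) (F.adjoint f a b c) = 0 := by
  simp only [adjoint, map_add, map_mul, eval_join, eval_polar, eval_linForm, hg]
  have hcr := congrArg (F.u i ⬝ᵥ ·) (cramer_three (F.e a) (F.e b) (F.e c) (F.e i))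
  simp only [dotProduct_add, dotProduct_smul, smul_eq_mul, F.u_self] at hcr
  have e1 : det3 (F.e a) (F.e i) (F.e c) = det3 (F.e i) (F.e c) (F.e a) := by
    simp only [det3_expand]; ring
  have e2 : det3 (F.e a) (F.e b) (F.e i) = det3 (F.e i) (F.e a) (F.e b) := by
    simp only [det3_expand]; ring
  rw [e1, e2] at hcr
  linear_combination (det3 (F.e i) (F.e b) (F.e c)) * (F.t b ⬝ᵥ F.e i) * (F.t c ⬝ᵥ F.e i) *
      F.rel i a +
    (det3 (F.e i) (F.e c) (F.e a)) * (F.t c ⬝ᵥ F.e i) * (F.t a ⬝ᵥ F.e i) * F.rel i b +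
    (det3 (F.e i) (F.e a) (F.e b)) * (F.t a ⬝ᵥ F.e i) * (F.t b ⬝ᵥ F.e i) * F.rel i c +
    (F.t a ⬝ᵥ F.e i) * (F.t b ⬝ᵥ F.e i) * (F.t c ⬝ᵥ F.e i) * hcr

/-- The quotient of the adjoint curve by `f` vanishes at `e a`, where its gradient is proportional
to `u a`. -/
lemma gradAt_quotient (F : SegreFamily ι K) {f g : MvPolynomial (Fin 3) K} {d : ℕ}
    (hf : f.IsHomogeneous d) {a b c : ι} (hfa : eval (F.e a) f = 0)
    (hg : gradAt f (F.e a) = F.t a) (hfg : F.adjoint f a b c = f * g) {v : Fin 3 → K}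
    (hv : F.t a ⬝ᵥ v ≠ 0) :
    gradAt g (F.e a) ⬝ᵥ v = (d - 2) * det3 (F.e a) (F.e b) (F.e c) * (F.t b ⬝ᵥ F.e a) *
      (F.t c ⬝ᵥ F.e a) * (F.u a ⬝ᵥ v) := by
  obtain ⟨P, hP⟩ := Polynomial.X_dvd_iff.mpr ((coeff_zero_alongLine (F.e a) v f).trans hfa)
  have hP0 : P.coeff 0 = F.t a ⬝ᵥ v := by
    rw [← hg, ← coeff_one_alongLine, hP, Polynomial.coeff_X_mul]
  have hX0 : (Polynomial.X : Polynomial K) ≠ 0 := Polynomial.X_ne_zero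
  have hline := congrArg (alongLine (F.e a) v) hfg
  have z1 : crossProduct (F.e c) (F.e a) ⬝ᵥ F.e a = 0 := by
    rw [crossProduct_dotProduct, det3_expand]; ring
  have z2 : crossProduct (F.e a) (F.e b) ⬝ᵥ F.e a = 0 := by
    rw [crossProduct_dotProduct, det3_expand]; ring
  simp only [adjoint, join, map_add, map_mul, alongLine_polar _ _ hf, alongLine_linForm, hP,
    F.t_self, F.u_self, z1, z2, Polynomial.derivative_mul, Polynomial.derivative_X, map_zero,
    zero_add, nsmul_eq_mul, ← Polynomial.C_eq_natCast] at hline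
  have hcoeff := coeff_one_of_polar_expansion hline
  rw [hP0] at hcoeff
  rw [coeff_one_alongLine, coeff_zero_alongLine, coeff_zero_alongLine, eval_polar, eval_polar,
    hg] at hcoeff
  refine mul_left_cancel₀ hv ?_
  rw [hcoeff hv]
  have hcr := congrArg (F.u a ⬝ᵥ ·) (cramer_three (F.e a) (F.e b) (F.e c) v)
  simp only [dotProduct_add, dotProduct_smul, smul_eq_mul, F.u_self] at hcr
  have e1 : det3 (F.e a) v (F.e c) = det3 v (F.e c) (F.e a) := by
    simp only [det3_expand]; ring
  have e2 : det3 (F.e a) (F.e b) v = det3 v (F.e a) (F.e b) := by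
    simp only [det3_expand]; ring
  rw [e1, e2] at hcr
  simp only [crossProduct_dotProduct]
  -- The first summand of the adjoint contributes `d - 1`; the other two, by the Segre relation and
  -- Cramer's rule for `v`, contribute `-1`.
  linear_combination (F.t a ⬝ᵥ v) * (det3 v (F.e c) (F.e a) * (F.t c ⬝ᵥ F.e a) * F.rel a b +
    det3 v (F.e a) (F.e b) * (F.t b ⬝ᵥ F.e a) * F.rel a c) + 
    (F.t a ⬝ᵥ v) * (F.t b ⬝ᵥ F.e a) * (F.t c ⬝ᵥ F.e a) * hcr

end SegreFamily

end SegreFamilies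

lemma det3_eq_zero_of_dotProduct {K : Type*} [Field K] {n x y z : Fin 3 → K} (hn : n ≠ 0)
    (hx : n ⬝ᵥ x = 0) (hy : n ⬝ᵥ y = 0) (hz : n ⬝ᵥ z = 0) : det3 x y z = 0 := by
  obtain ⟨v, hv⟩ := exists_dotProduct_ne_zero hn
  have h := congrArg (n ⬝ᵥ ·) (cramer_three x y z v)
  simp only [dotProduct_add, dotProduct_smul, smul_eq_mul, hx, hy, hz, mul_zero, add_zero] at h
  exact (mul_eq_zero.mp h).resolve_right hv

/-! ### Concurrence of tangents or 3-secants on a curve of degree at most 4. -/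

section SegreFamilies

open MvPolynomial

variable {K : Type*} [Field K] {ι : Type*}

namespace SegreFamily

variable {F : SegreFamily ι K} {s : Finset ι}

lemma Generic.one_lt_degree [Finite K] (h : F.Generic s) (hs : 3 ≤ s.card)
    {f : MvPolynomial (Fin 3) K} {d : ℕ} (hf : f.IsHomogeneous d) (hirr : Irreducible f)
    (hfs : ∀ i ∈ s, eval (F.e i) f = 0) : 1 < d := by
  obtain ⟨a, ha, b, hb, c, hc, hab, hac, hbc⟩ := Finset.two_lt_card.mp hs
  by_contra hd
  interval_cases d
  · rw [← totalDegree_zero_iff_isHomogeneous, totalDegree_eq_zero_iff_eq_C] at hf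
    have := hfs a ha
    rw [hf, eval_C] at this
    rw [this, C_0] at hf
    exact hirr.ne_zero hf
  · have htop := alongLine_top hf (F.e a) (F.e b)
    have h0 : alongLine (F.e a) (F.e b) f = 0 := by
      ext n
      rw [Polynomial.coeff_zero]
      by_cases hn : 1 < n
      · exact Polynomial.coeff_eq_zero_of_natDegree_lt (lt_of_le_of_lt htop.1 hn)
      · interval_cases n
        · rw [coeff_zero_alongLine, hfs a ha]
        · rw [htop.2, hfs b hb]
    obtain ⟨r, hr⟩ := dvd_linForm_of_alongLine_eq_zero hf hirr Finite.one_lt_card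
      (h.crossProduct_ne_zero a ha b hb hab) h0
    have := congrArg (eval (F.e c)) hr
    rw [map_mul, hfs c hc, zero_mul, eval_linForm, crossProduct_dotProduct] at this
    exact h.det_ne c hc a ha b hb (Ne.symm hac) (Ne.symm hbc) hab this

/-- Parametrises the points of the tangent at `e a` other than `e a`, which is placed at infinity.
-/
lemma exists_alongLine_eq_smul (F : SegreFamily ι K) {a : ι} {v z : Fin 3 → K}
    (hv : F.t a ⬝ᵥ v = 0) (hv1 : F.u a ⬝ᵥ v = 1) (hz : F.t a ⬝ᵥ z = 0) (hz0 : F.u a ⬝ᵥ z ≠ 0) :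
    ∃ x : K, z = (F.u a ⬝ᵥ z) • (v + x • F.e a) := by
  obtain ⟨x, hx⟩ : ∃ x : K, z - (F.u a ⬝ᵥ z) • v = x • F.e a := by
    refine exists_smul_of_crossProduct_eq_zero ?_ (F.e_ne_zero a)
    obtain ⟨k, -, hk⟩ := exists_smul_crossProduct (F.t_self a) (F.u_self a) (F.e_ne_zero a)
      (F.cross_ne_zero a)
    rw [hk, map_smul, cross_cross_eq_smul_sub_smul']
    simp only [dotProduct_sub, dotProduct_smul, hz, hv, hv1, dotProduct_comm _ (F.u a)]
    simp
  refine ⟨(F.u a ⬝ᵥ z)⁻¹ * x, ?_⟩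
  rw [smul_add, smul_smul, mul_inv_cancel_left₀ hz0, ← hx]
  abel

lemma card_collinear_le_one (h : F.Generic s) {b : ι} (hb : b ∈ s) {z : Fin 3 → K}
    (hz : crossProduct (F.e b) z ≠ 0) [DecidableEq ι] [DecidableEq K] :
    ((s.erase b).filter fun i => det3 (F.e b) (F.e i) z = 0).card ≤ 1 := by
  refine Finset.card_le_one.mpr fun i hi j hj => ?_
  simp only [Finset.mem_filter, Finset.mem_erase] at hi hj
  by_contra hij
  refine h.det_ne i hi.1.2 j hj.1.2 b hb hij hi.1.1 hj.1.1 ?_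
  have h1 : ∀ i, det3 (F.e b) (F.e i) z = 0 → crossProduct (F.e b) z ⬝ᵥ F.e i = 0 :=
    fun i hi => by
      rw [crossProduct_dotProduct, ← neg_eq_zero, ← hi]
      simp only [det3_expand]
      ring
  refine det3_eq_zero_of_dotProduct hz (h1 i hi.2) (h1 j hj.2) ?_
  rw [crossProduct_dotProduct, det3_expand]
  ring

/-- For a conic, `t` is symmetric. In degree 3 or 4 with no concurrent tangents, Bézout gives
`adjoint = f * g`. By `gradAt_quotient` the gradient of `g` at `e a` is not zero along the tangent
`t a`; but for well chosen `b` and `c`, `g` vanishes on that whole line. -/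
theorem Generic.exists_concurrent_of_gradAt [Finite K] (h : F.Generic s) (h2 : (2 : K) ≠ 0)
    (hK : 4 < Nat.card K) (hs : 30 ≤ s.card) {f : MvPolynomial (Fin 3) K} {d : ℕ}
    (hf : f.IsHomogeneous d) (hirr : Irreducible f) (hd : d ≤ 4)
    (hfs : ∀ i ∈ s, eval (F.e i) f = 0) (hg : ∀ i ∈ s, gradAt f (F.e i) = F.t i) :
    ∃ s' ⊆ s, 5 ≤ s'.card ∧ ((∃ Q : Fin 3 → K, Q ≠ 0 ∧ ∀ i ∈ s', F.t i ⬝ᵥ Q = 0) ∨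
      ∃ P : Fin 3 → K, P ≠ 0 ∧ ∀ i ∈ s', F.u i ⬝ᵥ P = 0) := by
  classical
  have hd1 := h.one_lt_degree (by omega) hf hirr hfs
  by_cases hd2 : d = 2
  · subst hd2
    refine ⟨s, Finset.Subset.refl _, by omega, Or.inr ?_⟩
    refine h.concurrent_of_symmetric (by omega) fun i hi j hj => ?_
    rw [← hg i hi, ← hg j hj, gradAt_dotProduct_comm hf]
  by_contra hcon
  have hconc : ∀ Q : Fin 3 → K, Q ≠ 0 → (s.filter fun i => F.t i ⬝ᵥ Q = 0).card ≤ 4 := by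
    intro Q hQ
    by_contra hlt
    exact hcon ⟨_, Finset.filter_subset _ _, not_le.mp hlt, Or.inl ⟨Q, hQ, fun i hi =>
      (Finset.mem_filter.mp hi).2⟩⟩
  obtain ⟨a, ha⟩ : s.Nonempty := Finset.card_pos.mp (by omega)
  obtain ⟨v, hv, hv1⟩ := exists_dotProduct_eq (F.cross_ne_zero a) 0 1
  have hva : crossProduct v (F.e a) ≠ 0 := fun h0 => by
    obtain ⟨k, hk⟩ := exists_smul_of_crossProduct_eq_zero h0 (F.e_ne_zero a)
    rw [hk, dotProduct_smul, F.u_self, smul_zero] at hv1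
    exact zero_ne_one hv1
  set z : K → Fin 3 → K := fun x => v + x • F.e a with hz
  have huz : ∀ x, F.u a ⬝ᵥ z x = 1 := fun x => by
    rw [hz, dotProduct_add, dotProduct_smul, F.u_self, hv1, smul_zero, add_zero]
  have htz : ∀ x, F.t a ⬝ᵥ z x = 0 := fun x => by
    rw [hz, dotProduct_add, dotProduct_smul, F.t_self, hv, smul_zero, add_zero]
  have hz0 : ∀ x, z x ≠ 0 := fun x h0 => by
    have := huz x
    rw [h0, dotProduct_zero] at this
    exact zero_ne_one this
  have hp0 := alongLine_ne_zero hf hirr hd1 (by omega) hva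
  set R := (alongLine v (F.e a) f).roots.toFinset with hR
  have hRcard : R.card ≤ 4 := (Multiset.toFinset_card_le _).trans
    ((Polynomial.card_roots' _).trans ((alongLine_top hf v (F.e a)).1.trans hd))
  have hmemR : ∀ x, eval (z x) f = 0 → x ∈ R := fun x hx => by
    rw [hR, Multiset.mem_toFinset, Polynomial.mem_roots hp0, Polynomial.IsRoot, eval_alongLine]
    exact hx
  -- Points whose tangent passes through an intersection, other than `e a`, of the curve with the
  -- tangent at `e a`: at most four intersections, each on at most four tangents `t i`.
  set bad1 := R.biUnion fun x => s.filter fun i => F.t i ⬝ᵥ z x = 0 with hbad1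
  have hbad1card : bad1.card ≤ 16 :=
    (Finset.card_biUnion_le_card_mul _ _ 4 fun x _ => hconc (z x) (hz0 x)).trans (by omega)
  have hgood1 : ∀ i ∈ s, i ∉ bad1 → i ≠ a → ∀ y, F.t a ⬝ᵥ y = 0 → y ≠ 0 → eval y f = 0 →
      F.t i ⬝ᵥ y ≠ 0 := by
    intro i hi hib hia y hy hy0 hyf
    by_cases huy : F.u a ⬝ᵥ y = 0
    · obtain ⟨k, hk, hek⟩ := exists_smul_crossProduct hy huy hy0 (F.cross_ne_zero a)
      obtain ⟨l, hl, hel⟩ := exists_smul_crossProduct (F.t_self a) (F.u_self a) (F.e_ne_zero a)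
        (F.cross_ne_zero a)
      have hia' := h.t_ne i hi a ha hia
      rw [hel, dotProduct_smul] at hia'
      rw [hek, dotProduct_smul]
      exact smul_ne_zero hk (right_ne_zero_of_mul hia')
    · obtain ⟨x, hx⟩ := F.exists_alongLine_eq_smul hv hv1 hy huy
      rw [hx, eval_smul_of_isHomogeneous hf] at hyf
      have hxR := hmemR x ((mul_eq_zero.mp hyf).resolve_left (pow_ne_zero _ huy))
      rw [hx, dotProduct_smul]
      refine smul_ne_zero huy fun h0 => hib ?_
      exact Finset.mem_biUnion.mpr ⟨x, hxR, Finset.mem_filter.mpr ⟨hi, h0⟩⟩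
  obtain ⟨b, hb, hb'⟩ : ∃ b ∈ s, b ∉ insert a bad1 :=
    Finset.exists_mem_notMem_of_card_lt_card (lt_of_le_of_lt (Finset.card_insert_le _ _) (by omega))
  rw [Finset.mem_insert, not_or] at hb'
  -- Avoiding these for `c` makes the line through `e b` and `e c` meet the tangent at `e a` off the
  -- curve.
  set bad2 := R.biUnion fun x => (s.erase b).filter fun i => det3 (F.e b) (F.e i) (z x) = 0
    with hbad2
  have hbad2card : bad2.card ≤ 4 := by
    refine (Finset.card_biUnion_le_card_mul _ _ 1 fun x _ => ?_).trans (by omega)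
    refine card_collinear_le_one h hb fun h0 => ?_
    obtain ⟨k, hk⟩ := exists_smul_of_crossProduct_eq_zero h0 (hz0 x)
    refine h.t_ne a ha b hb (Ne.symm hb'.1) ?_
    rw [hk, dotProduct_smul, htz, smul_zero]
  obtain ⟨c, hc, hc'⟩ : ∃ c ∈ s, c ∉ insert a (insert b (bad1 ∪ bad2)) := by
    refine Finset.exists_mem_notMem_of_card_lt_card (lt_of_le_of_lt (Finset.card_insert_le _ _) ?_)
    have h1 := Finset.card_insert_le b (bad1 ∪ bad2)
    have h2 := Finset.card_union_le bad1 bad2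
    omega
  simp only [Finset.mem_insert, Finset.mem_union, not_or] at hc'
  obtain ⟨hca, hcb, hc1, hc2⟩ := hc'
  obtain ⟨hba, hb1⟩ := hb'
  have hΔ := h.det_ne a ha b hb c hc (Ne.symm hba) (Ne.symm hca) (Ne.symm hcb)
  -- The intersection of that line with the tangent at `e a`.
  set w : Fin 3 → K := (F.t a ⬝ᵥ F.e c) • F.e b - (F.t a ⬝ᵥ F.e b) • F.e c with hw
  have htw : F.t a ⬝ᵥ w = 0 := by
    simp only [hw, dotProduct_sub, dotProduct_smul, smul_eq_mul]; ring
  have huw : F.u a ⬝ᵥ w ≠ 0 := by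
    obtain ⟨k, -, hk⟩ := F.exists_det3_eq a
    intro h0
    refine hΔ ?_
    rw [hk]
    simp only [hw, dotProduct_sub, dotProduct_smul, smul_eq_mul] at h0
    linear_combination (-k) * h0
  have hfw : eval w f ≠ 0 := fun h0 => by
    obtain ⟨x, hx⟩ := F.exists_alongLine_eq_smul hv hv1 htw huw
    rw [hx, eval_smul_of_isHomogeneous hf] at h0
    have hxR := hmemR x ((mul_eq_zero.mp h0).resolve_left (pow_ne_zero _ huw))
    refine hc2 (Finset.mem_biUnion.mpr ⟨x, hxR, Finset.mem_filter.mpr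
      ⟨Finset.mem_erase.mpr ⟨hcb, hc⟩, ?_⟩⟩)
    refine (mul_eq_zero_iff_left huw).mp ?_
    have : (F.u a ⬝ᵥ w) * det3 (F.e b) (F.e c) (z x) =
        det3 (F.e b) (F.e c) ((F.u a ⬝ᵥ w) • z x) := by
      simp only [det3_expand, Pi.smul_apply, smul_eq_mul]; ring
    rw [this, hz, ← hx, hw]
    simp only [det3_expand, Pi.smul_apply, Pi.sub_apply, smul_eq_mul]
    ring
  -- Bézout: `d * (d + 3) ≤ 28`, against 30 points.
  have hdvd : f ∣ F.adjoint f a b c := by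
    by_contra hnd
    have := card_le_of_irreducible hf hirr (F.isHomogeneous_adjoint hf hd1.le a b c) hnd s F.e
      h.crossProduct_ne_zero (fun j _ => F.e_ne_zero j) hfs
      fun j hj => F.eval_adjoint (hg j hj) a b c
    interval_cases d <;> omega
  obtain ⟨g, hfg⟩ := hdvd
  have hquot : ∀ v, F.t a ⬝ᵥ v ≠ 0 → _ := fun v hv =>
    F.gradAt_quotient hf (hfs a ha) (hg a ha) hfg hv
  have hgw : alongLine (F.e a) w g = 0 := by
    have hline := congrArg (alongLine (F.e a) w) hfg
    have z1 : crossProduct (F.e b) (F.e c) ⬝ᵥ w = 0 := by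
      rw [crossProduct_dotProduct, hw]
      simp only [det3_expand, Pi.smul_apply, Pi.sub_apply, smul_eq_mul]
      ring
    have ez : ∀ x, eval (F.e a + x • w) f = 0 → ∀ i ∈ s, i ∉ bad1 → i ≠ a →
        (F.t i ⬝ᵥ F.e a) + (F.t i ⬝ᵥ w) * x ≠ 0 := by
      intro x hx i hi hi1 hia
      have := hgood1 i hi hi1 hia (F.e a + x • w)
        (by rw [dotProduct_add, dotProduct_smul, F.t_self, htw, smul_zero, add_zero])
        (fun h0 => ?_) hx
      · rwa [dotProduct_add, dotProduct_smul, smul_eq_mul, mul_comm] at this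
      · have hx0 := congrArg (F.u a ⬝ᵥ ·) h0
        simp only [dotProduct_add, dotProduct_smul, F.u_self, zero_add, dotProduct_zero,
          smul_eq_mul] at hx0
        rw [(mul_eq_zero.mp hx0).resolve_right huw, zero_smul, add_zero] at h0
        exact F.e_ne_zero a h0
    -- On the tangent `t a` only the first summand of the adjoint survives, and its factor `join b
    -- c` is constant along `e a + x • w` because it vanishes at `w`.
    refine eq_zero_of_polar_mul_eq (d := d) (p := alongLine (F.e a) w f)
      (w := crossProduct (F.e b) (F.e c) ⬝ᵥ F.e a * (F.u a ⬝ᵥ w))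
      (α := F.t b ⬝ᵥ F.e a) (β := F.t b ⬝ᵥ w) (γ := F.t c ⬝ᵥ F.e a) (δ := F.t c ⬝ᵥ w)
      (by omega) (alongLine_top hf _ _).1 ?_ ?_ ?_ (Or.inl (h.t_ne b hb a ha hba))
      (Or.inl (h.t_ne c hc a ha hca)) (fun x hx => ?_) (fun x hx => ?_) ?_
    · rw [coeff_zero_alongLine, hfs a ha]
    · rw [coeff_one_alongLine, hg a ha, htw]
    · rw [(alongLine_top hf _ _).2]; exact hfw
    · exact ez x (by rw [← eval_alongLine]; exact hx) b hb hb1 hba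
    · exact ez x (by rw [← eval_alongLine]; exact hx) c hc hc1 hca
    · simp only [adjoint, join, map_add, map_mul, alongLine_polar _ _ hf, alongLine_linForm,
        F.t_self, F.u_self, htw, z1, map_zero, zero_mul, mul_zero, zero_add, add_zero] at hline
      rw [← hline, Polynomial.C_mul]
      ring
  have hgw0 : gradAt g (F.e a) ⬝ᵥ w = 0 := by
    rw [← coeff_one_alongLine, hgw, Polynomial.coeff_zero]
  have htab := h.t_ne a ha b hb (Ne.symm hba)
  -- `gradAt_quotient` needs a direction off the tangent, so `w` is reached as the difference of `w
  -- + e b` and `e b`.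
  have q1 := hquot (F.e b) htab
  have q2 := hquot (w + F.e b) (by rw [dotProduct_add, htw, zero_add]; exact htab)
  rw [dotProduct_add, dotProduct_add, hgw0, q1] at q2
  have hd20 : ((d : K) - 2) ≠ 0 := by
    have : d = 3 ∨ d = 4 := by omega
    rcases this with rfl | rfl
    · norm_num
    · norm_num [h2]
  refine mul_ne_zero (mul_ne_zero (mul_ne_zero (mul_ne_zero hd20 hΔ) (h.t_ne b hb a ha hba))
    (h.t_ne c hc a ha hca)) huw ?_
  linear_combination -q2

lemma Generic.exists_concurrent_of_gradAt_smul [Finite K] (h : F.Generic s) (h2 : (2 : K) ≠ 0)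
    (hK : 4 < Nat.card K) (hs : 30 ≤ s.card) {f : MvPolynomial (Fin 3) K} {d : ℕ}
    (hf : f.IsHomogeneous d) (hirr : Irreducible f) (hd : d ≤ 4)
    (hfs : ∀ i ∈ s, eval (F.e i) f = 0)
    (hg : ∀ i ∈ s, ∃ c : K, c ≠ 0 ∧ gradAt f (F.e i) = c • F.t i) :
    ∃ s' ⊆ s, 5 ≤ s'.card ∧ ((∃ Q : Fin 3 → K, Q ≠ 0 ∧ ∀ i ∈ s', F.t i ⬝ᵥ Q = 0) ∨
      ∃ P : Fin 3 → K, P ≠ 0 ∧ ∀ i ∈ s', F.u i ⬝ᵥ P = 0) := by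
  have hg' : ∀ i, ∃ c : K, c ≠ 0 ∧ (i ∈ s → gradAt f (F.e i) = c • F.t i) := fun i => by
    by_cases hi : i ∈ s
    · obtain ⟨c, hc, h⟩ := hg i hi
      exact ⟨c, hc, fun _ => h⟩
    · exact ⟨1, one_ne_zero, fun h => absurd h hi⟩
  choose c hc hgc using hg'
  obtain ⟨s', hs', hcard, hQ⟩ := (h.rescale c hc).exists_concurrent_of_gradAt h2 hK hs hf hirr hd
    hfs hgc
  refine ⟨s', hs', hcard, hQ.imp ?_ ?_⟩
  all_goals
    rintro ⟨Q, hQ0, hQ⟩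
    refine ⟨Q, hQ0, fun i hi => ?_⟩
    have := hQ i hi
    simp only [SegreFamily.rescale, smul_dotProduct] at this
    exact (smul_eq_zero.mp this).resolve_left (hc i)

/-- A generic family of points on an irreducible curve of degree at most 4 contains many points
whose tangents, or whose 3-secants, are concurrent. -/
theorem Generic.exists_concurrent [Finite K] (h : F.Generic s) (h2 : (2 : K) ≠ 0)
    (hK : 4 < Nat.card K) (hs : 72 ≤ s.card) {f : MvPolynomial (Fin 3) K} {d : ℕ}
    (hf : f.IsHomogeneous d) (hirr : Irreducible f) (hd : d ≤ 4)
    (hfs : ∀ i ∈ s, eval (F.e i) f = 0) :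
    ∃ s' ⊆ s, 5 ≤ s'.card ∧ ((∃ Q : Fin 3 → K, Q ≠ 0 ∧ ∀ i ∈ s', F.t i ⬝ᵥ Q = 0) ∨
      ∃ P : Fin 3 → K, P ≠ 0 ∧ ∀ i ∈ s', F.u i ⬝ᵥ P = 0) := by
  classical
  have hsing := card_singular_le h2 hK hf hirr hd (s.filter fun i => gradAt f (F.e i) = 0) F.e
    (h.mono (Finset.filter_subset _ _)).crossProduct_ne_zero (fun i _ => F.e_ne_zero i)
    (fun i hi => hfs i (Finset.mem_of_mem_filter i hi)) fun i hi => (Finset.mem_filter.mp hi).2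
  set s1 := s.filter fun i => ∃ c : K, c ≠ 0 ∧ gradAt f (F.e i) = c • F.t i with hs1
  set s2 := s.filter fun i => ∃ c : K, c ≠ 0 ∧ gradAt f (F.e i) = c • F.u i with hs2
  have hcover : s ⊆ (s.filter fun i => gradAt f (F.e i) = 0) ∪ (s1 ∪ s2) := by
    intro i hi
    by_cases hgi : gradAt f (F.e i) = 0
    · exact Finset.mem_union_left _ (Finset.mem_filter.mpr ⟨hi, hgi⟩)
    · refine Finset.mem_union_right _ ?_
      obtain ⟨c, hc, h1 | h1⟩ := h.gradAt_eq h2 hf hirr hd (by omega) hfs hi hgi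
      · exact Finset.mem_union_left _ (Finset.mem_filter.mpr ⟨hi, c, hc, h1⟩)
      · exact Finset.mem_union_right _ (Finset.mem_filter.mpr ⟨hi, c, hc, h1⟩)
  have hc1 := Finset.card_le_card hcover
  have hc2 := Finset.card_union_le (s.filter fun i => gradAt f (F.e i) = 0) (s1 ∪ s2)
  have hc3 := Finset.card_union_le s1 s2
  -- At most 12 of the 72 points are singular, so one of the two classes has at least 30; the second
  -- is the first for the swapped family.
  by_cases hbig : 30 ≤ s1.card
  · obtain ⟨s', hs', hQ⟩ := (h.mono (Finset.filter_subset _ _)).exists_concurrent_of_gradAt_smul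
      h2 hK hbig hf hirr hd (fun i hi => hfs i (Finset.mem_of_mem_filter i hi))
      fun i hi => (Finset.mem_filter.mp hi).2
    exact ⟨s', hs'.trans (Finset.filter_subset _ _), hQ⟩
  · obtain ⟨s', hs', hcard, hQ⟩ :=
      (h.swap.mono (Finset.filter_subset _ _)).exists_concurrent_of_gradAt_smul
      (s := s2) h2 hK (by omega) hf hirr hd (fun i hi => hfs i (Finset.mem_of_mem_filter i hi))
      fun i hi => (Finset.mem_filter.mp hi).2
    exact ⟨s', hs'.trans (Finset.filter_subset _ _), hcard, hQ.symm⟩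

end SegreFamily

end SegreFamilies

/-! ### Uniqueness of the conic through five points. -/

section ConicsThroughFivePoints

variable {K : Type*} [Field K]

lemma dotProduct_eq_of_three {a b x y z : Fin 3 → K} (hd : det3 x y z ≠ 0)
    (hx : a ⬝ᵥ x = b ⬝ᵥ x) (hy : a ⬝ᵥ y = b ⬝ᵥ y) (hz : a ⬝ᵥ z = b ⬝ᵥ z) : a = b := by
  rw [← sub_eq_zero]
  refine dotProduct_eq_zero _ fun w => ?_
  refine (smul_eq_zero.mp ?_).resolve_left hd
  rw [← dotProduct_smul, cramer_three x y z w]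
  simp only [dotProduct_add, dotProduct_smul, sub_dotProduct, hx, hy, hz, sub_self, smul_zero,
    add_zero]

lemma det3_rotate (x y z : Fin 3 → K) : det3 x y z = det3 y z x := by
  simp only [det3_expand]; ring

lemma mulVec_dotProduct_three (N : Matrix (Fin 3) (Fin 3) K) {x a b c : Fin 3 → K} {p q r : K}
    (hx : x = p • a + q • b + r • c) (ha : a ⬝ᵥ N.mulVec a = 0) (hb : b ⬝ᵥ N.mulVec b = 0)
    (hc : c ⬝ᵥ N.mulVec c = 0) : x ⬝ᵥ N.mulVec x =
      (q * r) * (b ⬝ᵥ N.mulVec c + c ⬝ᵥ N.mulVec b) +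
      (p * r) * (a ⬝ᵥ N.mulVec c + c ⬝ᵥ N.mulVec a) +
      (p * q) * (a ⬝ᵥ N.mulVec b + b ⬝ᵥ N.mulVec a) := by
  subst hx
  simp only [Matrix.mulVec_add, Matrix.mulVec_smul, add_dotProduct, dotProduct_add,
    smul_dotProduct, dotProduct_smul, smul_eq_mul]
  linear_combination p ^ 2 * ha + q ^ 2 * hb + r ^ 2 * hc

/-- A conic through five points, no three of which are collinear, is unique. -/
lemma exists_conic_eq_mul {N Q : Matrix (Fin 3) (Fin 3) K} {a b c d f : Fin 3 → K}
    (hN : ∀ x ∈ ({a, b, c, d, f} : Set (Fin 3 → K)), x ⬝ᵥ N.mulVec x = 0)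
    (hQ : ∀ x ∈ ({a, b, c, d, f} : Set (Fin 3 → K)), x ⬝ᵥ Q.mulVec x = 0)
    (hQ0 : ∃ x, x ⬝ᵥ Q.mulVec x ≠ 0) (habc : det3 a b c ≠ 0) (had : det3 a d f ≠ 0)
    (hd : det3 b c d ≠ 0) (hf : det3 b c f ≠ 0) :
    ∃ k : K, ∀ x, x ⬝ᵥ N.mulVec x = k * (x ⬝ᵥ Q.mulVec x) := by
  -- In coordinates on `a, b, c`, conics through these points become lines `m · v(x) = 0` under the
  -- quadratic Cremona map `v`. Passing through `d` and `f` fixes the line as `v d × v f`.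
  have hcoord : ∀ x, ∃ v : Fin 3 → K, ∀ R : Matrix (Fin 3) (Fin 3) K,
      a ⬝ᵥ R.mulVec a = 0 → b ⬝ᵥ R.mulVec b = 0 → c ⬝ᵥ R.mulVec c = 0 →
      (x ⬝ᵥ R.mulVec x) * det3 a b c ^ 2 =
        ![b ⬝ᵥ R.mulVec c + c ⬝ᵥ R.mulVec b, a ⬝ᵥ R.mulVec c + c ⬝ᵥ R.mulVec a,
          a ⬝ᵥ R.mulVec b + b ⬝ᵥ R.mulVec a] ⬝ᵥ v ∧
        v = ![det3 a x c * det3 a b x, det3 x b c * det3 a b x, det3 x b c * det3 a x c] := by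
    intro x
    refine ⟨![det3 a x c * det3 a b x, det3 x b c * det3 a b x, det3 x b c * det3 a x c],
      fun R ha hb hc => ⟨?_, rfl⟩⟩
    have := mulVec_dotProduct_three R (cramer_three a b c x) ha hb hc
    simp only [Matrix.mulVec_smul, smul_dotProduct, dotProduct_smul, smul_eq_mul] at this
    rw [dotProduct_three ![_, _, _]]
    simp only [Matrix.cons_val]
    linear_combination this
  choose v hv using hcoord
  have hNv := fun x => hv x N (hN a (by simp)) (hN b (by simp)) (hN c (by simp))
  have hQv := fun x => hv x Q (hQ a (by simp)) (hQ b (by simp)) (hQ c (by simp))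
  set n := ![b ⬝ᵥ N.mulVec c + c ⬝ᵥ N.mulVec b, a ⬝ᵥ N.mulVec c + c ⬝ᵥ N.mulVec a,
    a ⬝ᵥ N.mulVec b + b ⬝ᵥ N.mulVec a] with hn
  set m := ![b ⬝ᵥ Q.mulVec c + c ⬝ᵥ Q.mulVec b, a ⬝ᵥ Q.mulVec c + c ⬝ᵥ Q.mulVec a,
    a ⬝ᵥ Q.mulVec b + b ⬝ᵥ Q.mulVec a] with hm
  have hm0 : m ≠ 0 := by
    intro h0
    obtain ⟨x, hx⟩ := hQ0
    have := (hQv x).1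
    rw [h0, zero_dotProduct] at this
    exact hx ((mul_eq_zero.mp this).resolve_right (pow_ne_zero _ habc))
  have hcross : crossProduct (v d) (v f) ≠ 0 := by
    intro h0
    have h0' := congrFun h0 0
    rw [(hNv d).2, (hNv f).2, cross_apply] at h0'
    simp only [Matrix.cons_val, Pi.zero_apply] at h0'
    have : det3 a b c * det3 a d f * det3 d b c * det3 f b c = 0 := by
      have e : det3 a b c * det3 a d f = det3 a d c * det3 a b f - det3 a b d * det3 a f c := by
        simp only [det3_expand]; ring
      rw [e]
      linear_combination -h0'
    have h3' : det3 d b c ≠ 0 := by rwa [det3_rotate]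
    have h6' : det3 f b c ≠ 0 := by rwa [det3_rotate]
    exact mul_ne_zero (mul_ne_zero (mul_ne_zero habc had) h3') h6' this
  have hz : ∀ {w : Fin 3 → K} {R : Matrix (Fin 3) (Fin 3) K} {z : Fin 3 → K},
      z ⬝ᵥ R.mulVec z = 0 → (z ⬝ᵥ R.mulVec z) * det3 a b c ^ 2 = w ⬝ᵥ v z → v z ⬝ᵥ w = 0 := by
    intro w R z h0 h
    rw [dotProduct_comm, ← h, h0, zero_mul]
  obtain ⟨k, hk, hmk⟩ := exists_smul_crossProduct (hz (hQ d (by simp)) (hQv d).1)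
    (hz (hQ f (by simp)) (hQv f).1) hm0 hcross
  have hnk : ∃ k' : K, n = k' • crossProduct (v d) (v f) := by
    by_cases hn0 : n = 0
    · exact ⟨0, by rw [hn0, zero_smul]⟩
    · obtain ⟨k', -, h⟩ := exists_smul_crossProduct (hz (hN d (by simp)) (hNv d).1)
        (hz (hN f (by simp)) (hNv f).1) hn0 hcross
      exact ⟨k', h⟩
  obtain ⟨k', hnk⟩ := hnk
  refine ⟨k' / k, fun x => ?_⟩
  refine mul_right_cancel₀ (pow_ne_zero 2 habc) ?_
  rw [(hNv x).1, mul_assoc, (hQv x).1, hnk, hmk, smul_dotProduct, smul_dotProduct, smul_eq_mul,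
    smul_eq_mul]
  field_simp

end ConicsThroughFivePoints

/-! ### From five concurrent 3-secants to the whole family. -/

section ConcurrentSecants

variable {K : Type*} [Field K] {ι : Type*}

namespace SegreFamily

variable {F : SegreFamily ι K} {s : Finset ι}

/-- If `t i · e j` is symmetric then the tangents are the polars of a conic, at three points. -/
lemma Generic.exists_symmetric_form (h : F.Generic s) (h2 : (2 : K) ≠ 0) (hs : 3 ≤ s.card)
    (hsymm : ∀ i ∈ s, ∀ j ∈ s, F.t i ⬝ᵥ F.e j = F.t j ⬝ᵥ F.e i) :
    ∃ M : Matrix (Fin 3) (Fin 3) K, (∀ x y, x ⬝ᵥ M.mulVec y = y ⬝ᵥ M.mulVec x) ∧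
      (∀ x, M.mulVec x = 0 → x = 0) ∧ ∀ i ∈ s, M.mulVec (F.e i) = F.t i := by
  obtain ⟨a, ha, b, hb, c, hc, hab, hac, hbc⟩ := Finset.two_lt_card.mp hs
  have hΔ := h.det_ne a ha b hb c hc hab hac hbc
  set Δ := det3 (F.e a) (F.e b) (F.e c) with hΔdef
  -- The linear map that sends `e a, e b, e c` to their tangents.
  set M : Matrix (Fin 3) (Fin 3) K := Δ⁻¹ •
    (Matrix.vecMulVec (F.t a) (crossProduct (F.e b) (F.e c)) +
      Matrix.vecMulVec (F.t b) (crossProduct (F.e c) (F.e a)) +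
      Matrix.vecMulVec (F.t c) (crossProduct (F.e a) (F.e b))) with hM
  have hMx : ∀ x, M.mulVec x = Δ⁻¹ • (det3 x (F.e b) (F.e c) • F.t a +
      det3 x (F.e c) (F.e a) • F.t b + det3 x (F.e a) (F.e b) • F.t c) := by
    intro x
    simp only [hM, Matrix.smul_mulVec, Matrix.add_mulVec, Matrix.vecMulVec_mulVec,
      crossProduct_dotProduct, op_smul_eq_smul]
  have sab := hsymm a ha b hb
  have sac := hsymm a ha c hc
  have sbc := hsymm b hb c hc
  have hsym : ∀ x y, x ⬝ᵥ M.mulVec y = y ⬝ᵥ M.mulVec x := by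
    intro x y
    refine mul_left_cancel₀ (mul_ne_zero hΔ hΔ) ?_
    have key : ∀ x y, Δ * Δ * (x ⬝ᵥ M.mulVec y) =
        det3 y (F.e b) (F.e c) * (F.t a ⬝ᵥ Δ • x) + det3 y (F.e c) (F.e a) * (F.t b ⬝ᵥ Δ • x) +
          det3 y (F.e a) (F.e b) * (F.t c ⬝ᵥ Δ • x) := by
      intro x y
      rw [hMx, dotProduct_comm]
      simp only [dotProduct_smul, smul_dotProduct, add_dotProduct, smul_eq_mul]
      field_simp
    rw [key, key, hΔdef, cramer_three _ _ _ x, cramer_three _ _ _ y]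
    simp only [dotProduct_smul, dotProduct_add, smul_eq_mul, F.t_self]
    have e1 : ∀ x, det3 x (F.e c) (F.e a) = det3 (F.e a) x (F.e c) := fun x => by
      simp only [det3_expand]; ring
    have e2 : ∀ x, det3 x (F.e a) (F.e b) = det3 (F.e a) (F.e b) x := fun x => by
      simp only [det3_expand]; ring
    rw [e1, e1, e2, e2, sab, sac, sbc]
    ring
  have hMa : M.mulVec (F.e a) = F.t a := by
    have e1 : det3 (F.e a) (F.e c) (F.e a) = 0 := by simp only [det3_expand]; ring
    have e2 : det3 (F.e a) (F.e a) (F.e b) = 0 := by simp only [det3_expand]; ring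
    rw [hMx, e1, e2, zero_smul, zero_smul, add_zero, add_zero, smul_smul, inv_mul_cancel₀ hΔ,
      one_smul]
  have hMb : M.mulVec (F.e b) = F.t b := by
    have e1 : det3 (F.e b) (F.e b) (F.e c) = 0 := by simp only [det3_expand]; ring
    have e2 : det3 (F.e b) (F.e a) (F.e b) = 0 := by simp only [det3_expand]; ring
    have e3 : det3 (F.e b) (F.e c) (F.e a) = Δ := by rw [hΔdef]; simp only [det3_expand]; ring
    rw [hMx, e1, e2, e3, zero_smul, zero_smul, add_zero, zero_add, smul_smul, inv_mul_cancel₀ hΔ,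
      one_smul]
  have hMc : M.mulVec (F.e c) = F.t c := by
    have e1 : det3 (F.e c) (F.e b) (F.e c) = 0 := by simp only [det3_expand]; ring
    have e2 : det3 (F.e c) (F.e c) (F.e a) = 0 := by simp only [det3_expand]; ring
    have e3 : det3 (F.e c) (F.e a) (F.e b) = Δ := by rw [hΔdef]; simp only [det3_expand]; ring
    rw [hMx, e1, e2, e3, zero_smul, zero_smul, zero_add, zero_add, smul_smul, inv_mul_cancel₀ hΔ,
      one_smul]
  refine ⟨M, hsym, fun x hx => ?_, fun i hi => ?_⟩
  -- On this basis the form has zero diagonal, so its determinant is twice the product of the three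
  -- off-diagonal values.
  · have ex : ∀ y, (M.mulVec y) ⬝ᵥ (Δ • x) = 0 := fun y => by
      rw [dotProduct_smul, dotProduct_comm, hsym, hx, dotProduct_zero, smul_zero]
    have xa := ex (F.e a)
    have xb := ex (F.e b)
    have xc := ex (F.e c)
    rw [hMa, hΔdef, cramer_three] at xa
    rw [hMb, hΔdef, cramer_three] at xb
    rw [hMc, hΔdef, cramer_three] at xc
    simp only [dotProduct_smul, dotProduct_add, smul_eq_mul, F.t_self] at xa xb xc
    rw [← sab] at xb
    rw [← sac, ← sbc] at xc
    have tab := h.t_ne a ha b hb hab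
    have tac := h.t_ne a ha c hc hac
    have tbc := h.t_ne b hb c hc hbc
    have r : Δ • x = 0 := by
      rw [hΔdef, cramer_three]
      have z1 : det3 x (F.e b) (F.e c) = 0 := by
        refine (mul_eq_zero.mp (?_ : (2 * (F.t a ⬝ᵥ F.e b) * (F.t a ⬝ᵥ F.e c)) * _ = 0)).resolve_left
          (mul_ne_zero (mul_ne_zero h2 tab) tac)
        linear_combination (F.t a ⬝ᵥ F.e c) * xb + (F.t a ⬝ᵥ F.e b) * xc - (F.t b ⬝ᵥ F.e c) * xa
      rw [z1] at xb xc ⊢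
      have z2 : det3 (F.e a) (F.e b) x = 0 := by
        refine (mul_eq_zero.mp (?_ : _ * (F.t b ⬝ᵥ F.e c) = 0)).resolve_right tbc
        linear_combination xb
      have z3 : det3 (F.e a) x (F.e c) = 0 := by
        refine (mul_eq_zero.mp (?_ : _ * (F.t b ⬝ᵥ F.e c) = 0)).resolve_right tbc
        linear_combination xc
      rw [z2, z3, zero_smul, zero_smul, zero_smul, add_zero, add_zero]
    exact (smul_eq_zero.mp r).resolve_left hΔ
  · refine dotProduct_eq_of_three hΔ ?_ ?_ ?_
    · rw [dotProduct_comm, hsym, hMa, dotProduct_comm, hsymm a ha i hi]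
    · rw [dotProduct_comm, hsym, hMb, dotProduct_comm, hsymm b hb i hi]
    · rw [dotProduct_comm, hsym, hMc, dotProduct_comm, hsymm c hc i hi]

/-- If the 3-secants at five generic points are concurrent at `P`, then every point of the family,
apart from those on a certain line, has its 3-secant through `P`, and its tangent is the polar of
the point with respect to a fixed conic. -/
theorem Generic.secant_eq_of_concurrent (h : F.Generic s) (h2 : (2 : K) ≠ 0) (hs : 5 ≤ s.card)
    {P : Fin 3 → K} (hP0 : P ≠ 0) (hP : ∀ i ∈ s, F.u i ⬝ᵥ P = 0) :
    ∃ M : Matrix (Fin 3) (Fin 3) K, (∀ x y, x ⬝ᵥ M.mulVec y = y ⬝ᵥ M.mulVec x) ∧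
      (∀ x, M.mulVec x = 0 → x = 0) ∧ ∃ n : Fin 3 → K, n ≠ 0 ∧ ∀ i, n ⬝ᵥ F.e i = 0 ∨
        F.u i ⬝ᵥ P = 0 ∧ (crossProduct P (F.e i) ≠ 0 →
          ∃ c : K, c ≠ 0 ∧ F.u i = c • crossProduct P (F.e i) ∧ F.t i = c • M.mulVec (F.e i)) := by
  classical
  have hcross : ∀ i ∈ s, crossProduct P (F.e i) ≠ 0 := by
    intro i hi h0
    obtain ⟨k, hk⟩ := exists_smul_of_crossProduct_eq_zero h0 (F.e_ne_zero i)
    obtain ⟨j, hj, hji⟩ := Finset.exists_mem_ne (by omega : 1 < s.card) i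
    have := hP j hj
    rw [hk, dotProduct_smul] at this
    rcases smul_eq_zero.mp this with rfl | h0
    · exact hP0 (by rw [hk, zero_smul])
    · exact h.u_ne j hj i hi hji h0
  have hu_smul : ∀ i, F.u i ⬝ᵥ P = 0 → crossProduct P (F.e i) ≠ 0 →
      ∃ c : K, c ≠ 0 ∧ F.u i = c • crossProduct P (F.e i) := by
    intro i hi hc
    refine exists_smul_crossProduct (by rw [dotProduct_comm, hi])
      (by rw [dotProduct_comm, F.u_self]) ?_ hc
    intro h0
    exact F.cross_ne_zero i (by rw [h0, map_zero])
  -- Normalise to `u i = P × e i`. Then `u` is antisymmetric, and the Segre relation makes `t`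
  -- symmetric.
  have hscale : ∀ i, ∃ c : K, c ≠ 0 ∧ (i ∈ s → c • F.u i = crossProduct P (F.e i)) := by
    intro i
    by_cases hi : i ∈ s
    · obtain ⟨c, hc, h⟩ := hu_smul i (hP i hi) (hcross i hi)
      exact ⟨c⁻¹, inv_ne_zero hc, fun _ => by rw [h, smul_smul, inv_mul_cancel₀ hc, one_smul]⟩
    · exact ⟨1, one_ne_zero, fun h => absurd h hi⟩
  choose c hc hcu using hscale
  have hG := h.rescale c hc
  have hsymm : ∀ i ∈ s, ∀ j ∈ s, (F.rescale c hc).t i ⬝ᵥ (F.rescale c hc).e j =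
      (F.rescale c hc).t j ⬝ᵥ (F.rescale c hc).e i := by
    intro i hi j hj
    by_cases hij : i = j
    · rw [hij]
    have hr := (F.rescale c hc).rel i j
    have hne := hG.u_ne i hi j hj hij
    have ui : (F.rescale c hc).u i = crossProduct P (F.e i) := hcu i hi
    have uj : (F.rescale c hc).u j = crossProduct P (F.e j) := hcu j hj
    rw [ui, crossProduct_dotProduct] at hr hne
    rw [uj, crossProduct_dotProduct] at hr
    have e : det3 ((F.rescale c hc).e i) P (F.e j) = -det3 ((F.rescale c hc).e j) P (F.e i) := by
      simp only [SegreFamily.rescale, det3_expand]; ring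
    rw [e] at hr
    refine mul_right_cancel₀ hne ?_
    linear_combination -hr
  obtain ⟨M, hsym, hinj, hMt⟩ := hG.exists_symmetric_form h2 (by omega) hsymm
  have hMt' : ∀ i ∈ s, M.mulVec (F.e i) = c i • F.t i := hMt
  refine ⟨M, hsym, hinj, M.mulVec P, fun h0 => hP0 (hinj _ h0), fun y => ?_⟩
  -- For any `y`, the Segre relations of `y` with the points of `s` say that these lie on the conic
  -- `N`. They also lie on the conic `M`, and there are five of them, so `N = κ M` as quadratic
  -- forms.
  set N : Matrix (Fin 3) (Fin 3) K := Matrix.vecMulVec (M.mulVec (F.e y)) (F.u y) +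
    Matrix.vecMulVec (crossProduct (F.e y) P) (F.t y) with hN
  have hNx : ∀ x, x ⬝ᵥ N.mulVec x = (x ⬝ᵥ M.mulVec (F.e y)) * (F.u y ⬝ᵥ x) +
      det3 x (F.e y) P * (F.t y ⬝ᵥ x) := by
    intro x
    simp only [hN, Matrix.add_mulVec, Matrix.vecMulVec_mulVec, dotProduct_add, op_smul_eq_smul,
      dotProduct_smul, smul_eq_mul, det3]
    ring
  have hNs : ∀ i ∈ s, F.e i ⬝ᵥ N.mulVec (F.e i) = 0 := by
    intro i hi
    rw [hNx, hsym, hMt' i hi]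
    have e : det3 (F.e i) (F.e y) P = c i • F.u i ⬝ᵥ F.e y := by
      rw [hcu i hi, crossProduct_dotProduct]; simp only [det3_expand]; ring
    rw [e, dotProduct_comm, smul_dotProduct, smul_dotProduct, smul_eq_mul, smul_eq_mul]
    linear_combination c i * F.rel i y
  have hMs : ∀ i ∈ s, F.e i ⬝ᵥ M.mulVec (F.e i) = 0 := by
    intro i hi
    rw [hMt' i hi, dotProduct_comm, smul_dotProduct, F.t_self, smul_zero]
  obtain ⟨κ, hκ⟩ : ∃ k : K, ∀ x, x ⬝ᵥ N.mulVec x = k * (x ⬝ᵥ M.mulVec x) := by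
    obtain ⟨a, ha, b, hb, d, hd, hab, had, hbd⟩ := Finset.two_lt_card.mp (by omega : 2 < s.card)
    have hcard : 1 < (s \ {a, b, d}).card := by
      have := Finset.le_card_sdiff {a, b, d} s
      have := Finset.card_le_three (a := a) (b := b) (c := d)
      omega
    obtain ⟨f, hf, g, hg, hfg⟩ := Finset.one_lt_card.mp hcard
    simp only [Finset.mem_sdiff, Finset.mem_insert, Finset.mem_singleton, not_or] at hf hg
    obtain ⟨hf, hfa, hfb, hfd⟩ := hf
    obtain ⟨hg, hga, hgb, hgd⟩ := hg
    have mem : ∀ {x}, x ∈ ({F.e a, F.e b, F.e d, F.e f, F.e g} : Set (Fin 3 → K)) →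
        ∃ i ∈ s, x = F.e i := by
      rintro x (rfl | rfl | rfl | rfl | rfl)
      exacts [⟨a, ha, rfl⟩, ⟨b, hb, rfl⟩, ⟨d, hd, rfl⟩, ⟨f, hf, rfl⟩, ⟨g, hg, rfl⟩]
    refine exists_conic_eq_mul (a := F.e a) (b := F.e b) (c := F.e d) (d := F.e f) (f := F.e g)
      (fun x hx => ?_) (fun x hx => ?_) ⟨F.e a + F.e b, ?_⟩
      (h.det_ne a ha b hb d hd hab had hbd) (h.det_ne a ha f hf g hg (Ne.symm hfa) (Ne.symm hga) hfg)
      (h.det_ne b hb d hd f hf hbd (Ne.symm hfb) (Ne.symm hfd))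
      (h.det_ne b hb d hd g hg hbd (Ne.symm hgb) (Ne.symm hgd))
    · obtain ⟨i, hi, rfl⟩ := mem hx
      exact hNs i hi
    · obtain ⟨i, hi, rfl⟩ := mem hx
      exact hMs i hi
    · rw [Matrix.mulVec_add, add_dotProduct, dotProduct_add, dotProduct_add, hMs a ha, hMs b hb,
        hsym (F.e a) (F.e b), hMt' a ha, zero_add, add_zero, ← two_mul, dotProduct_comm]
      exact mul_ne_zero h2 (hG.t_ne a ha b hb hab)
  have hq : ∀ x, (x ⬝ᵥ M.mulVec (F.e y)) * (F.u y ⬝ᵥ x) + det3 x (F.e y) P * (F.t y ⬝ᵥ x) =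
      κ * (x ⬝ᵥ M.mulVec x) := fun x => by rw [← hNx, hκ]
  -- If `κ = 0`, the two products of linear forms in `hq` cancel, which matches `u y` with `P × e y`
  -- and `t y` with `M e y`. If `κ ≠ 0`, comparing the points `e y ± P`, where the determinant
  -- vanishes, puts `e y` on the polar of `P`.
  by_cases hκ0 : κ = 0
  · right
    simp only [hκ0, zero_mul] at hq
    have huP : F.u y ⬝ᵥ P = 0 := by
      obtain ⟨v, htv, huv⟩ := exists_dotProduct_eq (F.cross_ne_zero y) 1 0
      obtain ⟨k, hk, hdet⟩ := F.exists_det3_eq y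
      have := hq v
      rw [huv, htv, mul_zero, zero_add, mul_one, det3_rotate, hdet, htv, huv] at this
      simpa [hk] using this
    refine ⟨huP, fun hPy => ?_⟩
    obtain ⟨b, hb, hub⟩ := hu_smul y huP hPy
    refine ⟨b, hb, hub, ?_⟩
    have hprod : ∀ x, det3 x (F.e y) P * ((F.t y - b • M.mulVec (F.e y)) ⬝ᵥ x) = 0 := by
      intro x
      have := hq x
      rw [hub, smul_dotProduct, crossProduct_dotProduct, smul_eq_mul] at this
      have e : det3 x P (F.e y) = -det3 x (F.e y) P := by simp only [det3_expand]; ring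
      rw [e] at this
      rw [sub_dotProduct, smul_dotProduct, smul_eq_mul, dotProduct_comm (M.mulVec _)]
      linear_combination this
    obtain ⟨x₀, hx₀⟩ := exists_dotProduct_ne_zero hPy
    rw [crossProduct_dotProduct] at hx₀
    have hx₀' : det3 x₀ (F.e y) P ≠ 0 := by
      intro h0; apply hx₀; rw [← neg_eq_zero, ← h0]; simp only [det3_expand]; ring
    have hz₀ := (mul_eq_zero.mp (hprod x₀)).resolve_left hx₀'
    rw [← sub_eq_zero]
    refine dotProduct_eq_zero _ fun x => ?_
    by_cases hx : det3 x (F.e y) P = 0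
    · have hsum := hprod (x + x₀)
      have e : det3 (x + x₀) (F.e y) P = det3 x₀ (F.e y) P := by
        rw [det3, add_dotProduct, ← det3, ← det3, hx, zero_add]
      rw [e, dotProduct_add, hz₀, add_zero] at hsum
      exact (mul_eq_zero.mp hsum).resolve_left hx₀'
    · exact (mul_eq_zero.mp (hprod x)).resolve_left hx
  · left
    have hyy : F.e y ⬝ᵥ M.mulVec (F.e y) = 0 := by
      have e : det3 (F.e y) (F.e y) P = 0 := by simp only [det3_expand]; ring
      have := hq (F.e y)
      rw [F.u_self, F.t_self, mul_zero, mul_zero, add_zero] at this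
      exact (mul_eq_zero.mp this.symm).resolve_left hκ0
    have e1 : det3 (F.e y + P) (F.e y) P = 0 := by simp only [det3_expand, Pi.add_apply]; ring
    have e2 : det3 (F.e y - P) (F.e y) P = 0 := by simp only [det3_expand, Pi.sub_apply]; ring
    have q1 := hq (F.e y + P)
    have q2 := hq (F.e y - P)
    rw [e1] at q1
    rw [e2] at q2
    simp only [Matrix.mulVec_add, Matrix.mulVec_sub, add_dotProduct, sub_dotProduct,
      dotProduct_add, dotProduct_sub, F.u_self, hyy, hsym (F.e y) P] at q1 q2
    have h4 : (2 * 2 * κ) * (P ⬝ᵥ M.mulVec (F.e y)) = 0 := by linear_combination q2 - q1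
    rw [dotProduct_comm, hsym]
    exact (mul_eq_zero.mp h4).resolve_left (mul_ne_zero (mul_ne_zero h2 h2) hκ0)

end SegreFamily

end ConcurrentSecants

/-! ### Pairs sharing a 3-secant, and the dichotomy for Segre families. -/

section PartnerDichotomy

variable {K : Type*} [Field K] {ι : Type*}

namespace SegreFamily

open MvPolynomial

variable {F : SegreFamily ι K} {s : Finset ι}

/-- The quartic attached to two pairs of points `a, b` and `c, d`, where `a, b` share their
3-secant, and so do `c, d`. It is a factor of the sextic. -/
noncomputable def quartic (F : SegreFamily ι K) (a b c d : ι) (ρ ρ' σ σ' : K) :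
    MvPolynomial (Fin 3) K :=
  F.conic a d * F.conic b c - F.join a d * F.join b c *
    (linForm (ρ • F.t b - ρ' • F.t a) * linForm (σ • F.t d - σ' • F.t c))

lemma isHomogeneous_quartic (F : SegreFamily ι K) (a b c d : ι) (ρ ρ' σ σ' : K) :
    (F.quartic a b c d ρ ρ' σ σ').IsHomogeneous 4 :=
  ((F.isHomogeneous_conic _ _).mul (F.isHomogeneous_conic _ _)).sub
    (((isHomogeneous_linForm _).mul (isHomogeneous_linForm _)).mul
      ((isHomogeneous_linForm _).mul (isHomogeneous_linForm _)))

lemma eval_conic_of_partner {a b : ι} {ρ ρ' : K}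
    (ha : F.u a = ρ • crossProduct (F.e a) (F.e b)) (hb : F.u b = ρ' • crossProduct (F.e a) (F.e b))
    (y : Fin 3 → K) : eval y (F.conic a b) =
      eval y (F.join a b) * ((ρ • F.t b - ρ' • F.t a) ⬝ᵥ y) := by
  rw [eval_conic, join, eval_linForm, ha, hb]
  simp only [sub_dotProduct, smul_dotProduct, smul_eq_mul]
  ring

lemma join_mul_quartic {a b c d : ι} {ρ ρ' σ σ' : K}
    (ha : F.u a = ρ • crossProduct (F.e a) (F.e b)) (hb : F.u b = ρ' • crossProduct (F.e a) (F.e b))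
    (hc : F.u c = σ • crossProduct (F.e c) (F.e d)) (hd : F.u d = σ' • crossProduct (F.e c) (F.e d))
    (y : Fin 3 → K) : eval y (F.join a b) * eval y (F.join c d) *
      eval y (F.quartic a b c d ρ ρ' σ σ') = eval y (F.sextic a b c d) := by
  simp only [quartic, sextic, map_sub, map_mul, eval_conic_of_partner ha hb,
    eval_conic_of_partner hc hd, eval_linForm]
  ring

lemma u_symm (ht : ∀ i j, i ≠ j → F.t i ⬝ᵥ F.e j ≠ 0) {i j : ι} (h : F.u i ⬝ᵥ F.e j = 0) :
    F.u j ⬝ᵥ F.e i = 0 := by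
  by_cases hij : i = j
  · subst hij; exact h
  have := F.rel i j
  rw [h, zero_mul, add_zero] at this
  exact (mul_eq_zero.mp this).resolve_left (ht i j hij)

lemma cross_e_ne_zero (ht : ∀ i j, i ≠ j → F.t i ⬝ᵥ F.e j ≠ 0) {i j : ι} (hij : i ≠ j) :
    crossProduct (F.e i) (F.e j) ≠ 0 :=
  crossProduct_ne_zero_of_dotProduct (F.t_self i) (ht i j hij) (F.e_ne_zero i)

lemma u_ne_zero (F : SegreFamily ι K) (i : ι) : F.u i ≠ 0 := fun h0 =>
  F.cross_ne_zero i (by rw [h0, map_zero])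

lemma exists_u_eq_smul_of_partner (ht : ∀ i j, i ≠ j → F.t i ⬝ᵥ F.e j ≠ 0) {i j : ι}
    (hij : i ≠ j) (h : F.u i ⬝ᵥ F.e j = 0) :
    (∃ ρ : K, ρ ≠ 0 ∧ F.u i = ρ • crossProduct (F.e i) (F.e j)) ∧
      ∃ ρ : K, ρ ≠ 0 ∧ F.u j = ρ • crossProduct (F.e i) (F.e j) := by
  have hc := cross_e_ne_zero ht hij
  exact ⟨exists_smul_crossProduct (by rw [dotProduct_comm, F.u_self])
      (by rw [dotProduct_comm, h]) (F.u_ne_zero i) hc,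
    exists_smul_crossProduct (by rw [dotProduct_comm, u_symm ht h])
      (by rw [dotProduct_comm, F.u_self]) (F.u_ne_zero j) hc⟩

/-- The outcome of the analysis of a Segre family: up to a bounded set of exceptions, either the
3-secants are different, or they are concurrent. -/
def Dichotomy (F : SegreFamily ι K) (N : ℕ) : Prop :=
  ∃ A₀ : Finset ι, A₀.card ≤ N ∧ ((∀ i j, i ∉ A₀ → j ∉ A₀ → i ≠ j → F.u i ⬝ᵥ F.e j ≠ 0) ∨
    ∃ P : Fin 3 → K, P ≠ 0 ∧ (∀ i, i ∉ A₀ → F.u i ⬝ᵥ P = 0) ∧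
      -- The position of `P` on a shared 3-secant is recorded in a form comparable with Segre's
      -- lemma for such a pair.
      ∀ i j, i ∉ A₀ → j ∉ A₀ → i ≠ j → F.u i ⬝ᵥ F.e j = 0 → ∃ α β : K,
        P = α • F.e i + β • F.e j ∧ ∀ o, (F.u i ⬝ᵥ o) * (F.t j ⬝ᵥ F.e i) * α +
          (F.u j ⬝ᵥ o) * (F.t i ⬝ᵥ F.e j) * β = 0)

variable [Finite ι]

/-- At most three points lie on the line `n` and at most one coincides with `P`. -/
lemma exists_exceptional_set (ht : ∀ i j, i ≠ j → F.t i ⬝ᵥ F.e j ≠ 0)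
    (hline : ∀ a : Fin 3 → K, a ≠ 0 → ∀ T : Finset ι, (∀ i ∈ T, a ⬝ᵥ F.e i = 0) → T.card ≤ 3)
    {n P : Fin 3 → K} (hn : n ≠ 0) (hP : P ≠ 0) :
    ∃ A₀ : Finset ι, A₀.card ≤ 4 ∧ ∀ i, i ∉ A₀ → n ⬝ᵥ F.e i ≠ 0 ∧ crossProduct P (F.e i) ≠ 0 := by
  classical
  have := Fintype.ofFinite ι
  refine ⟨Finset.univ.filter (fun i => n ⬝ᵥ F.e i = 0) ∪
    Finset.univ.filter (fun i => crossProduct P (F.e i) = 0), ?_, fun i hi => ?_⟩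
  · refine (Finset.card_union_le _ _).trans (Nat.add_le_add (b := 3) (d := 1) ?_ ?_)
    · exact hline n hn _ fun i hi => (Finset.mem_filter.mp hi).2
    · rw [Finset.card_le_one]
      intro i hi j hj
      by_contra hij
      obtain ⟨k, hk⟩ := exists_smul_of_crossProduct_eq_zero (Finset.mem_filter.mp hi).2
        (F.e_ne_zero i)
      have hj' := (Finset.mem_filter.mp hj).2
      rw [hk, map_smul, LinearMap.smul_apply] at hj'
      rcases smul_eq_zero.mp hj' with rfl | h0
      · exact hP (by rw [hk, zero_smul])
      · exact cross_e_ne_zero ht hij h0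
  · simp only [Finset.mem_union, Finset.mem_filter, Finset.mem_univ, true_and, not_or] at hi
    exact hi

lemma Generic.dichotomy_of_concurrent_u (h : F.Generic s) (h2 : (2 : K) ≠ 0)
    (ht : ∀ i j, i ≠ j → F.t i ⬝ᵥ F.e j ≠ 0)
    (hline : ∀ a : Fin 3 → K, a ≠ 0 → ∀ T : Finset ι, (∀ i ∈ T, a ⬝ᵥ F.e i = 0) → T.card ≤ 3)
    (hs : 5 ≤ s.card) {P : Fin 3 → K} (hP0 : P ≠ 0) (hP : ∀ i ∈ s, F.u i ⬝ᵥ P = 0) :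
    F.Dichotomy 4 := by
  obtain ⟨M, hsym, -, n, hn, hM⟩ := h.secant_eq_of_concurrent h2 hs hP0 hP
  obtain ⟨A₀, hA, hA'⟩ := exists_exceptional_set ht hline hn hP0
  have key := fun i hi => (hM i).resolve_left (hA' i hi).1
  refine ⟨A₀, hA, Or.inr ⟨P, hP0, fun i hi => (key i hi).1, fun i j hi hj hij hu => ?_⟩⟩
  obtain ⟨ci, hci, hui, hti⟩ := (key i hi).2 (hA' i hi).2
  obtain ⟨cj, hcj, huj, htj⟩ := (key j hj).2 (hA' j hj).2
  obtain ⟨a, b, hab⟩ := exists_eq_smul_add_smul (e := F.u i) (t := F.e i) (u := F.e j) (g := P)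
    (by rw [dotProduct_comm, F.u_self]) (by rw [dotProduct_comm, hu])
    (by rw [dotProduct_comm, (key i hi).1]) (F.u_ne_zero i) (cross_e_ne_zero ht hij)
  refine ⟨a, b, hab, fun o => ?_⟩
  rw [hui, huj, hti, htj]
  simp only [smul_dotProduct, crossProduct_dotProduct, smul_eq_mul]
  rw [dotProduct_comm (M.mulVec _), dotProduct_comm (M.mulVec _), hsym (F.e j) (F.e i), hab]
  have e1 : det3 o (a • F.e i + b • F.e j) (F.e i) = -(b * det3 o (F.e i) (F.e j)) := by
    simp only [det3_expand, Pi.add_apply, Pi.smul_apply, smul_eq_mul]; ring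
  have e2 : det3 o (a • F.e i + b • F.e j) (F.e j) = a * det3 o (F.e i) (F.e j) := by
    simp only [det3_expand, Pi.add_apply, Pi.smul_apply, smul_eq_mul]; ring
  rw [e1, e2]
  ring

/-- With the roles of `t` and `u` exchanged, `u i` is a multiple of `M e i` for an injective `M`, so
distinct points have distinct 3-secants. -/
lemma Generic.dichotomy_of_concurrent_t (h : F.Generic s) (h2 : (2 : K) ≠ 0)
    (ht : ∀ i j, i ≠ j → F.t i ⬝ᵥ F.e j ≠ 0)
    (hline : ∀ a : Fin 3 → K, a ≠ 0 → ∀ T : Finset ι, (∀ i ∈ T, a ⬝ᵥ F.e i = 0) → T.card ≤ 3)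
    (hs : 5 ≤ s.card) {Q : Fin 3 → K} (hQ0 : Q ≠ 0) (hQ : ∀ i ∈ s, F.t i ⬝ᵥ Q = 0) :
    F.Dichotomy 4 := by
  obtain ⟨M, hsym, hinj, n, hn, hM⟩ := h.swap.secant_eq_of_concurrent h2 hs hQ0 hQ
  obtain ⟨A₀, hA, hA'⟩ := exists_exceptional_set ht hline hn hQ0
  have key : ∀ i, i ∉ A₀ → ∃ c : K, c ≠ 0 ∧ F.u i = c • M.mulVec (F.e i) := fun i hi => by
    obtain ⟨c, hc, -, h⟩ := ((hM i).resolve_left (hA' i hi).1).2 (hA' i hi).2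
    exact ⟨c, hc, h⟩
  refine ⟨A₀, hA, Or.inl fun i j hi hj hij hu => ?_⟩
  obtain ⟨ci, hci, hui⟩ := key i hi
  obtain ⟨cj, hcj, huj⟩ := key j hj
  obtain ⟨⟨ρ, hρ, h1⟩, ρ', hρ', h2⟩ := exists_u_eq_smul_of_partner ht hij hu
  have hz : (ρ' * ci) • F.e i - (ρ * cj) • F.e j = 0 := by
    refine hinj _ ?_
    rw [Matrix.mulVec_sub, Matrix.mulVec_smul, Matrix.mulVec_smul, mul_smul, mul_smul, ← hui,
      ← huj, h1, h2, smul_smul, smul_smul, mul_comm, sub_self]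
  have := congrArg (F.t i ⬝ᵥ ·) hz
  simp only [dotProduct_sub, dotProduct_smul, F.t_self, dotProduct_zero, smul_eq_mul, mul_zero,
    zero_sub, neg_eq_zero, mul_eq_zero] at this
  rcases this with (h | h) | h
  exacts [hρ h, hcj h, ht i j hij h]

/-- Given many points that share their 3-secants, two such pairs `a, b` and `c, d` reduce the sextic
to a nonzero quartic through many generic points. A component of it feeds
`Generic.exists_concurrent`. -/
theorem dichotomy [Finite K] (F : SegreFamily ι K) (h2 : (2 : K) ≠ 0) (hK : 4 < Nat.card K)
    (ht : ∀ i j, i ≠ j → F.t i ⬝ᵥ F.e j ≠ 0)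
    (hcol : ∀ i j k, i ≠ j → i ≠ k → j ≠ k → det3 (F.e i) (F.e j) (F.e k) = 0 →
      F.u i ⬝ᵥ F.e j = 0)
    (hline : ∀ a : Fin 3 → K, a ≠ 0 → ∀ T : Finset ι, (∀ i ∈ T, a ⬝ᵥ F.e i = 0) → T.card ≤ 3) :
    F.Dichotomy 870 := by
  classical
  have := Fintype.ofFinite ι
  set bad := Finset.univ.filter fun i => ∃ j, i ≠ j ∧ F.u i ⬝ᵥ F.e j = 0 with hbad
  by_cases hN : bad.card ≤ 870
  · refine ⟨bad, hN, Or.inl fun i j hi _ hij hu => hi ?_⟩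
    exact Finset.mem_filter.mpr ⟨Finset.mem_univ i, j, hij, hu⟩
  have mono : F.Dichotomy 4 → F.Dichotomy 870 := fun ⟨A₀, hA, h⟩ => ⟨A₀, hA.trans (by norm_num), h⟩
  -- A maximal set of bad points with pairwise distinct 3-secants. These 3-secants cover `bad`, with
  -- at most three points each, and `870 = 3 * 290`.
  obtain ⟨I, hI, hmax⟩ := (bad.powerset.filter fun I : Finset ι =>
    ∀ i ∈ I, ∀ j ∈ I, i ≠ j → F.u i ⬝ᵥ F.e j ≠ 0).exists_max_image Finset.card
      ⟨∅, by simp⟩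
  simp only [Finset.mem_filter, Finset.mem_powerset] at hI hmax
  obtain ⟨hIb, hIu⟩ := hI
  have hcover : bad ⊆ I.biUnion fun i => Finset.univ.filter fun j => F.u i ⬝ᵥ F.e j = 0 := by
    intro j hj
    simp only [Finset.mem_biUnion, Finset.mem_filter, Finset.mem_univ, true_and]
    by_cases hjI : j ∈ I
    · exact ⟨j, hjI, F.u_self j⟩
    by_contra! hno
    have := hmax (insert j I) ⟨Finset.insert_subset hj hIb, fun a ha b hb hab => ?_⟩
    · rw [Finset.card_insert_of_notMem hjI] at this
      omega
    · rcases Finset.mem_insert.mp ha with ha | ha <;> rcases Finset.mem_insert.mp hb with hb | hb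
      · exact absurd (ha.trans hb.symm) hab
      · exact fun h0 => hno b hb (u_symm ht (ha ▸ h0))
      · exact hb ▸ hno a ha
      · exact hIu a ha b hb hab
  have hIcard : 290 < I.card := by
    have h1 := Finset.card_le_card hcover
    have h3 := Finset.card_biUnion_le_card_mul I
      (fun i => Finset.univ.filter fun j => F.u i ⬝ᵥ F.e j = 0) 3 fun i _ =>
        hline (F.u i) (F.u_ne_zero i) _ fun j hj => (Finset.mem_filter.mp hj).2
    omega
  have hG : F.Generic I := ⟨fun i _ j _ => ht i j, hIu, fun i hi j hj k _ hij hik hjk h0 =>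
    hIu i hi j hj hij (hcol i j k hij hik hjk h0)⟩
  obtain ⟨a, ha⟩ : I.Nonempty := Finset.card_pos.mp (by omega)
  obtain ⟨b, hab, huab⟩ := (Finset.mem_filter.mp (hIb ha)).2
  obtain ⟨⟨ρ, hρ, hρu⟩, ρ', hρ', hρu'⟩ := exists_u_eq_smul_of_partner ht hab huab
  -- As `a` and `b` share their 3-secant, `conic a b` splits into that line and another; `w` is
  -- their intersection. Either many 3-secants pass through `w`, or some `u c` misses it.
  set w : Fin 3 → K := (ρ' * (F.t a ⬝ᵥ F.e b)) • F.e a + (ρ * (F.t b ⬝ᵥ F.e a)) • F.e b with hw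
  have htab := ht a b hab
  have htba := ht b a hab.symm
  have htaw : F.t a ⬝ᵥ w ≠ 0 := by
    rw [hw, dotProduct_add, dotProduct_smul, dotProduct_smul, F.t_self, smul_zero, zero_add]
    exact mul_ne_zero (mul_ne_zero hρ htba) htab
  have htbw : F.t b ⬝ᵥ w ≠ 0 := by
    rw [hw, dotProduct_add, dotProduct_smul, dotProduct_smul, F.t_self, smul_zero, add_zero]
    exact mul_ne_zero (mul_ne_zero hρ' htab) htba
  have hw0 : w ≠ 0 := fun h0 => htaw (by rw [h0, dotProduct_zero])
  have huaw : F.u a ⬝ᵥ w = 0 := by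
    rw [hw, dotProduct_add, dotProduct_smul, dotProduct_smul, F.u_self, huab, smul_zero,
      smul_zero, add_zero]
  have hubw : F.u b ⬝ᵥ w = 0 := by
    rw [hw, dotProduct_add, dotProduct_smul, dotProduct_smul, F.u_self, u_symm ht huab, smul_zero,
      smul_zero, add_zero]
  by_cases hmany : 5 ≤ (I.filter fun i => F.u i ⬝ᵥ w = 0).card
  · exact mono ((hG.mono (Finset.filter_subset _ _)).dichotomy_of_concurrent_u h2 ht hline hmany hw0
      fun i hi => (Finset.mem_filter.mp hi).2)
  obtain ⟨c, hc, hcw⟩ : ∃ c ∈ I, F.u c ⬝ᵥ w ≠ 0 := by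
    by_contra! hall
    rw [Finset.filter_true_of_mem hall] at hmany
    omega
  have hac : a ≠ c := by rintro rfl; exact hcw huaw
  obtain ⟨d, hcd, hucd⟩ := (Finset.mem_filter.mp (hIb hc)).2
  obtain ⟨⟨σ, hσ, hσu⟩, σ', hσ', hσu'⟩ := exists_u_eq_smul_of_partner ht hcd hucd
  have hdw : F.u d ⬝ᵥ w ≠ 0 := by
    intro h0
    rw [hσu', smul_dotProduct] at h0
    exact hcw (by rw [hσu, smul_dotProduct, (smul_eq_zero.mp h0).resolve_left hσ', smul_zero])
  -- At `w` the second term of the quartic vanishes, and the first is a product of four nonzero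
  -- values.
  have hΨ : eval w (F.quartic a b c d ρ ρ' σ σ') ≠ 0 := by
    have hz : (ρ • F.t b - ρ' • F.t a) ⬝ᵥ w = 0 := by
      simp only [hw, dotProduct_add, dotProduct_smul, sub_dotProduct, smul_dotProduct, F.t_self,
        smul_eq_mul]
      ring
    simp only [quartic, map_sub, map_mul, eval_linForm, eval_conic, hz, huaw, hubw, zero_mul,
      mul_zero, sub_zero, zero_sub]
    exact mul_ne_zero (neg_ne_zero.mpr (mul_ne_zero hdw htaw))
      (neg_ne_zero.mpr (mul_ne_zero hcw htbw))
  obtain ⟨f, m, hfirr, hfhom, hm, s', hs', hcard, hfs⟩ := exists_irreducible_of_isHomogeneous F.e 4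
    (F := F.quartic a b c d ρ ρ' σ σ') (fun h0 => hΨ (by rw [h0, map_zero]))
    (F.isHomogeneous_quartic a b c d ρ ρ' σ σ') (s := (I.erase a).erase c)
    (Finset.card_pos.mp (by
      rw [Finset.card_erase_of_mem (Finset.mem_erase.mpr ⟨hac.symm, hc⟩),
        Finset.card_erase_of_mem ha]
      omega)) (fun i hi => by
        simp only [Finset.mem_erase] at hi
        obtain ⟨hic, hia, hi⟩ := hi
        have hib : i ≠ b := by rintro rfl; exact hIu a ha i hi hab huab
        have hid : i ≠ d := by rintro rfl; exact hIu c hc i hi hcd hucd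
        have h1 : eval (F.e i) (F.join a b) ≠ 0 := by
          intro h0
          rw [join, eval_linForm] at h0
          exact hIu a ha i hi (Ne.symm hia) (by rw [hρu, smul_dotProduct, h0, smul_zero])
        have h3 : eval (F.e i) (F.join c d) ≠ 0 := by
          intro h0
          rw [join, eval_linForm] at h0
          exact hIu c hc i hi (Ne.symm hic) (by rw [hσu, smul_dotProduct, h0, smul_zero])
        have h4 := join_mul_quartic hρu hρu' hσu hσu' (F.e i)
        rw [F.eval_sextic (ht a i (Ne.symm hia)) (ht b i (Ne.symm hib)) (ht c i (Ne.symm hic))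
          (ht d i (Ne.symm hid))] at h4
        exact (mul_eq_zero.mp h4).resolve_left (mul_ne_zero h1 h3))
  -- At least 289 points remain without `a` and `c`; a quarter of them exceeds 72.
  have hs72 : 72 ≤ s'.card := by
    rw [Finset.card_erase_of_mem (Finset.mem_erase.mpr ⟨hac.symm, hc⟩),
      Finset.card_erase_of_mem ha] at hcard
    omega
  have hG' : F.Generic s' :=
    hG.mono (hs'.trans ((Finset.erase_subset _ _).trans (Finset.erase_subset _ _)))
  obtain ⟨s'', hs'', h5, ⟨Q, hQ0, hQ⟩ | ⟨P, hP0, hP⟩⟩ :=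
    hG'.exists_concurrent h2 hK hs72 hfhom hfirr hm hfs
  · exact mono ((hG'.mono hs'').dichotomy_of_concurrent_t h2 ht hline h5 hQ0 hQ)
  · exact mono ((hG'.mono hs'').dichotomy_of_concurrent_u h2 ht hline h5 hP0 hP)

end SegreFamily

end PartnerDichotomy

/-! ### Products over the pencil of lines at a point of `S`. -/

section Pencils

open scoped Classical

variable {K : Type*} [Field K]

lemma eq_of_crossProduct_rep_eq_zero {P Q : ProjPlane K} (h : crossProduct P.rep Q.rep = 0) :
    P = Q := by
  obtain ⟨k, hk⟩ := exists_smul_of_crossProduct_eq_zero h Q.rep_nonzero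
  have hk0 : k ≠ 0 := by
    rintro rfl
    exact P.rep_nonzero (by rw [hk, zero_smul])
  rw [← P.mk_rep, ← Q.mk_rep, Projectivization.mk_eq_mk_iff']
  exact ⟨k, hk.symm⟩

/-- The number of points of `S` on the line with equation `f`. -/
noncomputable def lineCount (S : Finset (ProjPlane K)) (f : Fin 3 → K) : ℕ :=
  (S.filter fun s => f ⬝ᵥ s.rep = 0).card

/-- The points of `S` that are not on the lines joining `z` to `x` and `y`. -/
noncomputable def offSides (S : Finset (ProjPlane K)) (x y z : ProjPlane K) :
    Finset (ProjPlane K) :=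
  S.filter fun s => det3 s.rep y.rep z.rep ≠ 0 ∧ det3 s.rep z.rep x.rep ≠ 0

/-- The product over the points of `S` of the coordinates of the lines joining them to `z`. -/
noncomputable def pencilProd (S : Finset (ProjPlane K)) (x y z : ProjPlane K) : K :=
  ∏ s ∈ offSides S x y z, det3 s.rep y.rep z.rep / det3 s.rep z.rep x.rep

/-- A point of `S` on exactly one tangent `t` and exactly one 3-secant `u`, all other lines through
it being bisecants. -/
structure IsSpecial (S : Finset (ProjPlane K)) (z : ProjPlane K) (t u : Fin 3 → K) : Prop where
  mem : z ∈ S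
  t_self : t ⬝ᵥ z.rep = 0
  u_self : u ⬝ᵥ z.rep = 0
  cross_ne_zero : crossProduct t u ≠ 0
  count : ∀ f : Fin 3 → K, f ≠ 0 → f ⬝ᵥ z.rep = 0 → lineCount S f =
    if crossProduct f t = 0 then 1 else if crossProduct f u = 0 then 3 else 2

variable {S : Finset (ProjPlane K)} {x y z : ProjPlane K}

lemma ne_of_det3_ne_zero (h : det3 x.rep y.rep z.rep ≠ 0) : x ≠ y ∧ x ≠ z ∧ y ≠ z := by
  refine ⟨?_, ?_, ?_⟩ <;> rintro rfl <;> exact h (by simp only [det3_expand]; ring)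

lemma eq_of_det3_eq_zero (h : det3 x.rep y.rep z.rep ≠ 0) {s : ProjPlane K}
    (h1 : det3 s.rep y.rep z.rep = 0) (h2 : det3 s.rep z.rep x.rep = 0) : s = z := by
  have hc := cramer_three x.rep y.rep z.rep s.rep
  have e : det3 x.rep s.rep z.rep = det3 s.rep z.rep x.rep := by
    simp only [det3_expand]; ring
  rw [h1, e, h2, zero_smul, zero_smul, zero_add, zero_add] at hc
  refine eq_of_crossProduct_rep_eq_zero ?_
  have := congrArg (fun v => crossProduct v z.rep) hc
  simp only [map_smul, LinearMap.smul_apply, cross_self, smul_zero] at this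
  exact (smul_eq_zero.mp this).resolve_left h

lemma pencil_line_ne_zero (h : det3 x.rep y.rep z.rep ≠ 0) (c : K) :
    crossProduct y.rep z.rep - c • crossProduct z.rep x.rep ≠ 0 := by
  intro h0
  have := congrArg (· ⬝ᵥ x.rep) h0
  simp only [sub_dotProduct, smul_dotProduct, crossProduct_dotProduct, zero_dotProduct] at this
  have e : det3 x.rep z.rep x.rep = 0 := by simp only [det3_expand]; ring
  rw [e, smul_zero, sub_zero] at this
  exact h this

lemma pencil_line_self (c : K) :
    (crossProduct y.rep z.rep - c • crossProduct z.rep x.rep) ⬝ᵥ z.rep = 0 := by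
  simp only [sub_dotProduct, smul_dotProduct, crossProduct_dotProduct, det3_expand, smul_eq_mul]
  ring

lemma pencil_line_cross_eq_zero_iff {t : Fin 3 → K}
    (ht : t ⬝ᵥ z.rep = 0) (c : K) :
    crossProduct (crossProduct y.rep z.rep - c • crossProduct z.rep x.rep) t = 0 ↔
      t ⬝ᵥ y.rep + c * (t ⬝ᵥ x.rep) = 0 := by
  have e : crossProduct (crossProduct y.rep z.rep - c • crossProduct z.rep x.rep) t =
      (t ⬝ᵥ y.rep + c * (t ⬝ᵥ x.rep)) • z.rep - (t ⬝ᵥ z.rep) • (y.rep + c • x.rep) := by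
    ext i
    fin_cases i <;>
    · simp [cross_apply, dotProduct_three]
      ring
  rw [e, ht, zero_smul, sub_zero, smul_eq_zero, or_iff_left z.rep_nonzero]

/-- The ratio `c` labels the lines through `z` other than the two sides; the extra 1 is `z` itself.
-/
lemma card_fiber_pencil (h : det3 x.rep y.rep z.rep ≠ 0) (hz : z ∈ S) {c : K} (hc : c ≠ 0) :
    ((offSides S x y z).filter fun s =>
      det3 s.rep y.rep z.rep / det3 s.rep z.rep x.rep = c).card + 1 =
      lineCount S (crossProduct y.rep z.rep - c • crossProduct z.rep x.rep) := by
  have key : (S.filter fun s =>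
      (crossProduct y.rep z.rep - c • crossProduct z.rep x.rep) ⬝ᵥ s.rep = 0) =
      insert z ((offSides S x y z).filter fun s =>
        det3 s.rep y.rep z.rep / det3 s.rep z.rep x.rep = c) := by
    ext s
    simp only [Finset.mem_filter, Finset.mem_insert, offSides, sub_dotProduct, smul_dotProduct,
      crossProduct_dotProduct, smul_eq_mul, sub_eq_zero]
    constructor
    · rintro ⟨hs, hsc⟩
      by_cases h2 : det3 s.rep z.rep x.rep = 0
      · left
        exact eq_of_det3_eq_zero h (by rw [hsc, h2, mul_zero]) h2
      · exact Or.inr ⟨⟨hs, by rw [hsc]; exact mul_ne_zero hc h2, h2⟩, by rw [hsc]; field_simp⟩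
    · rintro (rfl | ⟨⟨hs, -, h2⟩, hsc⟩)
      · exact ⟨hz, by simp only [det3_expand]; ring⟩
      · exact ⟨hs, by rw [← hsc]; field_simp⟩
  rw [lineCount, key, Finset.card_insert_of_notMem]
  simp only [Finset.mem_filter, offSides, not_and]
  intro h1
  exact absurd (by simp only [det3_expand]; ring) h1.2.1

namespace IsSpecial

variable {t u : Fin 3 → K}

lemma t_ne_zero (hz : IsSpecial S z t u) : t ≠ 0 := fun h0 =>
  hz.cross_ne_zero (by rw [h0, map_zero, LinearMap.zero_apply])

lemma u_ne_zero (hz : IsSpecial S z t u) : u ≠ 0 := fun h0 =>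
  hz.cross_ne_zero (by rw [h0, map_zero])

lemma t_ne (hz : IsSpecial S z t u) (hx : x ∈ S) (hxz : x ≠ z) : t ⬝ᵥ x.rep ≠ 0 := by
  intro h0
  have h1 := hz.count t hz.t_ne_zero hz.t_self
  rw [if_pos (cross_self t)] at h1
  refine hxz (Finset.card_le_one.mp h1.le x ?_ z ?_)
  · exact Finset.mem_filter.mpr ⟨hx, h0⟩
  · exact Finset.mem_filter.mpr ⟨hz.mem, hz.t_self⟩

lemma count_u (hz : IsSpecial S z t u) : lineCount S u = 3 := by
  rw [hz.count u hz.u_ne_zero hz.u_self, if_neg, if_pos (cross_self u)]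
  rw [← cross_anticomm, neg_eq_zero]
  exact hz.cross_ne_zero

lemma cross_t_ne_zero (hz : IsSpecial S z t u) {f : Fin 3 → K} (hf : f ≠ 0) (hx : x ∈ S)
    (hxz : x ≠ z) (hfx : f ⬝ᵥ x.rep = 0) : crossProduct f t ≠ 0 := by
  intro h0
  rw [← cross_anticomm, neg_eq_zero] at h0
  obtain ⟨k, hk⟩ := exists_smul_of_crossProduct_eq_zero h0 hf
  exact hz.t_ne hx hxz (by rw [hk, smul_dotProduct, hfx, smul_zero])

lemma count_eq_two (hz : IsSpecial S z t u) {f : Fin 3 → K} (hf : f ≠ 0) (hfz : f ⬝ᵥ z.rep = 0)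
    (hx : x ∈ S) (hxz : x ≠ z) (hfx : f ⬝ᵥ x.rep = 0) (hux : u ⬝ᵥ x.rep ≠ 0) :
    lineCount S f = 2 := by
  rw [hz.count f hf hfz, if_neg (hz.cross_t_ne_zero hf hx hxz hfx), if_neg]
  intro h0
  rw [← cross_anticomm, neg_eq_zero] at h0
  obtain ⟨k, hk⟩ := exists_smul_of_crossProduct_eq_zero h0 hf
  exact hux (by rw [hk, smul_dotProduct, hfx, smul_zero])

lemma count_le_three (hz : IsSpecial S z t u) {f : Fin 3 → K} (hf : f ≠ 0)
    (hfz : f ⬝ᵥ z.rep = 0) : lineCount S f ≤ 3 := by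
  rw [hz.count f hf hfz]
  split_ifs <;> omega

lemma exists_smul_of_count_eq_three (hz : IsSpecial S z t u) {f : Fin 3 → K} (hf : f ≠ 0)
    (hfz : f ⬝ᵥ z.rep = 0) (h3 : lineCount S f = 3) : ∃ k : K, f = k • u := by
  refine exists_smul_of_crossProduct_eq_zero ?_ hz.u_ne_zero
  have := hz.count f hf hfz
  by_contra h0
  rw [if_neg h0, h3] at this
  split_ifs at this <;> omega

lemma u_symm {t' u' : Fin 3 → K} (hx : IsSpecial S x t u) (hy : IsSpecial S y t' u')
    (h : u ⬝ᵥ y.rep = 0) : u' ⬝ᵥ x.rep = 0 := by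
  obtain ⟨k, hk⟩ := hy.exists_smul_of_count_eq_three hx.u_ne_zero h hx.count_u
  have h1 := hx.u_self
  rw [hk, smul_dotProduct] at h1
  refine (smul_eq_zero.mp h1).resolve_left ?_
  rintro rfl
  exact hx.u_ne_zero (by rw [hk, zero_smul])

end IsSpecial

variable [Fintype K]

lemma prod_erase_zero : ∏ c ∈ (Finset.univ : Finset K).erase 0, c = -1 := by
  have h := congrArg Units.val (FiniteField.prod_univ_units_id_eq_neg_one (K := K))
  rw [Units.coe_prod, Units.val_neg, Units.val_one] at h
  rw [← h]
  symm
  refine Finset.prod_bij (fun c _ => (c : K)) (fun c _ => ?_) (fun a _ b _ => Units.ext)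
    (fun c hc => ?_) fun _ _ => rfl
  · exact Finset.mem_erase.mpr ⟨c.ne_zero, Finset.mem_univ _⟩
  · exact ⟨Units.mk0 c (Finset.ne_of_mem_erase hc), Finset.mem_univ _, rfl⟩

lemma pencilProd_eq (h : det3 x.rep y.rep z.rep ≠ 0) (hz : z ∈ S) :
    pencilProd S x y z = ∏ c ∈ (Finset.univ : Finset K).erase 0,
      c ^ (lineCount S (crossProduct y.rep z.rep - c • crossProduct z.rep x.rep) - 1) := by
  rw [pencilProd, ← Finset.prod_fiberwise_of_maps_to (t := (Finset.univ : Finset K).erase 0)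
    (g := fun s => det3 s.rep y.rep z.rep / det3 s.rep z.rep x.rep)]
  · refine Finset.prod_congr rfl fun c hc => ?_
    rw [← card_fiber_pencil h hz (Finset.ne_of_mem_erase hc), Nat.add_sub_cancel,
      ← Finset.prod_const]
    exact Finset.prod_congr rfl fun s hs => (Finset.mem_filter.mp hs).2
  · intro s hs
    simp only [offSides, Finset.mem_filter] at hs
    exact Finset.mem_erase.mpr ⟨div_ne_zero hs.2.1 hs.2.2, Finset.mem_univ _⟩

/-- Every nonzero ratio occurs exactly once, so this is Wilson's theorem. -/
lemma pencilProd_of_bisecants (h : det3 x.rep y.rep z.rep ≠ 0) (hz : z ∈ S)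
    (hS : ∀ f : Fin 3 → K, f ≠ 0 → f ⬝ᵥ z.rep = 0 → lineCount S f = 2) :
    pencilProd S x y z = -1 := by
  rw [pencilProd_eq h hz, ← prod_erase_zero]
  refine Finset.prod_congr rfl fun c _ => ?_
  rw [hS _ (pencil_line_ne_zero h c) (pencil_line_self c), pow_one]

lemma prod_erase_zero_ite {p : K → Prop} [DecidablePred p] {a : K} (ha : a ≠ 0)
    (hp : ∀ c, p c ↔ c = a) (g : K → K) :
    ∏ c ∈ (Finset.univ : Finset K).erase 0, (if p c then g c else 1) = g a := by
  rw [Finset.prod_eq_single_of_mem a (Finset.mem_erase.mpr ⟨ha, Finset.mem_univ _⟩),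
    if_pos ((hp a).mpr rfl)]
  intro c _ hc
  rw [if_neg fun h => hc ((hp c).mp h)]

namespace IsSpecial

variable {t u : Fin 3 → K}

/-- Wilson's product with two corrections: the ratio of the tangent does not occur, and that of the
3-secant occurs twice. The latter stays conditional since the 3-secant may be a side of the
triangle. -/
lemma pencilProd_mul (hz : IsSpecial S z t u) (h : det3 x.rep y.rep z.rep ≠ 0) (hx : x ∈ S)
    (hy : y ∈ S) : pencilProd S x y z * (t ⬝ᵥ y.rep) = (t ⬝ᵥ x.rep) *
      ∏ c ∈ (Finset.univ : Finset K).erase 0,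
        if u ⬝ᵥ y.rep + c * (u ⬝ᵥ x.rep) = 0 then c else 1 := by
  obtain ⟨-, hxz, hyz⟩ := ne_of_det3_ne_zero h
  have htx := hz.t_ne hx hxz
  have hty := hz.t_ne hy hyz
  have e : pencilProd S x y z = ∏ c ∈ (Finset.univ : Finset K).erase 0,
      (c * (if t ⬝ᵥ y.rep + c * (t ⬝ᵥ x.rep) = 0 then c⁻¹ else 1)) *
        if u ⬝ᵥ y.rep + c * (u ⬝ᵥ x.rep) = 0 then c else 1 := by
    rw [pencilProd_eq h hz.mem]
    refine Finset.prod_congr rfl fun c hc => ?_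
    have hc0 := Finset.ne_of_mem_erase hc
    have hl := pencil_line_ne_zero h c
    rw [hz.count _ hl (pencil_line_self c)]
    have hnot : ¬ (crossProduct (crossProduct y.rep z.rep - c • crossProduct z.rep x.rep) t = 0 ∧
        crossProduct (crossProduct y.rep z.rep - c • crossProduct z.rep x.rep) u = 0) := by
      rintro ⟨h1, h2⟩
      rw [← cross_anticomm, neg_eq_zero] at h1 h2
      obtain ⟨k, hk⟩ := exists_smul_of_crossProduct_eq_zero h1 hl
      obtain ⟨k', hk'⟩ := exists_smul_of_crossProduct_eq_zero h2 hl
      apply hz.cross_ne_zero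
      rw [hk, hk', map_smul, map_smul, LinearMap.smul_apply, cross_self, smul_zero, smul_zero]
    simp only [pencil_line_cross_eq_zero_iff hz.t_self,
      pencil_line_cross_eq_zero_iff hz.u_self] at hnot ⊢
    split_ifs with h1 h2
    · exact absurd ⟨h1, h2⟩ hnot
    · simp [hc0]
    · simp [sq]
    · simp
  rw [e, Finset.prod_mul_distrib, Finset.prod_mul_distrib, prod_erase_zero,
    prod_erase_zero_ite (a := -(t ⬝ᵥ y.rep) / (t ⬝ᵥ x.rep)) (div_ne_zero (neg_ne_zero.mpr hty) htx)
      (fun c => by rw [eq_div_iff htx, add_comm, ← eq_neg_iff_add_eq_zero])]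
  field_simp
  simp only [mul_comm (u ⬝ᵥ x.rep)]

lemma pencilProd_mul_of_u_ne (hz : IsSpecial S z t u) (h : det3 x.rep y.rep z.rep ≠ 0)
    (hx : x ∈ S) (hy : y ∈ S) (hux : u ⬝ᵥ x.rep ≠ 0) (huy : u ⬝ᵥ y.rep ≠ 0) :
    pencilProd S x y z * ((t ⬝ᵥ y.rep) * (u ⬝ᵥ x.rep)) = -((t ⬝ᵥ x.rep) * (u ⬝ᵥ y.rep)) := by
  rw [← mul_assoc, hz.pencilProd_mul h hx hy,
    prod_erase_zero_ite (a := -(u ⬝ᵥ y.rep) / (u ⬝ᵥ x.rep)) (div_ne_zero (neg_ne_zero.mpr huy) hux)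
      (fun c => by rw [eq_div_iff hux, add_comm, ← eq_neg_iff_add_eq_zero]) fun c => c]
  field_simp

lemma pencilProd_mul_of_u_left (hz : IsSpecial S z t u) (h : det3 x.rep y.rep z.rep ≠ 0)
    (hx : x ∈ S) (hy : y ∈ S) (hux : u ⬝ᵥ x.rep = 0) (huy : u ⬝ᵥ y.rep ≠ 0) :
    pencilProd S x y z * (t ⬝ᵥ y.rep) = t ⬝ᵥ x.rep := by
  rw [hz.pencilProd_mul h hx hy, Finset.prod_eq_one, mul_one]
  intro c _
  rw [hux, mul_zero, add_zero, if_neg huy]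

lemma pencilProd_mul_of_u_right (hz : IsSpecial S z t u) (h : det3 x.rep y.rep z.rep ≠ 0)
    (hx : x ∈ S) (hy : y ∈ S) (hux : u ⬝ᵥ x.rep ≠ 0) (huy : u ⬝ᵥ y.rep = 0) :
    pencilProd S x y z * (t ⬝ᵥ y.rep) = t ⬝ᵥ x.rep := by
  rw [hz.pencilProd_mul h hx hy, Finset.prod_eq_one, mul_one]
  intro c hc
  rw [huy, zero_add, if_neg (mul_ne_zero (Finset.ne_of_mem_erase hc) hux)]

end IsSpecial

end Pencils

/-! ### Segre's lemma of tangents. -/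

section Triangles

open scoped Classical

variable {K : Type*} [Field K] {S : Finset (ProjPlane K)} {x y z w : ProjPlane K}

lemma crossProduct_rep_ne_zero (h : x ≠ y) : crossProduct x.rep y.rep ≠ 0 :=
  fun h0 => h (eq_of_crossProduct_rep_eq_zero h0)

lemma eq_or_eq_of_lineCount {f : Fin 3 → K} (hf : lineCount S f = 2) (hxy : x ≠ y) (hx : x ∈ S)
    (hy : y ∈ S) (hfx : f ⬝ᵥ x.rep = 0) (hfy : f ⬝ᵥ y.rep = 0) {s : ProjPlane K} (hs : s ∈ S)
    (hfs : f ⬝ᵥ s.rep = 0) : s = x ∨ s = y := by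
  have hsub : ({x, y} : Finset (ProjPlane K)) ⊆ S.filter fun s => f ⬝ᵥ s.rep = 0 := by
    intro p hp
    rcases Finset.mem_insert.mp hp with rfl | hp
    · exact Finset.mem_filter.mpr ⟨hx, hfx⟩
    · rw [Finset.mem_singleton.mp hp]
      exact Finset.mem_filter.mpr ⟨hy, hfy⟩
  have := Finset.eq_of_subset_of_card_le hsub (by rw [Finset.card_pair hxy]; exact hf.le)
  have hm : s ∈ ({x, y} : Finset (ProjPlane K)) := by
    rw [this]; exact Finset.mem_filter.mpr ⟨hs, hfs⟩
  simpa using hm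

lemma exists_third_of_lineCount {f : Fin 3 → K} (hf : lineCount S f = 3) (hxy : x ≠ y)
    (hx : x ∈ S) (hy : y ∈ S) (hfx : f ⬝ᵥ x.rep = 0) (hfy : f ⬝ᵥ y.rep = 0) :
    ∃ w ∈ S, w ≠ x ∧ w ≠ y ∧ f ⬝ᵥ w.rep = 0 ∧
      ∀ s ∈ S, f ⬝ᵥ s.rep = 0 → s = x ∨ s = y ∨ s = w := by
  have hx' : x ∈ S.filter fun s => f ⬝ᵥ s.rep = 0 := Finset.mem_filter.mpr ⟨hx, hfx⟩
  have hy' : y ∈ (S.filter fun s => f ⬝ᵥ s.rep = 0).erase x :=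
    Finset.mem_erase.mpr ⟨hxy.symm, Finset.mem_filter.mpr ⟨hy, hfy⟩⟩
  have hc : (((S.filter fun s => f ⬝ᵥ s.rep = 0).erase x).erase y).card = 1 := by
    rw [Finset.card_erase_of_mem hy', Finset.card_erase_of_mem hx', ← lineCount, hf]
  obtain ⟨w, hw⟩ := Finset.card_eq_one.mp hc
  have hmem : ∀ s, s ≠ y ∧ s ≠ x ∧ s ∈ S ∧ f ⬝ᵥ s.rep = 0 ↔ s = w := fun s => by
    have := congrArg (s ∈ ·) hw
    simpa only [Finset.mem_erase, Finset.mem_filter, Finset.mem_singleton, eq_iff_iff] using this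
  obtain ⟨h1, h2, h3, h4⟩ := (hmem w).mpr rfl
  refine ⟨w, h3, h2, h1, h4, fun s hs hfs => ?_⟩
  by_cases hsx : s = x
  · exact Or.inl hsx
  by_cases hsy : s = y
  · exact Or.inr (Or.inl hsy)
  exact Or.inr (Or.inr ((hmem s).mp ⟨hsy, hsx, hs, hfs⟩))

lemma offSides_eq (h1 : ∀ s ∈ S, det3 s.rep y.rep z.rep = 0 → s = y ∨ s = z)
    (h2 : ∀ s ∈ S, det3 s.rep z.rep x.rep = 0 → s = z ∨ s = x) :
    offSides S x y z = S \ {x, y, z} := by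
  ext s
  simp only [offSides, Finset.mem_filter, Finset.mem_sdiff, Finset.mem_insert,
    Finset.mem_singleton, not_or]
  refine and_congr_right fun hs => ⟨fun ⟨hy, hx⟩ => ⟨?_, ?_, ?_⟩, fun ⟨hx, hy, hz⟩ => ⟨?_, ?_⟩⟩
  · rintro rfl; exact hx (by simp only [det3_expand]; ring)
  · rintro rfl; exact hy (by simp only [det3_expand]; ring)
  · rintro rfl; exact hy (by simp only [det3_expand]; ring)
  · exact fun h0 => (h1 s hs h0).elim hy hz
  · exact fun h0 => (h2 s hs h0).elim hz hx

lemma offSides_eq_of_third (hwyz : det3 w.rep y.rep z.rep = 0)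
    (h1 : ∀ s ∈ S, det3 s.rep y.rep z.rep = 0 → s = y ∨ s = z ∨ s = w)
    (h2 : ∀ s ∈ S, det3 s.rep z.rep x.rep = 0 → s = z ∨ s = x) :
    offSides S x y z = S \ {x, y, z, w} := by
  ext s
  simp only [offSides, Finset.mem_filter, Finset.mem_sdiff, Finset.mem_insert,
    Finset.mem_singleton, not_or]
  refine and_congr_right fun hs =>
    ⟨fun ⟨hy, hx⟩ => ⟨?_, ?_, ?_, ?_⟩, fun ⟨hx, hy, hz, hw⟩ => ⟨?_, ?_⟩⟩
  · rintro rfl; exact hx (by simp only [det3_expand]; ring)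
  · rintro rfl; exact hy (by simp only [det3_expand]; ring)
  · rintro rfl; exact hy (by simp only [det3_expand]; ring)
  · rintro rfl; exact hy hwyz
  · exact fun h0 => (h1 s hs h0).elim hy fun h => h.elim hz hw
  · exact fun h0 => (h2 s hs h0).elim hz hx

lemma offSides_eq_of_third' (hwzx : det3 w.rep z.rep x.rep = 0)
    (h1 : ∀ s ∈ S, det3 s.rep y.rep z.rep = 0 → s = y ∨ s = z)
    (h2 : ∀ s ∈ S, det3 s.rep z.rep x.rep = 0 → s = z ∨ s = x ∨ s = w) :
    offSides S x y z = S \ {x, y, z, w} := by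
  ext s
  simp only [offSides, Finset.mem_filter, Finset.mem_sdiff, Finset.mem_insert,
    Finset.mem_singleton, not_or]
  refine and_congr_right fun hs =>
    ⟨fun ⟨hy, hx⟩ => ⟨?_, ?_, ?_, ?_⟩, fun ⟨hx, hy, hz, hw⟩ => ⟨?_, ?_⟩⟩
  · rintro rfl; exact hx (by simp only [det3_expand]; ring)
  · rintro rfl; exact hy (by simp only [det3_expand]; ring)
  · rintro rfl; exact hy (by simp only [det3_expand]; ring)
  · rintro rfl; exact hx hwzx
  · exact fun h0 => (h1 s hs h0).elim hy hz
  · exact fun h0 => (h2 s hs h0).elim hz fun h => h.elim hx hw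

/-- The three pencils run over the same points, those other than the vertices, and at each point the
three ratios cancel, as in Ceva's theorem. -/
lemma pencilProd_cyclic (hxy : ∀ s ∈ S, det3 s.rep x.rep y.rep = 0 → s = x ∨ s = y)
    (hyz : ∀ s ∈ S, det3 s.rep y.rep z.rep = 0 → s = y ∨ s = z)
    (hzx : ∀ s ∈ S, det3 s.rep z.rep x.rep = 0 → s = z ∨ s = x) :
    pencilProd S x y z * pencilProd S y z x * pencilProd S z x y = 1 := by
  have e1 : ({y, z, x} : Finset (ProjPlane K)) = {x, y, z} := by ext; simp; tauto
  have e2 : ({z, x, y} : Finset (ProjPlane K)) = {x, y, z} := by ext; simp; tauto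
  rw [pencilProd, pencilProd, pencilProd, offSides_eq hyz hzx, offSides_eq hzx hxy,
    offSides_eq hxy hyz, e1, e2, ← Finset.prod_mul_distrib, ← Finset.prod_mul_distrib]
  refine Finset.prod_eq_one fun s hs => ?_
  simp only [Finset.mem_sdiff, Finset.mem_insert, Finset.mem_singleton, not_or] at hs
  obtain ⟨hs, hsx, hsy, hsz⟩ := hs
  have a1 : det3 s.rep x.rep y.rep ≠ 0 := fun h0 => (hxy s hs h0).elim hsx hsy
  have a2 : det3 s.rep y.rep z.rep ≠ 0 := fun h0 => (hyz s hs h0).elim hsy hsz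
  have a3 : det3 s.rep z.rep x.rep ≠ 0 := fun h0 => (hzx s hs h0).elim hsz hsx
  field_simp

/-- The third point `w` on the side `xy` enters only the pencil at `z`, so its ratio there is not
cancelled. -/
lemma pencilProd_cyclic_of_third (hw : w ∈ S) (hwx : w ≠ x) (hwy : w ≠ y) (hwz : w ≠ z)
    (hwxy : det3 w.rep x.rep y.rep = 0)
    (hxy : ∀ s ∈ S, det3 s.rep x.rep y.rep = 0 → s = x ∨ s = y ∨ s = w)
    (hyz : ∀ s ∈ S, det3 s.rep y.rep z.rep = 0 → s = y ∨ s = z)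
    (hzx : ∀ s ∈ S, det3 s.rep z.rep x.rep = 0 → s = z ∨ s = x) :
    pencilProd S x y z * pencilProd S y z x * pencilProd S z x y =
      det3 w.rep y.rep z.rep / det3 w.rep z.rep x.rep := by
  have e1 : ({y, z, x, w} : Finset (ProjPlane K)) = {x, y, z, w} := by ext; simp; tauto
  have e2 : ({z, x, y, w} : Finset (ProjPlane K)) = {x, y, z, w} := by ext; simp; tauto
  have e3 : S \ {x, y, z} = insert w (S \ {x, y, z, w}) := by
    ext s
    simp only [Finset.mem_sdiff, Finset.mem_insert, Finset.mem_singleton]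
    by_cases h : s = w
    · subst h; tauto
    · tauto
  rw [pencilProd, pencilProd, pencilProd, offSides_eq hyz hzx, e3, Finset.prod_insert (by simp),
    offSides_eq_of_third' hwxy hzx hxy, offSides_eq_of_third hwxy hxy hyz, e1, e2, mul_assoc,
    mul_assoc, ← Finset.prod_mul_distrib, ← Finset.prod_mul_distrib]
  rw [Finset.prod_eq_one, mul_one]
  intro s hs
  simp only [Finset.mem_sdiff, Finset.mem_insert, Finset.mem_singleton, not_or] at hs
  obtain ⟨hs, hsx, hsy, hsz, hsw⟩ := hs
  have a1 : det3 s.rep x.rep y.rep ≠ 0 := fun h0 => (hxy s hs h0).elim hsx fun h => h.elim hsy hsw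
  have a2 : det3 s.rep y.rep z.rep ≠ 0 := fun h0 => (hyz s hs h0).elim hsy hsz
  have a3 : det3 s.rep z.rep x.rep ≠ 0 := fun h0 => (hzx s hs h0).elim hsz hsx
  field_simp

lemma eq_or_eq_of_side {f : Fin 3 → K} (hf : f = crossProduct x.rep y.rep)
    (h2 : lineCount S f = 2) (hxy : x ≠ y) (hx : x ∈ S) (hy : y ∈ S) :
    ∀ s ∈ S, det3 s.rep x.rep y.rep = 0 → s = x ∨ s = y := fun s hs h0 => by
  subst hf
  refine eq_or_eq_of_lineCount h2 hxy hx hy ?_ ?_ hs (by rw [crossProduct_dotProduct, h0]) <;>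
  · rw [crossProduct_dotProduct]; simp only [det3_expand]; ring

lemma det3_rep_rotate (h : det3 x.rep y.rep z.rep ≠ 0) : det3 y.rep z.rep x.rep ≠ 0 := by
  rwa [det3_rotate] at h

/-- Three points of `S` all of whose secants are bisecants are collinear. -/
lemma det3_eq_zero_of_bisecants [Fintype K] (h2 : (2 : K) ≠ 0) (hx : x ∈ S) (hy : y ∈ S)
    (hz : z ∈ S) (hSx : ∀ f : Fin 3 → K, f ≠ 0 → f ⬝ᵥ x.rep = 0 → lineCount S f = 2)
    (hSy : ∀ f : Fin 3 → K, f ≠ 0 → f ⬝ᵥ y.rep = 0 → lineCount S f = 2)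
    (hSz : ∀ f : Fin 3 → K, f ≠ 0 → f ⬝ᵥ z.rep = 0 → lineCount S f = 2) :
    det3 x.rep y.rep z.rep = 0 := by
  by_contra h
  obtain ⟨hxy, hxz, hyz⟩ := ne_of_det3_ne_zero h
  have side : ∀ {x y : ProjPlane K}, x ≠ y → x ∈ S → y ∈ S →
      (∀ f : Fin 3 → K, f ≠ 0 → f ⬝ᵥ x.rep = 0 → lineCount S f = 2) →
      ∀ s ∈ S, det3 s.rep x.rep y.rep = 0 → s = x ∨ s = y := fun {x y} hxy hx hy hSx =>
    eq_or_eq_of_side rfl (hSx _ (crossProduct_rep_ne_zero hxy)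
      (by rw [crossProduct_dotProduct]; simp only [det3_expand]; ring)) hxy hx hy
  have := pencilProd_cyclic (side hxy hx hy hSx) (side hyz hy hz hSy) (side hxz.symm hz hx hSz)
  rw [pencilProd_of_bisecants h hz hSz, pencilProd_of_bisecants (det3_rep_rotate h) hx hSx,
    pencilProd_of_bisecants (det3_rep_rotate (det3_rep_rotate h)) hy hSy] at this
  -- Three factors `-1` would multiply to 1.
  exact h2 (by linear_combination -this)

namespace IsSpecial

variable {tx ux ty uy tz uz : Fin 3 → K}

lemma side (hx : IsSpecial S x tx ux) (hy : y ∈ S) (hxy : x ≠ y) (h : ux ⬝ᵥ y.rep ≠ 0) :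
    ∀ s ∈ S, det3 s.rep x.rep y.rep = 0 → s = x ∨ s = y := by
  refine eq_or_eq_of_side rfl (hx.count_eq_two (crossProduct_rep_ne_zero hxy) ?_ hy hxy.symm ?_ h)
    hxy hx.mem hy <;>
  · rw [crossProduct_dotProduct]; simp only [det3_expand]; ring

/-- Segre's lemma of tangents for three points of which no two share their 3-secant. -/
lemma segre [Fintype K] (hx : IsSpecial S x tx ux) (hy : IsSpecial S y ty uy)
    (hz : IsSpecial S z tz uz) (h : det3 x.rep y.rep z.rep ≠ 0) (hxy : ux ⬝ᵥ y.rep ≠ 0)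
    (hyz : uy ⬝ᵥ z.rep ≠ 0) (hzx : uz ⬝ᵥ x.rep ≠ 0) :
    (uz ⬝ᵥ y.rep) * (tz ⬝ᵥ x.rep) * ((ux ⬝ᵥ z.rep) * (tx ⬝ᵥ y.rep)) *
      ((uy ⬝ᵥ x.rep) * (ty ⬝ᵥ z.rep)) = -((uz ⬝ᵥ x.rep) * (tz ⬝ᵥ y.rep) *
      ((ux ⬝ᵥ y.rep) * (tx ⬝ᵥ z.rep)) * ((uy ⬝ᵥ z.rep) * (ty ⬝ᵥ x.rep))) := by
  obtain ⟨nxy, nxz, nyz⟩ := ne_of_det3_ne_zero h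
  have hyx : uy ⬝ᵥ x.rep ≠ 0 := fun h0 => hxy (hy.u_symm hx h0)
  have hzy : uz ⬝ᵥ y.rep ≠ 0 := fun h0 => hyz (hz.u_symm hy h0)
  have hxz : ux ⬝ᵥ z.rep ≠ 0 := fun h0 => hzx (hx.u_symm hz h0)
  have hc := pencilProd_cyclic (hx.side hy.mem nxy hxy) (hy.side hz.mem nyz hyz)
    (hz.side hx.mem nxz.symm hzx)
  have pz := hz.pencilProd_mul_of_u_ne h hx.mem hy.mem hzx hzy
  have px := hx.pencilProd_mul_of_u_ne (det3_rep_rotate h) hy.mem hz.mem hxy hxz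
  have py := hy.pencilProd_mul_of_u_ne (det3_rep_rotate (det3_rep_rotate h)) hz.mem hx.mem hyz hyx
  generalize pencilProd S x y z = a at *
  generalize pencilProd S y z x = b at *
  generalize pencilProd S z x y = c at *
  have e := congrArg₂ (· * ·) (congrArg₂ (· * ·) pz px) py
  linear_combination e - (uz ⬝ᵥ x.rep) * (tz ⬝ᵥ y.rep) *
      ((ux ⬝ᵥ y.rep) * (tx ⬝ᵥ z.rep)) * ((uy ⬝ᵥ z.rep) * (ty ⬝ᵥ x.rep)) * hc

/-- Segre's lemma of tangents for three points of which exactly two share their 3-secant. -/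
lemma segre_of_shared [Fintype K] (hx : IsSpecial S x tx ux) (hy : IsSpecial S y ty uy)
    (hz : IsSpecial S z tz uz) (h : det3 x.rep y.rep z.rep ≠ 0) (hxy : ux ⬝ᵥ y.rep = 0)
    (hyz : uy ⬝ᵥ z.rep ≠ 0) (hzx : uz ⬝ᵥ x.rep ≠ 0) :
    ∃ w ∈ S, ∃ α β : K, α ≠ 0 ∧ β ≠ 0 ∧ w.rep = α • x.rep + β • y.rep ∧
      α * ((uz ⬝ᵥ x.rep) * (tz ⬝ᵥ y.rep) * (tx ⬝ᵥ z.rep) * (ty ⬝ᵥ x.rep)) +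
      β * ((uz ⬝ᵥ y.rep) * (tz ⬝ᵥ x.rep) * (tx ⬝ᵥ y.rep) * (ty ⬝ᵥ z.rep)) = 0 := by
  obtain ⟨nxy, nxz, nyz⟩ := ne_of_det3_ne_zero h
  have hyx : uy ⬝ᵥ x.rep = 0 := hx.u_symm hy hxy
  have hzy : uz ⬝ᵥ y.rep ≠ 0 := fun h0 => hyz (hz.u_symm hy h0)
  have hxz : ux ⬝ᵥ z.rep ≠ 0 := fun h0 => hzx (hx.u_symm hz h0)
  obtain ⟨w, hw, hwx, hwy, huw, hthird⟩ :=
    exists_third_of_lineCount hx.count_u nxy hx.mem hy.mem hx.u_self hxy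
  have hwz : w ≠ z := by rintro rfl; exact hxz huw
  obtain ⟨α, β, hαβ⟩ := exists_eq_smul_add_smul (e := ux) (t := x.rep) (u := y.rep) (g := w.rep)
    (by rw [dotProduct_comm, hx.u_self]) (by rw [dotProduct_comm, hxy])
    (by rw [dotProduct_comm, huw]) hx.u_ne_zero (crossProduct_rep_ne_zero nxy)
  have hα : α ≠ 0 := by
    rintro rfl
    refine hwy (eq_of_crossProduct_rep_eq_zero ?_)
    rw [hαβ, zero_smul, zero_add, map_smul, LinearMap.smul_apply, cross_self, smul_zero]
  have hβ : β ≠ 0 := by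
    rintro rfl
    refine hwx (eq_of_crossProduct_rep_eq_zero ?_)
    rw [hαβ, zero_smul, add_zero, map_smul, LinearMap.smul_apply, cross_self, smul_zero]
  refine ⟨w, hw, α, β, hα, hβ, hαβ, ?_⟩
  have hline : ∀ s ∈ S, det3 s.rep x.rep y.rep = 0 → s = x ∨ s = y ∨ s = w := by
    intro s hs h0
    refine hthird s hs ?_
    obtain ⟨k, -, hk⟩ := exists_smul_crossProduct (e := ux) (t := x.rep) (u := y.rep)
      (by rw [dotProduct_comm, hx.u_self]) (by rw [dotProduct_comm, hxy]) hx.u_ne_zero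
      (crossProduct_rep_ne_zero nxy)
    rw [hk, smul_dotProduct, crossProduct_dotProduct, h0, smul_zero]
  have hwdet : det3 w.rep x.rep y.rep = 0 := by
    rw [hαβ]; simp only [det3_expand, Pi.add_apply, Pi.smul_apply, smul_eq_mul]; ring
  have hc := pencilProd_cyclic_of_third hw hwx hwy hwz hwdet hline (hy.side hz.mem nyz hyz)
    (hz.side hx.mem nxz.symm hzx)
  have e1 : det3 w.rep y.rep z.rep = α * det3 x.rep y.rep z.rep := by
    rw [hαβ]; simp only [det3_expand, Pi.add_apply, Pi.smul_apply, smul_eq_mul]; ring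
  have e2 : det3 w.rep z.rep x.rep = β * det3 x.rep y.rep z.rep := by
    rw [hαβ]; simp only [det3_expand, Pi.add_apply, Pi.smul_apply, smul_eq_mul]; ring
  rw [e1, e2, mul_div_mul_right _ _ h, eq_div_iff hβ] at hc
  have pz := hz.pencilProd_mul_of_u_ne h hx.mem hy.mem hzx hzy
  have px := hx.pencilProd_mul_of_u_left (det3_rep_rotate h) hy.mem hz.mem hxy hxz
  have py := hy.pencilProd_mul_of_u_right (det3_rep_rotate (det3_rep_rotate h)) hz.mem hx.mem hyz
    hyx
  generalize pencilProd S x y z = a at *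
  generalize pencilProd S y z x = b at *
  generalize pencilProd S z x y = c at *
  have e := congrArg₂ (· * ·) (congrArg₂ (· * ·) pz px) py
  linear_combination β * e - (uz ⬝ᵥ x.rep) * (tz ⬝ᵥ y.rep) * (tx ⬝ᵥ z.rep) * (ty ⬝ᵥ x.rep) * hc

end IsSpecial

end Triangles

/-! ### The Segre family of the special points. -/

section SpecialPoints

open scoped Classical

variable {K : Type*} [Field K] {S A : Finset (ProjPlane K)} {t u : ProjPlane K → Fin 3 → K}
  {o : ProjPlane K}

/-- The points of `A`, other than `o`, which do not share their 3-secant with `o`. -/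
noncomputable def notSharing (A : Finset (ProjPlane K)) (u : ProjPlane K → Fin 3 → K)
    (o : ProjPlane K) : Finset (ProjPlane K) :=
  A.filter fun x => x ≠ o ∧ u o ⬝ᵥ x.rep ≠ 0

/-- The factor that normalises the 3-secant at `x` with respect to `o`. -/
noncomputable def secantScale (t u : ProjPlane K → Fin 3 → K) (o x : ProjPlane K) : K :=
  (t x ⬝ᵥ o.rep) * (u o ⬝ᵥ x.rep) / ((u x ⬝ᵥ o.rep) * (t o ⬝ᵥ x.rep))

lemma det3_ne_zero_of_notSharing (hA : ∀ x ∈ A, IsSpecial S x (t x) (u x)) (ho : o ∈ A)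
    {x y : ProjPlane K} (hx : x ∈ notSharing A u o) (hy : y ∈ notSharing A u o) (hxy : x ≠ y) :
    det3 x.rep y.rep o.rep ≠ 0 := by
  simp only [notSharing, Finset.mem_filter] at hx hy
  intro h0
  have h1 : det3 y.rep o.rep x.rep = 0 := by rw [← det3_rotate, h0]
  rcases (hA o ho).side (hA x hx.1).mem hx.2.1.symm hx.2.2 y (hA y hy.1).mem h1 with h | h
  · exact hy.2.1 h
  · exact hxy h.symm

lemma secant_apply_ne_zero (hA : ∀ x ∈ A, IsSpecial S x (t x) (u x)) (ho : o ∈ A)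
    {x : ProjPlane K} (hx : x ∈ notSharing A u o) : u x ⬝ᵥ o.rep ≠ 0 := by
  simp only [notSharing, Finset.mem_filter] at hx
  exact fun h0 => hx.2.2 ((hA x hx.1).u_symm (hA o ho) h0)

lemma secantScale_ne_zero (hA : ∀ x ∈ A, IsSpecial S x (t x) (u x)) (ho : o ∈ A)
    {x : ProjPlane K} (hx : x ∈ notSharing A u o) : secantScale t u o x ≠ 0 := by
  have h1 := secant_apply_ne_zero hA ho hx
  simp only [notSharing, Finset.mem_filter] at hx
  exact div_ne_zero (mul_ne_zero ((hA x hx.1).t_ne (hA o ho).mem hx.2.1.symm) hx.2.2)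
    (mul_ne_zero h1 ((hA o ho).t_ne (hA x hx.1).mem hx.2.1))

/-- The Segre family formed by the special points of a set of size `q + 2`. -/
noncomputable def specialFamily [Fintype K] (hA : ∀ x ∈ A, IsSpecial S x (t x) (u x))
    (ho : o ∈ A) : SegreFamily (notSharing A u o) K where
  e i := i.1.rep
  t i := t i
  u i := secantScale t u o i • u i
  e_ne_zero i := i.1.rep_nonzero
  t_self i := (hA i (Finset.mem_filter.mp i.2).1).t_self
  u_self i := by rw [smul_dotProduct, (hA i (Finset.mem_filter.mp i.2).1).u_self, smul_zero]
  cross_ne_zero i := by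
    rw [map_smul]
    exact smul_ne_zero (secantScale_ne_zero hA ho i.2)
      (hA i (Finset.mem_filter.mp i.2).1).cross_ne_zero
  rel i j := by
    obtain ⟨x, hx⟩ := i
    obtain ⟨y, hy⟩ := j
    have hxo := secant_apply_ne_zero hA ho hx
    have hyo := secant_apply_ne_zero hA ho hy
    have hdet := det3_ne_zero_of_notSharing hA ho hx hy
    simp only [notSharing, Finset.mem_filter] at hx hy
    have sx := hA x hx.1
    have sy := hA y hy.1
    have so := hA o ho
    by_cases hxy : x = y
    · subst hxy
      rw [sx.t_self]; ring
    simp only [smul_dotProduct, smul_eq_mul]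
    -- On a shared 3-secant both terms vanish. Otherwise Segre's lemma for `x, y, o` applies, and
    -- the scaling absorbs all factors that involve `o`.
    by_cases hu : u x ⬝ᵥ y.rep = 0
    · rw [hu, sx.u_symm sy hu]; ring
    have hs := sx.segre sy so (hdet hxy) hu hyo hx.2.2
    have htx := so.t_ne sx.mem hx.2.1
    have hty := so.t_ne sy.mem hy.2.1
    rw [secantScale, secantScale]
    field_simp
    linear_combination hs

variable [Fintype K]

lemma specialFamily_t_ne (hA : ∀ x ∈ A, IsSpecial S x (t x) (u x)) (ho : o ∈ A)
    (i j : notSharing A u o) (hij : i ≠ j) :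
    (specialFamily hA ho).t i ⬝ᵥ (specialFamily hA ho).e j ≠ 0 :=
  (hA i (Finset.mem_filter.mp i.2).1).t_ne (hA j (Finset.mem_filter.mp j.2).1).mem
    fun h => hij (Subtype.ext h.symm)

lemma specialFamily_u_eq_zero_iff (hA : ∀ x ∈ A, IsSpecial S x (t x) (u x)) (ho : o ∈ A)
    (i : notSharing A u o) (v : Fin 3 → K) :
    (specialFamily hA ho).u i ⬝ᵥ v = 0 ↔ u i ⬝ᵥ v = 0 := by
  change (secantScale t u o i • u i) ⬝ᵥ v = 0 ↔ _
  rw [smul_dotProduct, smul_eq_zero, or_iff_right (secantScale_ne_zero hA ho i.2)]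

lemma specialFamily_dichotomy (hA : ∀ x ∈ A, IsSpecial S x (t x) (u x)) (ho : o ∈ A)
    (h2 : (2 : K) ≠ 0) (hK : 4 < Nat.card K) : (specialFamily hA ho).Dichotomy 870 := by
  have hS : ∀ i : notSharing A u o, IsSpecial S i (t i) (u i) := fun i =>
    hA i (Finset.mem_filter.mp i.2).1
  refine (specialFamily hA ho).dichotomy h2 hK (specialFamily_t_ne hA ho)
    (fun i j k hij hik hjk h0 => ?_) (fun a ha T hT => ?_)
  · rw [specialFamily_u_eq_zero_iff]
    change u i ⬝ᵥ j.1.rep = 0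
    by_contra hu
    rw [← det3_rotate] at h0
    rcases (hS i).side (hS j).mem (fun h => hij (Subtype.ext h)) hu k (hS k).mem h0 with h | h
    · exact hik (Subtype.ext h.symm)
    · exact hjk (Subtype.ext h.symm)
  · rcases T.eq_empty_or_nonempty with rfl | ⟨i, hi⟩
    · simp
    refine le_trans ?_ ((hS i).count_le_three ha (hT i hi))
    rw [← Finset.card_image_of_injective T Subtype.val_injective]
    refine Finset.card_le_card fun x hx => ?_
    obtain ⟨j, hj, rfl⟩ := Finset.mem_image.mp hx
    exact Finset.mem_filter.mpr ⟨(hS j).mem, hT j hj⟩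

/-- Apart from a bounded number of exceptions, the 3-secants at the special points are distinct, or
they are concurrent at a point of `S`. -/
theorem exists_special_dichotomy (h2 : (2 : K) ≠ 0) (hK : 4 < Nat.card K)
    (hA : ∀ x ∈ A, ∃ t u, IsSpecial S x t u) : ∃ B ⊆ A, A.card ≤ B.card + 873 ∧
      ((∀ x ∈ B, ∀ y ∈ B, x ≠ y → ∀ f : Fin 3 → K, f ≠ 0 → f ⬝ᵥ x.rep = 0 → f ⬝ᵥ y.rep = 0 →
        lineCount S f ≠ 3) ∨
      ∃ P ∈ S, ∀ x ∈ B, x ≠ P → lineCount S (crossProduct x.rep P.rep) = 3) := by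
  rcases A.eq_empty_or_nonempty with rfl | ⟨o, ho⟩
  · exact ⟨∅, subset_rfl, by simp, Or.inl (by simp)⟩
  have hA' : ∀ x, ∃ t u, x ∈ A → IsSpecial S x t u := fun x => by
    by_cases hx : x ∈ A
    · obtain ⟨t, u, h⟩ := hA x hx
      exact ⟨t, u, fun _ => h⟩
    · exact ⟨0, 0, fun h => absurd h hx⟩
  choose t u hA' using hA'
  obtain ⟨A₀, hcard, hdich⟩ := specialFamily_dichotomy hA' ho h2 hK
  set B := notSharing A u o \ A₀.image Subtype.val with hB
  have hBmem : ∀ x, x ∈ B ↔ ∃ h : x ∈ notSharing A u o, (⟨x, h⟩ : notSharing A u o) ∉ A₀ := by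
    intro x
    simp only [hB, Finset.mem_sdiff, Finset.mem_image, Subtype.exists, exists_and_right,
      exists_eq_right, not_exists]
    exact ⟨fun ⟨h1, h2⟩ => ⟨h1, h2 h1⟩, fun ⟨h1, h2⟩ => ⟨h1, fun _ => h2⟩⟩
  have hBA : B ⊆ A := fun x hx => (Finset.mem_filter.mp (Finset.mem_sdiff.mp hx).1).1
  have so := hA' o ho
  refine ⟨B, hBA, ?_, ?_⟩
  -- The loss is `873 = 870 + 3`: the exceptions of the dichotomy and the points on the 3-secant at
  -- `o`.
  · have h1 : A ⊆ notSharing A u o ∪ S.filter fun x => u o ⬝ᵥ x.rep = 0 := by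
      intro x hx
      by_cases hu : u o ⬝ᵥ x.rep = 0
      · exact Finset.mem_union_right _ (Finset.mem_filter.mpr ⟨(hA' x hx).mem, hu⟩)
      · refine Finset.mem_union_left _ (Finset.mem_filter.mpr ⟨hx, ?_, hu⟩)
        rintro rfl
        exact hu so.u_self
    have h3 := (Finset.card_le_card h1).trans (Finset.card_union_le _ _)
    have h4 : (S.filter fun x => u o ⬝ᵥ x.rep = 0).card = 3 := so.count_u
    have h5 := Finset.le_card_sdiff (A₀.image Subtype.val) (notSharing A u o)
    rw [← hB] at h5
    have h6 := Finset.card_image_le (s := A₀) (f := Subtype.val)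
    omega
  by_cases hpart : ∀ x ∈ B, ∀ y ∈ B, x ≠ y → u x ⬝ᵥ y.rep ≠ 0
  · left
    intro x hx y hy hxy f hf hfx hfy h3
    obtain ⟨k, hk⟩ := (hA' x (hBA hx)).exists_smul_of_count_eq_three hf hfx h3
    refine hpart x hx y hy hxy ?_
    rw [hk, smul_dotProduct] at hfy
    refine (smul_eq_zero.mp hfy).resolve_left ?_
    rintro rfl
    exact hf (by rw [hk, zero_smul])
  right
  push Not at hpart
  obtain ⟨x, hx, y, hy, hxy, hu⟩ := hpart
  have sx := hA' x (hBA hx)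
  have sy := hA' y (hBA hy)
  obtain ⟨hx', hxA⟩ := (hBmem x).mp hx
  obtain ⟨hy', hyA⟩ := (hBmem y).mp hy
  have hij : (⟨x, hx'⟩ : notSharing A u o) ≠ ⟨y, hy'⟩ := fun h => hxy (congrArg Subtype.val h)
  rcases hdich with hdich | ⟨P, hP0, hP, hPf⟩
  · exact absurd ((specialFamily_u_eq_zero_iff hA' ho _ _).mpr hu) (hdich _ _ hxA hyA hij)
  obtain ⟨α, β, hPxy, hPo⟩ := hPf _ _ hxA hyA hij ((specialFamily_u_eq_zero_iff hA' ho _ _).mpr hu)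
  have hxo := secant_apply_ne_zero hA' ho hx'
  have hyo := secant_apply_ne_zero hA' ho hy'
  have hdet := det3_ne_zero_of_notSharing hA' ho hx' hy' hxy
  simp only [notSharing, Finset.mem_filter] at hx' hy'
  obtain ⟨w, hw, α', β', hα', hβ', hwxy, hwo⟩ := sx.segre_of_shared sy so hdet hu hyo hx'.2.2
  have htx := so.t_ne sx.mem hx'.2.1
  have hty := so.t_ne sy.mem hy'.2.1
  have htxo := sx.t_ne so.mem hx'.2.1.symm
  have htyo := sy.t_ne so.mem hy'.2.1.symm
  have htxy := sx.t_ne sy.mem hxy.symm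
  have htyx := sy.t_ne sx.mem hxy
  have hPo' := hPo o.rep
  change (secantScale t u o x • u x) ⬝ᵥ o.rep * (t y ⬝ᵥ x.rep) * α +
    (secantScale t u o y • u y) ⬝ᵥ o.rep * (t x ⬝ᵥ y.rep) * β = 0 at hPo'
  change P = α • x.rep + β • y.rep at hPxy
  rw [smul_dotProduct, smul_dotProduct, smul_eq_mul, smul_eq_mul, secantScale, secantScale] at hPo'
  field_simp at hPo'
  -- `P` and the third point `w` of the shared 3-secant satisfy the same linear relation, one by the
  -- dichotomy and the other by Segre's lemma with `o`. So they coincide, and this puts `P` in `S`.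
  have hαβ : α * β' = α' * β := by
    refine mul_left_cancel₀ (mul_ne_zero (mul_ne_zero (mul_ne_zero hx'.2.2 hty) htxo) htyx) ?_
    linear_combination β' * hPo' - β * hwo
  have hPw : α' • P = α • w.rep := by
    rw [hPxy, hwxy, smul_add, smul_add, smul_smul, smul_smul, smul_smul, smul_smul, ← hαβ,
      mul_comm α']
  have hα : α ≠ 0 := by
    rintro rfl
    rw [zero_smul] at hPw
    exact hP0 ((smul_eq_zero.mp hPw).resolve_left hα')
  refine ⟨w, hw, fun z hz hzw => ?_⟩
  have sz := hA' z (hBA hz)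
  obtain ⟨hz', hzA⟩ := (hBmem z).mp hz
  have huw : u z ⬝ᵥ w.rep = 0 := by
    have := (specialFamily_u_eq_zero_iff hA' ho _ _).mp (hP _ hzA)
    change u z ⬝ᵥ P = 0 at this
    have h3 := congrArg (u z ⬝ᵥ ·) hPw
    simp only [dotProduct_smul, this, smul_zero] at h3
    exact (smul_eq_zero.mp h3.symm).resolve_left hα
  have hf := crossProduct_rep_ne_zero hzw
  obtain ⟨k, -, hk⟩ := exists_smul_crossProduct (e := u z) (t := z.rep) (u := w.rep)
      (by rw [dotProduct_comm, sz.u_self]) (by rw [dotProduct_comm, huw]) sz.u_ne_zero hf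
  rw [sz.count _ hf (by rw [crossProduct_dotProduct]; simp only [det3_expand]; ring),
    if_neg (sz.cross_t_ne_zero hf hw hzw.symm
      (by rw [crossProduct_dotProduct]; simp only [det3_expand]; ring)), if_pos]
  conv_lhs => rw [hk]
  rw [map_smul, cross_self, smul_zero]

end SpecialPoints

/-! ### Counting tangents and 3-secants. -/

section Counting

open scoped Classical

variable {K : Type*} [Field K] {S : Finset (ProjPlane K)} {x y ℓ : ProjPlane K}

lemma lineCount_smul (S : Finset (ProjPlane K)) (f : Fin 3 → K) {k : K} (hk : k ≠ 0) :
    lineCount S (k • f) = lineCount S f := by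
  simp only [lineCount, smul_dotProduct, smul_eq_zero, or_iff_right hk]

lemma orthogonal_iff : ℓ.orthogonal x ↔ ℓ.rep ⬝ᵥ x.rep = 0 := by
  conv_lhs => rw [← ℓ.mk_rep, ← x.mk_rep]
  exact Projectivization.orthogonal_mk _ _

lemma exists_rep_mk_eq_smul {f : Fin 3 → K} (hf : f ≠ 0) :
    ∃ k : K, k ≠ 0 ∧ f = k • (Projectivization.mk K f hf).rep := by
  obtain ⟨a, ha⟩ := Projectivization.exists_smul_eq_mk_rep K f hf
  refine ⟨(a⁻¹ : Kˣ), Units.ne_zero _, ?_⟩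
  rw [← ha, Units.smul_def, smul_smul, Units.inv_mul, one_smul]

lemma eq_of_incident (hxy : x ≠ y) {m : ProjPlane K} (h1 : ℓ.rep ⬝ᵥ x.rep = 0)
    (h2 : ℓ.rep ⬝ᵥ y.rep = 0) (h3 : m.rep ⬝ᵥ x.rep = 0) (h4 : m.rep ⬝ᵥ y.rep = 0) : ℓ = m :=
  (Configuration.ofField.eq_or_eq_of_orthogonal (orthogonal_iff.mpr h1) (orthogonal_iff.mpr h3)
    (orthogonal_iff.mpr h2) (orthogonal_iff.mpr h4)).resolve_right hxy

/-- The number of lines through a point of the plane of order `q` is `q + 1`. -/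
lemma natCard_pencil [Finite K] (x : ProjPlane K) :
    Nat.card {ℓ : ProjPlane K // ℓ.rep ⬝ᵥ x.rep = 0} = Nat.card K + 1 := by
  have := Fintype.ofFinite (ProjPlane K)
  have h1 := Configuration.ProjectivePlane.card_points (ProjPlane K) (ProjPlane K)
  have h2 := Projectivization.card_of_finrank K (Fin 3 → K) (n := 3) (by simp)
  rw [Nat.card_eq_fintype_card, h1] at h2
  simp only [Finset.sum_range_succ, Finset.sum_range_zero, pow_zero, pow_one] at h2
  have h3 : Configuration.ProjectivePlane.order (ProjPlane K) (ProjPlane K) = Nat.card K := by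
    rcases lt_trichotomy (Configuration.ProjectivePlane.order (ProjPlane K) (ProjPlane K))
      (Nat.card K) with h | h | h
    · have := Nat.pow_lt_pow_left h two_ne_zero
      omega
    · exact h
    · have := Nat.pow_lt_pow_left h two_ne_zero
      omega
  have h4 := Configuration.ProjectivePlane.lineCount_eq (ProjPlane K) x
  rw [h3, Configuration.lineCount] at h4
  rw [← h4]
  refine Nat.card_congr (Equiv.subtypeEquivRight fun ℓ => ?_)
  rw [Configuration.ofField.mem_iff, Projectivization.orthogonal_comm, orthogonal_iff]

lemma one_le_lineCount (hx : x ∈ S) {f : Fin 3 → K} (h : f ⬝ᵥ x.rep = 0) : 1 ≤ lineCount S f :=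
  Finset.card_pos.mpr ⟨x, Finset.mem_filter.mpr ⟨hx, h⟩⟩

variable [Fintype (ProjPlane K)]

/-- The lines through `x` with exactly `n` points of `S`. -/
noncomputable def secantsThrough (S : Finset (ProjPlane K)) (x : ProjPlane K) (n : ℕ) :
    Finset (ProjPlane K) :=
  Finset.univ.filter fun ℓ => ℓ.rep ⬝ᵥ x.rep = 0 ∧ lineCount S ℓ.rep = n

lemma mem_secantsThrough {n : ℕ} :
    ℓ ∈ secantsThrough S x n ↔ ℓ.rep ⬝ᵥ x.rep = 0 ∧ lineCount S ℓ.rep = n := by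
  simp [secantsThrough]

/-- The `q + 1` lines through `x` partition the `q + 1` other points of `S`. -/
lemma sum_pencil [Finite K] (hS : S.card = Nat.card K + 2) (hx : x ∈ S) :
    ∑ ℓ : ProjPlane K with ℓ.rep ⬝ᵥ x.rep = 0, ((lineCount S ℓ.rep : ℤ) - 2) = 0 := by
  have hpencil : (Finset.univ.filter fun ℓ : ProjPlane K => ℓ.rep ⬝ᵥ x.rep = 0).card =
      Nat.card K + 1 := by
    rw [← natCard_pencil x, Nat.card_eq_fintype_card, Fintype.card_subtype]
  have hsum : (S.erase x).card = ∑ ℓ : ProjPlane K with ℓ.rep ⬝ᵥ x.rep = 0, (lineCount S ℓ.rep - 1) := by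
    rw [Finset.card_eq_sum_card_fiberwise (f := fun y => Projectivization.cross x y)
      (t := Finset.univ.filter fun ℓ : ProjPlane K => ℓ.rep ⬝ᵥ x.rep = 0)]
    · refine Finset.sum_congr rfl fun ℓ hℓ => ?_
      have hℓ := (Finset.mem_filter.mp hℓ).2
      rw [lineCount, ← Finset.card_erase_of_mem (Finset.mem_filter.mpr ⟨hx, hℓ⟩)]
      congr 1
      ext y
      simp only [Finset.mem_filter, Finset.mem_erase]
      constructor
      · rintro ⟨⟨hyx, hy⟩, rfl⟩
        exact ⟨hyx, hy, orthogonal_iff.mp (Projectivization.cross_orthogonal_right hyx.symm)⟩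
      · rintro ⟨hyx, hy, h⟩
        refine ⟨⟨hyx, hy⟩, eq_of_incident hyx.symm
          (orthogonal_iff.mp (Projectivization.cross_orthogonal_left hyx.symm))
          (orthogonal_iff.mp (Projectivization.cross_orthogonal_right hyx.symm)) hℓ h⟩
    · intro y hy
      have hyx := Finset.ne_of_mem_erase (Finset.mem_coe.mp hy)
      exact Finset.mem_coe.mpr (Finset.mem_filter.mpr ⟨Finset.mem_univ _,
        orthogonal_iff.mp (Projectivization.cross_orthogonal_left hyx.symm)⟩)
  rw [Finset.card_erase_of_mem hx, hS] at hsum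
  have hcast : (∑ ℓ : ProjPlane K with ℓ.rep ⬝ᵥ x.rep = 0, ((lineCount S ℓ.rep : ℤ) - 1)) =
      Nat.card K + 1 := by
    have hc : ∀ ℓ ∈ Finset.univ.filter (fun ℓ : ProjPlane K => ℓ.rep ⬝ᵥ x.rep = 0),
        ((lineCount S ℓ.rep - 1 : ℕ) : ℤ) = (lineCount S ℓ.rep : ℤ) - 1 := fun ℓ hℓ => by
      rw [Nat.cast_sub (one_le_lineCount hx (Finset.mem_filter.mp hℓ).2), Nat.cast_one]
    rw [← Finset.sum_congr rfl hc, ← Nat.cast_sum, ← hsum]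
    omega
  have : ∀ ℓ : ProjPlane K, ((lineCount S ℓ.rep : ℤ) - 2) = (lineCount S ℓ.rep : ℤ) - 1 - 1 :=
    fun ℓ => by ring
  simp only [this]
  rw [Finset.sum_sub_distrib, hcast, Finset.sum_const, hpencil]
  simp

/-- In `sum_pencil` tangents contribute `-1`, 3-secants `1`, and no other line a negative amount. -/
lemma card_three_le_card_one [Finite K] (hS : S.card = Nat.card K + 2) (hx : x ∈ S) :
    (secantsThrough S x 3).card ≤ (secantsThrough S x 1).card := by
  have h := sum_pencil hS hx
  have e : ∀ n, ((secantsThrough S x n).card : ℤ) =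
      ∑ ℓ : ProjPlane K with ℓ.rep ⬝ᵥ x.rep = 0, if lineCount S ℓ.rep = n then 1 else 0 := by
    intro n
    rw [secantsThrough, ← Finset.filter_filter, Finset.card_filter]
    push_cast
    rfl
  have : ((secantsThrough S x 3).card : ℤ) - (secantsThrough S x 1).card ≤ 0 := by
    rw [e, e, ← h, ← Finset.sum_sub_distrib]
    refine Finset.sum_le_sum fun ℓ hℓ => ?_
    have := one_le_lineCount hx (Finset.mem_filter.mp hℓ).2
    split_ifs <;> omega
  omega

lemma bisecants_of_card_one_eq_zero [Finite K] (hS : S.card = Nat.card K + 2) (hx : x ∈ S)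
    (h0 : (secantsThrough S x 1).card = 0) {f : Fin 3 → K} (hf : f ≠ 0) (hfx : f ⬝ᵥ x.rep = 0) :
    lineCount S f = 2 := by
  obtain ⟨k, hk, hfk⟩ := exists_rep_mk_eq_smul hf
  set ℓ := Projectivization.mk K f hf
  rw [hfk, smul_dotProduct] at hfx
  have hℓ := (smul_eq_zero.mp hfx).resolve_left hk
  rw [hfk, lineCount_smul S _ hk]
  have h := (Finset.sum_eq_zero_iff_of_nonneg fun m hm => ?_).mp (sum_pencil hS hx) ℓ
    (Finset.mem_filter.mpr ⟨Finset.mem_univ _, hℓ⟩)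
  · omega
  · have hm := (Finset.mem_filter.mp hm).2
    have h1 := one_le_lineCount hx hm
    have h2 : lineCount S m.rep ≠ 1 := fun h1 => by
      rw [Finset.card_eq_zero] at h0
      exact Finset.notMem_empty m (h0 ▸ mem_secantsThrough.mpr ⟨hm, h1⟩)
    omega

/-- The tangent contributes `-1`, so the remaining nonnegative terms add up to 1: a single 3-secant.
-/
lemma exists_isSpecial [Finite K] (hS : S.card = Nat.card K + 2) (hx : x ∈ S)
    (h1 : (secantsThrough S x 1).card = 1) : ∃ t u, IsSpecial S x t u := by
  obtain ⟨t, ht⟩ := Finset.card_eq_one.mp h1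
  have ht' : ∀ m : ProjPlane K, m.rep ⬝ᵥ x.rep = 0 → (lineCount S m.rep = 1 ↔ m = t) := by
    intro m hm
    have := congrArg (m ∈ ·) ht
    simpa [mem_secantsThrough, hm] using this
  obtain ⟨htx, ht1⟩ := mem_secantsThrough.mp (ht ▸ Finset.mem_singleton_self t)
  set L := (Finset.univ.filter fun ℓ : ProjPlane K => ℓ.rep ⬝ᵥ x.rep = 0) with hL
  have hsum := sum_pencil hS hx
  have htL : t ∈ L := Finset.mem_filter.mpr ⟨Finset.mem_univ _, htx⟩
  rw [← Finset.add_sum_erase _ _ htL, ht1] at hsum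
  have hnonneg : ∀ m ∈ L.erase t, 0 ≤ (lineCount S m.rep : ℤ) - 2 := by
    intro m hm
    obtain ⟨hmt, hm⟩ := Finset.mem_erase.mp hm
    have hm := (Finset.mem_filter.mp hm).2
    have h1 := one_le_lineCount hx hm
    have h2 : lineCount S m.rep ≠ 1 := fun h => hmt ((ht' m hm).mp h)
    omega
  obtain ⟨u, hu, hu0⟩ : ∃ u ∈ L.erase t, (lineCount S u.rep : ℤ) - 2 ≠ 0 :=
    Finset.exists_ne_zero_of_sum_ne_zero (s := L.erase t) (by
      intro h; rw [h] at hsum; norm_num at hsum)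
  rw [← Finset.add_sum_erase _ _ hu] at hsum
  have hnn : 0 ≤ ∑ m ∈ (L.erase t).erase u, ((lineCount S m.rep : ℤ) - 2) :=
    Finset.sum_nonneg fun m hm => hnonneg m (Finset.mem_of_mem_erase hm)
  have hu2 := hnonneg u hu
  have hu3 : lineCount S u.rep = 3 := by push_cast at hsum; omega
  have hrest := (Finset.sum_eq_zero_iff_of_nonneg
    fun m hm => hnonneg m (Finset.mem_of_mem_erase hm)).mp
    (by push_cast at hsum; omega : ∑ m ∈ (L.erase t).erase u, ((lineCount S m.rep : ℤ) - 2) = 0)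
  obtain ⟨hut, huL⟩ := Finset.mem_erase.mp hu
  have hux := (Finset.mem_filter.mp huL).2
  refine ⟨t.rep, u.rep, hx, htx, hux, fun h => hut (eq_of_crossProduct_rep_eq_zero h).symm,
    fun f hf hfx => ?_⟩
  obtain ⟨k, hk, hfk⟩ := exists_rep_mk_eq_smul hf
  set ℓ := Projectivization.mk K f hf
  rw [hfk, smul_dotProduct] at hfx
  have hℓ := (smul_eq_zero.mp hfx).resolve_left hk
  have hcross : ∀ m : ProjPlane K, crossProduct f m.rep = 0 ↔ ℓ = m := by
    intro m
    rw [hfk, map_smul, LinearMap.smul_apply, smul_eq_zero, or_iff_right hk]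
    exact ⟨eq_of_crossProduct_rep_eq_zero, fun h => by rw [h, cross_self]⟩
  simp only [hcross]
  rw [hfk, lineCount_smul S _ hk]
  split_ifs with h1 h2
  · rw [h1, ht1]
  · rw [h2, hu3]
  · have := hrest ℓ (Finset.mem_erase.mpr ⟨h2, Finset.mem_erase.mpr ⟨h1,
      Finset.mem_filter.mpr ⟨Finset.mem_univ _, hℓ⟩⟩⟩)
    omega

/-- There are at most two points of `S` all of whose secants are bisecants. -/
lemma card_bisecant_points_le [Finite K] (h2 : (2 : K) ≠ 0) (hS : S.card = Nat.card K + 2) :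
    (S.filter fun x => (secantsThrough S x 1).card = 0).card ≤ 2 := by
  have := Fintype.ofFinite K
  by_contra! h
  obtain ⟨x, hx, y, hy, z, hz, hxy, hxz, hyz⟩ := Finset.two_lt_card.mp h
  simp only [Finset.mem_filter] at hx hy hz
  have hb := fun {x : ProjPlane K} (hx : x ∈ S ∧ (secantsThrough S x 1).card = 0)
    (f : Fin 3 → K) (hf : f ≠ 0) (hfx : f ⬝ᵥ x.rep = 0) =>
    bisecants_of_card_one_eq_zero hS hx.1 hx.2 hf hfx
  have hdet := det3_eq_zero_of_bisecants h2 hx.1 hy.1 hz.1 (hb hx) (hb hy) (hb hz)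
  have hline := hb hx _ (crossProduct_rep_ne_zero hxy)
    (by rw [crossProduct_dotProduct]; simp only [det3_expand]; ring)
  rcases eq_or_eq_of_side rfl hline hxy hx.1 hy.1 z hz.1 (by rw [← hdet, det3_rotate]) with h | h
  · exact hxz h.symm
  · exact hyz h.symm

/-- The lines with exactly `n` points of `S`. -/
noncomputable def secants (S : Finset (ProjPlane K)) (n : ℕ) : Finset (ProjPlane K) :=
  Finset.univ.filter fun ℓ => lineCount S ℓ.rep = n

lemma card_secantsThrough_le (n : ℕ) : (secantsThrough S x n).card ≤ (secants S n).card :=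
  Finset.card_le_card fun _ h =>
    Finset.mem_filter.mpr ⟨Finset.mem_univ _, (mem_secantsThrough.mp h).2⟩

lemma sum_card_tangents (S : Finset (ProjPlane K)) :
    ∑ x ∈ S, (secantsThrough S x 1).card = (secants S 1).card := by
  have h := Finset.sum_card_bipartiteAbove_eq_sum_card_bipartiteBelow
    (fun (x : ProjPlane K) (ℓ : ProjPlane K) => ℓ.rep ⬝ᵥ x.rep = 0) (s := S) (t := secants S 1)
  have h1 : ∀ ℓ ∈ secants S 1, (Finset.bipartiteBelow
      (fun (x : ProjPlane K) (ℓ : ProjPlane K) => ℓ.rep ⬝ᵥ x.rep = 0) S ℓ).card = 1 :=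
    fun ℓ hℓ => (Finset.mem_filter.mp hℓ).2
  rw [Finset.sum_congr rfl h1, ← Finset.card_eq_sum_ones] at h
  rw [← h]
  refine Finset.sum_congr rfl fun x _ => congrArg Finset.card ?_
  ext ℓ
  simp only [secantsThrough, secants, Finset.bipartiteAbove, Finset.mem_filter, Finset.mem_univ,
    true_and]
  exact and_comm

/-- The number of tangents and 3-secants. -/
theorem le_card_tangents_add_card_three_secants [Finite K] (h2 : (2 : K) ≠ 0)
    (hS : S.card = Nat.card K + 2) :
    2 * Nat.card K ≤ (secants S 1).card + (secants S 3).card + 876 := by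
  by_cases hK : 4 < Nat.card K
  swap
  · omega
  have := Fintype.ofFinite K
  set A := S.filter fun x => (secantsThrough S x 1).card = 1 with hA
  set Z := S.filter fun x => (secantsThrough S x 1).card = 0 with hZ
  have hZ2 : Z.card ≤ 2 := card_bisecant_points_le h2 hS
  -- Every point counts for two tangents, once special points are credited with 1 and points without
  -- tangents with 2.
  have hlow : ∀ x : ProjPlane K, 2 ≤ (secantsThrough S x 1).card +
      (if (secantsThrough S x 1).card = 1 then 1 else 0) +
      2 * (if (secantsThrough S x 1).card = 0 then 1 else 0) := by
    intro x; split_ifs <;> omega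
  have htot : ∑ x ∈ S, ((secantsThrough S x 1).card +
      (if (secantsThrough S x 1).card = 1 then 1 else 0) +
      2 * (if (secantsThrough S x 1).card = 0 then 1 else 0)) =
      (secants S 1).card + A.card + 2 * Z.card := by
    rw [Finset.sum_add_distrib, Finset.sum_add_distrib, ← Finset.mul_sum, sum_card_tangents,
      ← Finset.card_filter, ← Finset.card_filter]
  have hspecial : ∀ x ∈ A, ∃ t u, IsSpecial S x t u := fun x hx =>
    exists_isSpecial hS (Finset.mem_filter.mp hx).1 (Finset.mem_filter.mp hx).2
  obtain ⟨B, hBA, hcard, hB | ⟨P, hP, hB⟩⟩ := exists_special_dichotomy h2 hK hspecial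
  -- Distinct 3-secants: at least `|A| - 873` of them, besides at least `2(q + 2) - |A| - 4`
  -- tangents.
  · have h3 : B.card ≤ (secants S 3).card := by
      have hex : ∀ x, ∃ ℓ : ProjPlane K, x ∈ B → ℓ.rep ⬝ᵥ x.rep = 0 ∧ lineCount S ℓ.rep = 3 := by
        intro x
        by_cases hx : x ∈ B
        · obtain ⟨t, u, h⟩ := hspecial x (hBA hx)
          obtain ⟨k, hk, hu⟩ := exists_rep_mk_eq_smul h.u_ne_zero
          refine ⟨Projectivization.mk K u h.u_ne_zero, fun _ => ⟨?_, ?_⟩⟩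
          · have h0 := h.u_self
            rw [hu, smul_dotProduct] at h0
            exact (smul_eq_zero.mp h0).resolve_left hk
          · rw [← lineCount_smul S _ hk, ← hu, h.count_u]
        · exact ⟨x, fun h => absurd h hx⟩
      choose g hg using hex
      refine Finset.card_le_card_of_injOn g (fun x hx => ?_) fun x hx y hy hxy => ?_
      · exact Finset.mem_coe.mpr (Finset.mem_filter.mpr ⟨Finset.mem_univ _, (hg x hx).2⟩)
      · by_contra hne
        exact hB x hx y hy hne (g x).rep (g x).rep_nonzero (hg x hx).1 (hxy ▸ (hg y hy).1)
          (hg x hx).2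
    have hsum := Finset.sum_le_sum fun x (_ : x ∈ S) => hlow x
    rw [htot, Finset.sum_const, hS, smul_eq_mul] at hsum
    omega
  -- Let `P` be on `k` 3-secants, each with two further points, so `2k ≥ |A| - 874`. Then `P` is on
  -- at least `k` tangents, and the other points give `2(q + 1) - |A| - 4`; the total is at least
  -- `2q - 876`.
  · have hBk : B.card ≤ 2 * (secantsThrough S P 3).card + 1 := by
      have hsub : B.erase P ⊆ (secantsThrough S P 3).biUnion fun ℓ =>
          (S.filter fun x => ℓ.rep ⬝ᵥ x.rep = 0).erase P := by
        intro x hx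
        obtain ⟨hxP, hx⟩ := Finset.mem_erase.mp hx
        have hxS := (Finset.mem_filter.mp (hBA hx)).1
        have h3 := hB x hx hxP
        have hf := crossProduct_rep_ne_zero hxP
        obtain ⟨k, hk, hfk⟩ := exists_rep_mk_eq_smul hf
        set ℓ := Projectivization.mk K _ hf
        have e1 : crossProduct x.rep P.rep ⬝ᵥ x.rep = 0 := by
          rw [crossProduct_dotProduct]; simp only [det3_expand]; ring
        have e2 : crossProduct x.rep P.rep ⬝ᵥ P.rep = 0 := by
          rw [crossProduct_dotProduct]; simp only [det3_expand]; ring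
        rw [hfk, smul_dotProduct] at e1 e2
        rw [hfk, lineCount_smul S _ hk] at h3
        refine Finset.mem_biUnion.mpr ⟨ℓ, mem_secantsThrough.mpr
          ⟨(smul_eq_zero.mp e2).resolve_left hk, h3⟩, Finset.mem_erase.mpr ⟨hxP,
            Finset.mem_filter.mpr ⟨hxS, (smul_eq_zero.mp e1).resolve_left hk⟩⟩⟩
      have h1 := (Finset.card_le_card hsub).trans
        (Finset.card_biUnion_le_card_mul _ _ 2 fun ℓ hℓ => by
          obtain ⟨hℓP, hℓ3⟩ := mem_secantsThrough.mp hℓ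
          rw [Finset.card_erase_of_mem (Finset.mem_filter.mpr ⟨hP, hℓP⟩), ← lineCount, hℓ3])
      have h2 := Finset.pred_card_le_card_erase (s := B) (a := P)
      omega
    have hk1 := card_three_le_card_one hS hP
    have hk3 := card_secantsThrough_le (S := S) (x := P) 3
    rw [← Finset.add_sum_erase _ _ hP] at htot
    have hsum := Finset.sum_le_sum fun x (_ : x ∈ S.erase P) => hlow x
    rw [Finset.sum_const, Finset.card_erase_of_mem hP, hS, smul_eq_mul] at hsum
    omega

end Counting

/-! ### Lines as subspaces, and the theorem. -/

section OddSecants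

open scoped Classical

variable {K : Type*} [Field K]

/-- The line with equation `f`, as a subspace of `K³`. -/
noncomputable def lineSubmodule (f : Fin 3 → K) : Submodule K (Fin 3 → K) :=
  LinearMap.ker (dotProductEquiv K (Fin 3) f)

lemma mem_lineSubmodule {f v : Fin 3 → K} : v ∈ lineSubmodule f ↔ f ⬝ᵥ v = 0 := Iff.rfl

lemma finrank_lineSubmodule {f : Fin 3 → K} (hf : f ≠ 0) :
    Module.finrank K (lineSubmodule f) = 2 := by
  have h := Module.Dual.finrank_ker_add_one_of_ne_zero (f := dotProductEquiv K (Fin 3) f)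
    ((dotProductEquiv K (Fin 3)).map_ne_zero_iff.mpr hf)
  rw [Module.finrank_fin_fun] at h
  exact Nat.succ_injective h

lemma crossProduct_eq_zero_of_lineSubmodule_eq {f g : Fin 3 → K}
    (h : lineSubmodule f = lineSubmodule g) : crossProduct f g = 0 := by
  refine dotProduct_eq_zero _ fun w => ?_
  have hm : crossProduct f w ∈ lineSubmodule f := mem_lineSubmodule.mpr (dot_self_cross f w)
  rw [h, mem_lineSubmodule, ← det3] at hm
  rw [crossProduct_dotProduct, ← neg_eq_zero, ← hm]
  simp only [det3_expand]; ring

lemma incidentCount_lineSubmodule (S : Finset (ProjPlane K)) (f : Fin 3 → K) :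
    incidentCount S (lineSubmodule f) = lineCount S f := by
  rw [incidentCount, lineCount, ← Set.ncard_coe_finset]
  congr 1
  ext P
  rw [Set.mem_ofPred_eq, Finset.mem_coe, Finset.mem_filter, Projectivization.submodule_eq,
    Submodule.span_singleton_le_iff_mem, mem_lineSubmodule]

lemma card_odd_lines_le [Finite K] (S : Finset (ProjPlane K)) (T : Finset (ProjPlane K))
    (hT : ∀ ℓ ∈ T, Odd (lineCount S ℓ.rep)) : T.card ≤ (oddSecants S).ncard := by
  have hinj : Function.Injective fun ℓ : ProjPlane K => lineSubmodule ℓ.rep := fun a b h =>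
    eq_of_crossProduct_rep_eq_zero (crossProduct_eq_zero_of_lineSubmodule_eq h)
  have : Finite (Submodule K (Fin 3 → K)) :=
    Finite.of_injective (fun p : Submodule K (Fin 3 → K) => (p : Set (Fin 3 → K)))
      SetLike.coe_injective
  rw [← Set.ncard_coe_finset, ← Set.ncard_image_of_injective _ hinj]
  refine Set.ncard_le_ncard ?_ (Set.toFinite _)
  rintro _ ⟨ℓ, hℓ, rfl⟩
  exact ⟨finrank_lineSubmodule ℓ.rep_nonzero, by
    rw [incidentCount_lineSubmodule]; exact hT ℓ hℓ⟩

end OddSecants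

/-- There is an absolute constant `c` such that, over every finite field with an odd number `q` of
elements, every set of `q + 2` points of the projective plane has at least `2q - c` odd secants. -/
theorem theorem1 :
    ∃ c : ℕ, ∀ (K : Type*) [Field K] [Finite K], Odd (Nat.card K) →
      ∀ S : Finset (ProjPlane K), S.card = Nat.card K + 2 →
        2 * (Nat.card K : ℤ) - (c : ℤ) ≤ ((oddSecants S).ncard : ℤ) := by
  classical
  refine ⟨876, fun K _ _ hodd S hS => ?_⟩
  have := Fintype.ofFinite K
  have := Fintype.ofFinite (ProjPlane K)
  have h2 : (2 : K) ≠ 0 := by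
    refine Ring.two_ne_zero fun h => ?_
    rw [Nat.card_eq_fintype_card] at hodd
    exact Nat.not_even_iff_odd.mpr hodd ((FiniteField.even_card_iff_char_two).mp h |> Nat.even_iff.mpr)
  have hcount := le_card_tangents_add_card_three_secants h2 hS
  have hdisj : Disjoint (secants S 1) (secants S 3) := by
    rw [Finset.disjoint_left]
    intro ℓ h1 h3
    have h1 := (Finset.mem_filter.mp h1).2
    have h3 := (Finset.mem_filter.mp h3).2
    omega
  have hle := card_odd_lines_le S (secants S 1 ∪ secants S 3) fun ℓ hℓ => by
    rcases Finset.mem_union.mp hℓ with h | h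
    · rw [(Finset.mem_filter.mp h).2]; exact odd_one
    · rw [(Finset.mem_filter.mp h).2]; decide
  rw [Finset.card_union_of_disjoint hdisj] at hle
  omega
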